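/- Let $k$ be a field. A quasi-Hopf algebra over $k$ consists of: a unital associative $k$-algebra $H$; algebra maps $\Delta:H\to H\otimes H$, $\Delta(h)=\sum h_1\otimes h_2$, and $\varepsilon:H\to k$; an invertible $\Phi=\sum X^1\otimes X^2\otimes X^3\in H\otimes H\otimes H$ with inverse $\Phi^{-1}=\sum x^1\otimes x^2\otimes x^3$; a linear map $S:H\to H$ with $S(1)=1$, $S(ab)=S(b)S(a)$ (not assumed bijective); and $\alpha,\beta\in H$; such that for all $h\in H$ $$(\mathrm{id}\otimes\Delta)\Delta(h)=\Phi\,(\Delta\otimes \mathrm{id})\Delta(h)\,\Phi^{-1},\quad (\mathrm{id}\otimes\varepsilon)\Delta(h)=h\otimes 1,\quad (\varepsilon\otimes \mathrm{id})\Delta(h)=1\otimes h,$$ $$(1\otimes\Phi)(\mathrm{id}\otimes\Delta\otimes \mathrm{id})(\Phi)(\Phi\otimes1)=(\mathrm{id}\otimes \mathrm{id}\otimes\Delta)(\Phi)(\Delta\otimes \mathrm{id}\otimes \mathrm{id})(\Phi),\quad (\mathrm{id}\otimes\varepsilon\otimes \mathrm{id})(\Phi)=1\otimes1\otimes1,$$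 $$\sum S(h_1)\alpha h_2=\varepsilon(h)\alpha,\quad \sum h_1\beta S(h_2)=\varepsilon(h)\beta,\quad \sum X^1\beta S(X^2)\alpha X^3=1,\quad \sum S(x^1)\alpha x^2\beta S(x^3)=1.$$ Let $H$ be a finite-dimensional quasi-Hopf algebra. Put $\Delta^{op}(h)=\sum h_2\otimes h_1$ and $$\sum A^1\otimes A^2\otimes A^3\otimes A^4=(\Phi\otimes1)(\Delta\otimes \mathrm{id}\otimes \mathrm{id})(\Phi^{-1}),\qquad \gamma=\sum S(A^2)\alpha A^3\otimes S(A^1)\alpha A^4,$$ $$\sum B^1\otimes B^2\otimes B^3\otimes B^4=(\Delta\otimes \mathrm{id}\otimes \mathrm{id})(\Phi)(\Phi^{-1}\otimes1),\qquad \delta=\sum B^1\beta S(B^4)\otimes B^2\beta S(B^3),$$ $$f=\sum f^1\otimes f^2=\sum (S\otimes S)(\Delta^{op}(x^1))\,\gamma\,\Delta(x^2\beta S(x^3)),$$ $$f^{-1}=\sum g^1\otimes g^2=\sum \Delta(S(x^1)\alpha x^2)\,\delta\,(S\otimes S)(\Delta^{op}(x^3)),$$ $$p_R=\sum p^1\otimes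 p^2=\sum x^1\otimes x^2\beta S(x^3),\qquad q_R=\sum q^1\otimes q^2=\sum X^1\otimes S^{-1}(\alpha X^3)X^2,$$ $$U=\sum U^1\otimes U^2=\sum g^1S(q^2)\otimes g^2S(q^1),\qquad V=\sum V^1\otimes V^2=\sum S^{-1}(f^2p^2)\otimes S^{-1}(f^1p^1).$$ Let $\mu\in H^*$ be the distinguished grouplike element: $th=\mu(h)t$ for all $h\in H$ and all left integrals $t$ in $H$ (that is, all $t\in H$ with $ht=\varepsilon(h)t$ for every $h\in H$). Let $(e_i)$ be a basis of $H$ with dual basis $(e^i)$ of $H^*$, and equip $H^*$ with the actions and coaction $$(h\cdot\varphi\cdot h')(a)=\varphi(S^{-1}(h)\,a\,S(h')),\qquad \rho(\varphi)=\sum\varphi_{(0)}\otimes\varphi_{(1)}=\sum_i (e^i*\varphi)\otimes e_i,$$ $$(\varphi*\psi)(h)=\sum\varphi(V^1h_1U^1)\,\psi(V^2h_2U^2).$$ An element $\lambda\in H^*$ is called a left cointegral on $H$ (in the sense of Hausser and Nill) if it is a coinvariant of $H^*$, i.e. $E(\lambda)=\lambda$, where $E(\varphi)=\sum X^1\cdot\varphi_{(0)}\cdot\beta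 S(X^2\varphi_{(1)})\alpha X^3$. **Proposition 3.4.** The antipode $S$ is bijective (so that $S^{-1}$ above makes sense), and for every $\lambda\in H^*$ the following statements are equivalent: (a) $\lambda$ is a left cointegral on $H$; (b) for all $h\in H$, $$\sum\lambda\big(S^{-1}(f^1)h_2S^{-1}(q^1g^1)\big)\,S^{-1}(f^2)h_1S^{-1}(q^2g^2)=\sum\mu(q^1_1x^1)\,\lambda\big(hS^{-1}(f^1)g^2S(q^1_2x^2)\big)\,q^2x^3S^{-1}\big(S^{-1}(f^2)g^1\big);$$ (c) for all $h\in H$, $$\sum\lambda\big(S^{-1}(f^1)h_2U^2\big)\,S^{-1}(f^2)h_1U^1=\sum\mu(q^1_1x^1)\,\lambda\big(hS(q^1_2x^2)\big)\,q^2x^3 .$$ -/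

import Mathlib

open scoped TensorProduct

noncomputable section

section SweedlerMaps

variable {k H : Type*} [Field k] [Ring H] [Algebra k H]

/-- `a ⊗ b ↦ S(a) α b`. -/
def sAlpha (S : H →ₗ[k] H) (α : H) : H ⊗[k] H →ₗ[k] H :=
  LinearMap.mul' k H ∘ₗ TensorProduct.map (LinearMap.mulRight k α ∘ₗ S) LinearMap.id

/-- `a ⊗ b ↦ a β S(b)`. -/
def betaS (S : H →ₗ[k] H) (β : H) : H ⊗[k] H →ₗ[k] H :=
  LinearMap.mul' k H ∘ₗ TensorProduct.map (LinearMap.mulRight k β) S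

/-- `a ⊗ (b ⊗ c) ↦ a β S(b) α c`. -/
def betaSAlpha (S : H →ₗ[k] H) (α β : H) : H ⊗[k] (H ⊗[k] H) →ₗ[k] H :=
  LinearMap.mul' k H ∘ₗ TensorProduct.map (LinearMap.mulRight k β) (sAlpha S α)

/-- `a ⊗ (b ⊗ c) ↦ S(a) α b β S(c)`. -/
def sAlphaBetaS (S : H →ₗ[k] H) (α β : H) : H ⊗[k] (H ⊗[k] H) →ₗ[k] H :=
  LinearMap.mul' k H ∘ₗ TensorProduct.map (LinearMap.mulRight k α ∘ₗ S) (betaS S β)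

/-- `a ⊗ b ↦ φ(a) b`. -/
def contractLeft₂ (φ : Module.Dual k H) : H ⊗[k] H →ₗ[k] H :=
  (TensorProduct.lid k H).toLinearMap ∘ₗ TensorProduct.map φ LinearMap.id

/-- `a ⊗ b ↦ φ(b) a`. -/
def contractRight₂ (φ : Module.Dual k H) : H ⊗[k] H →ₗ[k] H :=
  (TensorProduct.rid k H).toLinearMap ∘ₗ TensorProduct.map LinearMap.id φ

/-- `a ⊗ (b ⊗ c) ↦ φ(a) ψ(b) c`. -/
def contractLeft₃ (φ ψ : Module.Dual k H) : H ⊗[k] (H ⊗[k] H) →ₗ[k] H :=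
  (TensorProduct.lid k H).toLinearMap ∘ₗ TensorProduct.map φ (contractLeft₂ ψ)

/-- `(a ⊗ b, c ⊗ d) ↦ a c ⊗ d b`. -/
def outerMul : H ⊗[k] H →ₗ[k] H ⊗[k] H →ₗ[k] H ⊗[k] H :=
  TensorProduct.map₂ (LinearMap.mul k H) (LinearMap.mul k H).flip

@[simp] theorem outerMul_tmul (a b c d : H) :
    outerMul (k := k) (a ⊗ₜ b) (c ⊗ₜ d) = (a * c) ⊗ₜ (d * b) := rfl

@[simp] theorem sAlpha_tmul (S : H →ₗ[k] H) (α a b : H) :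
    sAlpha S α (a ⊗ₜ b) = S a * α * b := rfl

@[simp] theorem betaS_tmul (S : H →ₗ[k] H) (β a b : H) :
    betaS S β (a ⊗ₜ b) = a * β * S b := rfl

@[simp] theorem betaSAlpha_tmul (S : H →ₗ[k] H) (α β a b c : H) :
    betaSAlpha S α β (a ⊗ₜ (b ⊗ₜ c)) = a * β * (S b * α * c) := rfl

@[simp] theorem sAlphaBetaS_tmul (S : H →ₗ[k] H) (α β a b c : H) :
    sAlphaBetaS S α β (a ⊗ₜ (b ⊗ₜ c)) = S a * α * (b * β * S c) := rfl

@[simp] theorem contractLeft₂_tmul (φ : Module.Dual k H) (a b : H) :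
    contractLeft₂ φ (a ⊗ₜ b) = φ a • b := rfl

@[simp] theorem contractRight₂_tmul (φ : Module.Dual k H) (a b : H) :
    contractRight₂ φ (a ⊗ₜ b) = φ b • a := rfl

@[simp] theorem contractLeft₃_tmul (φ ψ : Module.Dual k H) (a b c : H) :
    contractLeft₃ φ ψ (a ⊗ₜ (b ⊗ₜ c)) = φ a • ψ b • c := rfl

end SweedlerMaps

/-- A quasi-bialgebra over the field `k`. Triple and fourfold tensor powers are bracketed to the
right. -/
class QuasiBialgebra (k H : Type*) [Field k] [Ring H] [Algebra k H] where
  /-- the comultiplication `Δ` -/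
  comul : H →ₐ[k] H ⊗[k] H
  /-- the counit `ε` -/
  counit : H →ₐ[k] k
  /-- the (invertible) reassociator `Φ` -/
  reassociator : (H ⊗[k] (H ⊗[k] H))ˣ
  /-- `(id ⊗ Δ)(Δ(h)) = Φ (Δ ⊗ id)(Δ(h)) Φ⁻¹` -/
  quasi_coassoc : ∀ h : H,
    Algebra.TensorProduct.map (AlgHom.id k H) comul (comul h) =
      (reassociator : H ⊗[k] (H ⊗[k] H)) *
        Algebra.TensorProduct.assoc k k k H H H
          (Algebra.TensorProduct.map comul (AlgHom.id k H) (comul h)) *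
        ((reassociator⁻¹ : (H ⊗[k] (H ⊗[k] H))ˣ) : H ⊗[k] (H ⊗[k] H))
  /-- `(id ⊗ ε)(Δ(h)) = h ⊗ 1` -/
  id_counit_comul : ∀ h : H,
    Algebra.TensorProduct.map (AlgHom.id k H) counit (comul h) = h ⊗ₜ[k] (1 : k)
  /-- `(ε ⊗ id)(Δ(h)) = 1 ⊗ h` -/
  counit_id_comul : ∀ h : H,
    Algebra.TensorProduct.map counit (AlgHom.id k H) (comul h) = (1 : k) ⊗ₜ[k] h
  /-- `(1 ⊗ Φ) (id ⊗ Δ ⊗ id)(Φ) (Φ ⊗ 1) = (id ⊗ id ⊗ Δ)(Φ) (Δ ⊗ id ⊗ id)(Φ)` -/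
  cocycle :
    ((1 : H) ⊗ₜ[k] (reassociator : H ⊗[k] (H ⊗[k] H))) *
      Algebra.TensorProduct.map (AlgHom.id k H)
        ((Algebra.TensorProduct.assoc k k k H H H).toAlgHom.comp
          (Algebra.TensorProduct.map comul (AlgHom.id k H))) reassociator *
      Algebra.TensorProduct.map (AlgHom.id k H) (Algebra.TensorProduct.assoc k k k H H H).toAlgHom
        (Algebra.TensorProduct.assoc k k k H (H ⊗[k] H) H
          ((reassociator : H ⊗[k] (H ⊗[k] H)) ⊗ₜ[k] (1 : H))) =
    Algebra.TensorProduct.map (AlgHom.id k H)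
        (Algebra.TensorProduct.map (AlgHom.id k H) comul) reassociator *
      Algebra.TensorProduct.assoc k k k H H (H ⊗[k] H)
        (Algebra.TensorProduct.map comul (AlgHom.id k (H ⊗[k] H)) reassociator)
  /-- `(id ⊗ ε ⊗ id)(Φ) = 1 ⊗ 1 ⊗ 1` -/
  id_counit_id_reassociator :
    Algebra.TensorProduct.map (AlgHom.id k H)
      (Algebra.TensorProduct.map counit (AlgHom.id k H)) reassociator =
        (1 : H) ⊗ₜ[k] ((1 : k) ⊗ₜ[k] (1 : H))

/-- A quasi-Hopf algebra over the field `k`. The antipode is a unital anti-endomorphism of the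
algebra; it is not required to be bijective. -/
class QuasiHopfAlgebra (k H : Type*) [Field k] [Ring H] [Algebra k H] extends
    QuasiBialgebra k H where
  /-- the antipode `S` -/
  antipode : H →ₗ[k] H
  antipode_one : antipode 1 = 1
  antipode_mul : ∀ a b : H, antipode (a * b) = antipode b * antipode a
  /-- the element `α` -/
  α : H
  /-- the element `β` -/
  β : H
  /-- `∑ S(h₁) α h₂ = ε(h) α` -/
  antipode_left : ∀ h : H, sAlpha antipode α (comul h) = counit h • α
  /-- `∑ h₁ β S(h₂) = ε(h) β` -/
  antipode_right : ∀ h : H, betaS antipode β (comul h) = counit h • β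
  /-- `∑ X¹ β S(X²) α X³ = 1` -/
  antipode_reassociator : betaSAlpha antipode α β (reassociator : H ⊗[k] (H ⊗[k] H)) = 1
  /-- `∑ S(x¹) α x² β S(x³) = 1` -/
  antipode_reassociator_inv :
    sAlphaBetaS antipode α β
      ((reassociator⁻¹ : (H ⊗[k] (H ⊗[k] H))ˣ) : H ⊗[k] (H ⊗[k] H)) = 1

/-- The coinvariant projection `E(m) = ∑ X¹ · m₍₀₎ · β S(X² m₍₁₎) α X³` on a space `M` with left
action `L`, right action `R` and coaction `ρ`, where `Φ = ∑ X¹ ⊗ X² ⊗ X³`. -/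
def QuasiHopfAlgebra.coinvariantProjection {k H M : Type*} [Field k] [Ring H] [Algebra k H]
    [QuasiHopfAlgebra k H] [AddCommGroup M] [Module k M]
    (L : H →ₗ[k] M →ₗ[k] M) (R : M →ₗ[k] H →ₗ[k] M) (ρ : M →ₗ[k] M ⊗[k] H) : M →ₗ[k] M :=
  TensorProduct.lift R ∘ₗ
    -- `m ⊗ (y ⊗ z) ↦ m ⊗ β S(y) α z`
    TensorProduct.map LinearMap.id
      (LinearMap.mulLeft k (QuasiHopfAlgebra.β k : H) ∘ₗ
        sAlpha QuasiHopfAlgebra.antipode (QuasiHopfAlgebra.α k)) ∘ₗ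
    -- `m ⊗ c ↦ ∑ X¹ · m ⊗ (X² c ⊗ X³)`
    TensorProduct.map₂ L (LinearMap.mul k (H ⊗[k] H))
      (QuasiBialgebra.reassociator : (H ⊗[k] (H ⊗[k] H))ˣ) ∘ₗ
    TensorProduct.map LinearMap.id
      (Algebra.TensorProduct.includeLeft : H →ₐ[k] H ⊗[k] H).toLinearMap ∘ₗ ρ

namespace QuasiHopfAlgebra

open QuasiBialgebra

variable (k H : Type*) [Field k] [Ring H] [Algebra k H] [QuasiHopfAlgebra k H]

/-- The reassociator `Φ` as an element. -/
def Phi : H ⊗[k] (H ⊗[k] H) := ((reassociator : (H ⊗[k] (H ⊗[k] H))ˣ) : H ⊗[k] (H ⊗[k] H))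

/-- The inverse `Φ⁻¹` as an element. -/
def PhiInv : H ⊗[k] (H ⊗[k] H) :=
  ((reassociator⁻¹ : (H ⊗[k] (H ⊗[k] H))ˣ) : H ⊗[k] (H ⊗[k] H))

/-- The compositional inverse `S⁻¹` of the antipode: `Ring.inverse` in the ring of `k`-linear
endomorphisms of `H` is the two-sided inverse of `S` when `S` is bijective. -/
def antipodeInv : H →ₗ[k] H := Ring.inverse (antipode : Module.End k H)

/-- `a ⊗ b ↦ S(b) ⊗ S(a)`. -/
def antipodeFlip : H ⊗[k] H →ₗ[k] H ⊗[k] H :=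
  TensorProduct.map antipode antipode ∘ₗ (TensorProduct.comm k H H).toLinearMap

/-- `a ⊗ b ↦ S⁻¹(b) ⊗ S⁻¹(a)`. -/
def antipodeInvFlip : H ⊗[k] H →ₗ[k] H ⊗[k] H :=
  TensorProduct.map (antipodeInv k H) (antipodeInv k H) ∘ₗ (TensorProduct.comm k H H).toLinearMap

/-- `a ⊗ (b ⊗ (c ⊗ d)) ↦ (b ⊗ c) ⊗ (a ⊗ d)`. -/
def innerOuter : H ⊗[k] (H ⊗[k] (H ⊗[k] H)) →ₗ[k] (H ⊗[k] H) ⊗[k] (H ⊗[k] H) :=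
  (TensorProduct.leftComm k H (H ⊗[k] H) H).toLinearMap ∘ₗ
    TensorProduct.map LinearMap.id (TensorProduct.assoc k H H H).symm.toLinearMap

/-- `x ⊗ 1` in the fourfold tensor power, for `x` in the threefold one. -/
def tensorOne (x : H ⊗[k] (H ⊗[k] H)) : H ⊗[k] (H ⊗[k] (H ⊗[k] H)) :=
  Algebra.TensorProduct.map (AlgHom.id k H) (Algebra.TensorProduct.assoc k k k H H H).toAlgHom
    (Algebra.TensorProduct.assoc k k k H (H ⊗[k] H) H (x ⊗ₜ[k] (1 : H)))

/-- `(Δ ⊗ id ⊗ id)(x)`. -/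
def comulFirst (x : H ⊗[k] (H ⊗[k] H)) : H ⊗[k] (H ⊗[k] (H ⊗[k] H)) :=
  Algebra.TensorProduct.assoc k k k H H (H ⊗[k] H)
    (Algebra.TensorProduct.map comul (AlgHom.id k (H ⊗[k] H)) x)

/-- `γ = ∑ S(A²) α A³ ⊗ S(A¹) α A⁴`, where
`∑ A¹ ⊗ A² ⊗ A³ ⊗ A⁴ = (Φ ⊗ 1) (Δ ⊗ id ⊗ id)(Φ⁻¹)`. -/
def gam : H ⊗[k] H :=
  TensorProduct.map (sAlpha antipode (α k)) (sAlpha antipode (α k))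
    (innerOuter k H (tensorOne k H (Phi k H) * comulFirst k H (PhiInv k H)))

/-- `δ = ∑ B¹ β S(B⁴) ⊗ B² β S(B³)`, where
`∑ B¹ ⊗ B² ⊗ B³ ⊗ B⁴ = (Δ ⊗ id ⊗ id)(Φ) (Φ⁻¹ ⊗ 1)`. -/
def del : H ⊗[k] H :=
  TensorProduct.comm k H H
    (TensorProduct.map (betaS antipode (β k)) (betaS antipode (β k))
      (innerOuter k H (comulFirst k H (Phi k H) * tensorOne k H (PhiInv k H))))

/-- The twist `f = ∑ (S ⊗ S)(Δᵒᵖ(x¹)) γ Δ(x² β S(x³))`, where `Φ⁻¹ = ∑ x¹ ⊗ x² ⊗ x³`. -/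
def twistF : H ⊗[k] H :=
  (LinearMap.mul' k (H ⊗[k] H) ∘ₗ
    TensorProduct.map
      (LinearMap.mulRight k (gam k H) ∘ₗ antipodeFlip k H ∘ₗ comul.toLinearMap)
      (comul.toLinearMap ∘ₗ betaS antipode (β k))) (PhiInv k H)

/-- The inverse twist `f⁻¹ = ∑ Δ(S(x¹) α x²) δ (S ⊗ S)(Δᵒᵖ(x³))`, where
`Φ⁻¹ = ∑ x¹ ⊗ x² ⊗ x³`. -/
def twistFInv : H ⊗[k] H :=
  (LinearMap.mul' k (H ⊗[k] H) ∘ₗ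
    TensorProduct.map
      (LinearMap.mulRight k (del k H) ∘ₗ comul.toLinearMap ∘ₗ sAlpha antipode (α k))
      (antipodeFlip k H ∘ₗ comul.toLinearMap))
    ((TensorProduct.assoc k H H H).symm (PhiInv k H))

/-- `p_R = ∑ x¹ ⊗ x² β S(x³)`, where `Φ⁻¹ = ∑ x¹ ⊗ x² ⊗ x³`. -/
def pR : H ⊗[k] H :=
  TensorProduct.map LinearMap.id (betaS antipode (β k)) (PhiInv k H)

/-- `q_R = ∑ X¹ ⊗ S⁻¹(α X³) X²`, where `Φ = ∑ X¹ ⊗ X² ⊗ X³`. -/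
def qR : H ⊗[k] H :=
  TensorProduct.map LinearMap.id
    (LinearMap.mul' k H ∘ₗ
      TensorProduct.map (antipodeInv k H ∘ₗ LinearMap.mulLeft k (α k)) LinearMap.id ∘ₗ
      (TensorProduct.comm k H H).toLinearMap) (Phi k H)

/-- `U = ∑ g¹ S(q²) ⊗ g² S(q¹)`, where `f⁻¹ = ∑ g¹ ⊗ g²` and `q_R = ∑ q¹ ⊗ q²`. -/
def U : H ⊗[k] H := twistFInv k H * antipodeFlip k H (qR k H)

/-- `V = ∑ S⁻¹(f² p²) ⊗ S⁻¹(f¹ p¹)`, where `f = ∑ f¹ ⊗ f²` and `p_R = ∑ p¹ ⊗ p²`. -/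
def V : H ⊗[k] H := antipodeInvFlip k H (twistF k H * pR k H)

variable {k H}

/-- The multiplication `(φ * ψ)(h) = ∑ φ(V¹ h₁ U¹) ψ(V² h₂ U²)` on `H*`. -/
def dualMul (φ ψ : Module.Dual k H) : Module.Dual k H :=
  LinearMap.mul' k k ∘ₗ TensorProduct.map φ ψ ∘ₗ
    LinearMap.mulRight k (U k H) ∘ₗ LinearMap.mulLeft k (V k H) ∘ₗ comul.toLinearMap

variable (k H)

/-- The left action `(h · φ)(a) = φ(S⁻¹(h) a)` of `H` on `H*`. -/
def dualLeft : H →ₗ[k] Module.Dual k H →ₗ[k] Module.Dual k H :=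
  LinearMap.mk₂ k (fun h φ => φ ∘ₗ LinearMap.mulLeft k (antipodeInv k H h))
    (fun _ _ _ => by ext; simp [add_mul]) (fun _ _ _ => by ext; simp)
    (fun _ _ _ => by ext; simp) (fun _ _ _ => by ext; simp)

/-- The right action `(φ · h)(a) = φ(a S(h))` of `H` on `H*`. -/
def dualRight : Module.Dual k H →ₗ[k] H →ₗ[k] Module.Dual k H :=
  LinearMap.mk₂ k (fun φ h => φ ∘ₗ LinearMap.mulRight k ((antipode : H →ₗ[k] H) h))
    (fun _ _ _ => by ext; simp) (fun _ _ _ => by ext; simp)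
    (fun _ _ _ => by ext; simp [mul_add]) (fun _ _ _ => by ext; simp)

/-- The coaction `ρ(φ) = ∑ᵢ (eⁱ * φ) ⊗ eᵢ` of `H` on `H*`, for a basis `eᵢ` of `H` with dual
basis `eⁱ` (the sum does not depend on the basis). -/
def dualCoaction [FiniteDimensional k H] :
    Module.Dual k H →ₗ[k] Module.Dual k H ⊗[k] H where
  toFun φ := ∑ i, dualMul ((Module.finBasis k H).coord i) φ ⊗ₜ[k] Module.finBasis k H i
  map_add' φ ψ := by
    simp [dualMul, TensorProduct.map_add_right, LinearMap.add_comp, LinearMap.comp_add,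
      TensorProduct.add_tmul, Finset.sum_add_distrib]
  map_smul' c φ := by
    simp [dualMul, TensorProduct.map_smul_right, LinearMap.smul_comp, LinearMap.comp_smul,
      TensorProduct.smul_tmul', Finset.smul_sum]

variable {k H}

/-- `l` is a left cointegral on `H` in the sense of Hausser and Nill: it is a coinvariant of the
right quasi-Hopf `H`-bimodule `H*`, that is, `E(l) = l`. -/
def IsLeftCointegral [FiniteDimensional k H] (l : Module.Dual k H) : Prop :=
  coinvariantProjection (dualLeft k H) (dualRight k H) (dualCoaction k H) l = l

variable (k)

/-- `t` is a left integral in `H`: `h t = ε(h) t` for all `h`. -/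
def IsLeftIntegral (t : H) : Prop := ∀ h : H, h * t = (counit h : k) • t

variable {k}

/-- `μ` is the distinguished grouplike element (modulus) of `H*`: `t h = μ(h) t` for all left
integrals `t` in `H` and all `h`. For finite-dimensional `H` it exists, is unique, and is an
algebra map, because the space of left integrals is one-dimensional. -/
def IsDistinguishedGrouplike (μ : Module.Dual k H) : Prop :=
  ∀ t : H, IsLeftIntegral k t → ∀ h : H, t * h = μ h • t

variable (k H)

/-- `∑ q¹₁ x¹ ⊗ (q¹₂ x² ⊗ q² x³) = (Δ ⊗ id)(q_R) Φ⁻¹`. -/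
def qx : H ⊗[k] (H ⊗[k] H) :=
  Algebra.TensorProduct.assoc k k k H H H
    (Algebra.TensorProduct.map comul (AlgHom.id k H) (qR k H)) * PhiInv k H

/-- `∑ S⁻¹(f¹) g² ⊗ S⁻¹(S⁻¹(f²) g¹)`, where `f = ∑ f¹ ⊗ f²` and `f⁻¹ = ∑ g¹ ⊗ g²`. -/
def fg : H ⊗[k] H :=
  TensorProduct.map LinearMap.id (antipodeInv k H)
    (TensorProduct.map (antipodeInv k H) (antipodeInv k H) (twistF k H) *
      TensorProduct.comm k H H (twistFInv k H))

variable {k H}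

/-- `∑ l(S⁻¹(f¹) h₂ S⁻¹(q¹ g¹)) S⁻¹(f²) h₁ S⁻¹(q² g²)`. -/
def twistIdentityLeft (l : Module.Dual k H) (h : H) : H :=
  contractRight₂ l (antipodeInvFlip k H (twistF k H) * comul h *
    antipodeInvFlip k H (qR k H * twistFInv k H))

/-- `∑ μ(q¹₁ x¹) l(h S⁻¹(f¹) g² S(q¹₂ x²)) q² x³ S⁻¹(S⁻¹(f²) g¹)`. -/
def twistIdentityRight (μ l : Module.Dual k H) (h : H) : H :=
  contractLeft₂ (l ∘ₗ LinearMap.mulLeft k h)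
    (outerMul (fg k H)
      -- `∑ μ(q¹₁ x¹) S(q¹₂ x²) ⊗ q² x³`
      (TensorProduct.map antipode LinearMap.id
        (TensorProduct.lid k (H ⊗[k] H) (TensorProduct.map μ LinearMap.id (qx k H)))))

/-- `∑ l(S⁻¹(f¹) h₂ U²) S⁻¹(f²) h₁ U¹`. -/
def uIdentityLeft (l : Module.Dual k H) (h : H) : H :=
  contractRight₂ l (antipodeInvFlip k H (twistF k H) * comul h * U k H)

/-- `∑ μ(q¹₁ x¹) l(h S(q¹₂ x²)) q² x³`. -/
def uIdentityRight (μ l : Module.Dual k H) (h : H) : H :=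
  contractLeft₃ μ (l ∘ₗ LinearMap.mulLeft k h ∘ₗ antipode) (qx k H)

end QuasiHopfAlgebra

end

set_option linter.unusedSectionVars false

open scoped TensorProduct

/-! Antipode. If algebra maps φ, ψ agree on the image of S, then ∑ ψ(X¹βS(X²)) φ(αX³) intertwines φ
and ψ and turns out to be 1, so φ = ψ: the antipode is an epimorphism
(`algHom_eq_of_comp_antipode`), and so are all powers of S². The Fitting decomposition of a high
power T of S² gives an algebra projection of H onto the range of T. It agrees with the identity on
that range, hence it is the identity, so T is injective, and S with it (`antipode_bijective`).

Equivalence of (a) and (c). The twist f is invertible and intertwines Δ ∘ S with (S ⊗ S) ∘ Δᵒᵖ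
(`twistF_mul_comul_antipode`, `twistFInv_mul_twistF`). The resulting relations for U and V make H* a
right quasi-Hopf bimodule (`isHopfBimodule_dual`), whose coinvariants are the left cointegrals. In
such a bimodule M one has m = ∑ E(m₀)·m₁ and (E ⊗ id)ρ(E(m)) = E(m) ⊗ 1, so M is the coinvariants
tensored with H. Counting dimensions, the cointegrals of H form a line spanned by some l₀, and y ↦
l₀·y is a bijection from H to H*. The rule E(h·l₀) = χ(h) l₀ defines a character, and evaluation at
a left integral shows χ = μ (`projection_dualLeft`). A cointegral l therefore satisfies h·l = ∑
μ(h₁) l·h₂ and ρ(l) = ∑ μ(x¹) l·x² ⊗ x³. Evaluating the second formula at S⁻¹(q¹)h and simplifying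
by the first yields (c), because S⁻¹(f²) ⊗ S⁻¹(f¹) = ∑ (q² ⊗ 1) V Δ(S⁻¹(q¹)). Conversely, every
functional has the form l₀·y. If it satisfies (c), then m Δ(y) = (y ⊗ 1) m for m = ∑ μ(q¹₁x¹) q¹₂x²
⊗ q²x³; applying a ⊗ b ↦ aβS(b), which sends m to 1, gives y = ε(y)1, so the functional is a
multiple of l₀.

Equivalence of (b) and (c). Put w ⊗ z = S⁻¹(f¹)g² ⊗ S⁻¹(S⁻¹(f²)g¹). Either side of (b) at h is the
matching side of (c) at hw, multiplied on the right by z. For the left sides this is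
`antipodeInvFlip_qR_mul_twistFInv`. Since w ⊗ z is left invertible in H ⊗ Hᵒᵖ, the two families of
identities are equivalent.

Most computations with Φ follow one pattern. A multilinear expression containing bβS(c) or S(b)αc
absorbs a coproduct inserted at these places, hence also a whole factor such as (id ⊗ Δ ⊗ id)(Φ).
The pentagon moves factors into places where they are absorbed, and the surviving factor is
evaluated by one of the antipode axioms. -/

noncomputable section

/-! ### Multilinear maps and equality checks on pure tensors -/

section Multilinear

variable {k A B C D M N : Type*} [Field k] [AddCommGroup A] [Module k A] [AddCommGroup B]
  [Module k B] [AddCommGroup C] [Module k C] [AddCommGroup D] [Module k D] [AddCommGroup M]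
  [Module k M] [AddCommGroup N] [Module k N]

/-- The linear map on `A ⊗ B` given by a function that is linear in each variable. -/
def lin₂ (F : A → B → M)
    (h₁ : ∀ b, IsLinearMap k (fun a => F a b) := by
      intros; constructor <;> intros <;> simp [add_mul, mul_add, TensorProduct.add_tmul,
        TensorProduct.tmul_add, ← TensorProduct.smul_tmul', add_smul, mul_smul, smul_comm])
    (h₂ : ∀ a, IsLinearMap k (F a) := by
      intros; constructor <;> intros <;> simp [add_mul, mul_add, TensorProduct.add_tmul,
        TensorProduct.tmul_add, ← TensorProduct.smul_tmul', add_smul, mul_smul, smul_comm]) :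
    A ⊗[k] B →ₗ[k] M :=
  TensorProduct.lift (LinearMap.mk₂ k F (fun a a' b => (h₁ b).map_add a a')
    (fun c a b => (h₁ b).map_smul c a) (fun a => (h₂ a).map_add)
    (fun c a b => (h₂ a).map_smul c b))

@[simp] theorem lin₂_tmul (F : A → B → M) (h₁ : ∀ b, IsLinearMap k (fun a => F a b))
    (h₂ : ∀ a, IsLinearMap k (F a)) (a : A) (b : B) : lin₂ F h₁ h₂ (a ⊗ₜ b) = F a b := rfl

/-- The linear map on `A ⊗ (B ⊗ C)` given by a function that is linear in each variable. -/
def lin₃ (F : A → B → C → M)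
    (h₁ : ∀ b c, IsLinearMap k (fun a => F a b c) := by
      intros; constructor <;> intros <;> simp [add_mul, mul_add, TensorProduct.add_tmul,
        TensorProduct.tmul_add, ← TensorProduct.smul_tmul', add_smul, mul_smul, smul_comm])
    (h₂ : ∀ a c, IsLinearMap k (fun b => F a b c) := by
      intros; constructor <;> intros <;> simp [add_mul, mul_add, TensorProduct.add_tmul,
        TensorProduct.tmul_add, ← TensorProduct.smul_tmul', add_smul, mul_smul, smul_comm])
    (h₃ : ∀ a b, IsLinearMap k (F a b) := by
      intros; constructor <;> intros <;> simp [add_mul, mul_add, TensorProduct.add_tmul,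
        TensorProduct.tmul_add, ← TensorProduct.smul_tmul', add_smul, mul_smul, smul_comm]) :
    A ⊗[k] (B ⊗[k] C) →ₗ[k] M :=
  lin₂ (fun a t => lin₂ (F a) (h₂ a) (h₃ a) t)
    (fun t => by
      induction t with
      | zero => constructor <;> simp
      | tmul b c => exact h₁ b c
      | add s t hs ht =>
        constructor
        · intro a b; simp only [map_add]
          rw [hs.map_add, ht.map_add]; abel
        · intro a b; simp only [map_add]
          rw [hs.map_smul, ht.map_smul, smul_add])
    (fun a => LinearMap.isLinear _)

@[simp] theorem lin₃_tmul (F : A → B → C → M) (h₁ : ∀ b c, IsLinearMap k (fun a => F a b c))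
    (h₂ : ∀ a c, IsLinearMap k (fun b => F a b c)) (h₃ : ∀ a b, IsLinearMap k (F a b))
    (a : A) (b : B) (c : C) : lin₃ F h₁ h₂ h₃ (a ⊗ₜ (b ⊗ₜ c)) = F a b c := rfl

/-- The linear map on `A ⊗ (B ⊗ (C ⊗ D))` given by a function that is linear in each variable. -/
def lin₄ (F : A → B → C → D → M)
    (h₁ : ∀ b c d, IsLinearMap k (fun a => F a b c d) := by
      intros; constructor <;> intros <;> simp [add_mul, mul_add, TensorProduct.add_tmul,
        TensorProduct.tmul_add, ← TensorProduct.smul_tmul', add_smul, mul_smul, smul_comm])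
    (h₂ : ∀ a c d, IsLinearMap k (fun b => F a b c d) := by
      intros; constructor <;> intros <;> simp [add_mul, mul_add, TensorProduct.add_tmul,
        TensorProduct.tmul_add, ← TensorProduct.smul_tmul', add_smul, mul_smul, smul_comm])
    (h₃ : ∀ a b d, IsLinearMap k (fun c => F a b c d) := by
      intros; constructor <;> intros <;> simp [add_mul, mul_add, TensorProduct.add_tmul,
        TensorProduct.tmul_add, ← TensorProduct.smul_tmul', add_smul, mul_smul, smul_comm])
    (h₄ : ∀ a b c, IsLinearMap k (F a b c) := by
      intros; constructor <;> intros <;> simp [add_mul, mul_add, TensorProduct.add_tmul,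
        TensorProduct.tmul_add, ← TensorProduct.smul_tmul', add_smul, mul_smul, smul_comm]) :
    A ⊗[k] (B ⊗[k] (C ⊗[k] D)) →ₗ[k] M :=
  lin₃ (fun a b t => lin₂ (F a b) (h₃ a b) (h₄ a b) t)
    (fun b t => by
      induction t with
      | zero => constructor <;> simp
      | tmul c d => exact h₁ b c d
      | add s t hs ht =>
        constructor
        · intro a b; simp only [map_add]
          rw [hs.map_add, ht.map_add]; abel
        · intro a b; simp only [map_add]
          rw [hs.map_smul, ht.map_smul, smul_add])
    (fun a t => by
      induction t with
      | zero => constructor <;> simp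
      | tmul c d => exact h₂ a c d
      | add s t hs ht =>
        constructor
        · intro a b; simp only [map_add]
          rw [hs.map_add, ht.map_add]; abel
        · intro a b; simp only [map_add]
          rw [hs.map_smul, ht.map_smul, smul_add])
    (fun a b => LinearMap.isLinear _)

@[simp] theorem lin₄_tmul (F : A → B → C → D → M)
    (h₁ : ∀ b c d, IsLinearMap k (fun a => F a b c d))
    (h₂ : ∀ a c d, IsLinearMap k (fun b => F a b c d))
    (h₃ : ∀ a b d, IsLinearMap k (fun c => F a b c d))
    (h₄ : ∀ a b c, IsLinearMap k (F a b c)) (a : A) (b : B) (c : C) (d : D) :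
    lin₄ F h₁ h₂ h₃ h₄ (a ⊗ₜ (b ⊗ₜ (c ⊗ₜ d))) = F a b c d := rfl

/-- This replaces Sweedler notation: an identity involving Δ(h), Φ or f says that two linear maps
agree at one tensor, and it is checked by letting that tensor be pure. Nested sums are opened one
tensor at a time. -/
theorem linearMap_congr₂ {f g : A ⊗[k] B →ₗ[k] M} (h : ∀ a b, f (a ⊗ₜ b) = g (a ⊗ₜ b)) (t) :
    f t = g t := by
  rw [TensorProduct.ext' h]

theorem linearMap_congr₃ {f g : A ⊗[k] (B ⊗[k] C) →ₗ[k] M}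
    (h : ∀ a b c, f (a ⊗ₜ (b ⊗ₜ c)) = g (a ⊗ₜ (b ⊗ₜ c))) (t) : f t = g t := by
  refine linearMap_congr₂ (fun a s => ?_) t
  exact linearMap_congr₂ (f := f ∘ₗ TensorProduct.mk k A _ a) (g := g ∘ₗ TensorProduct.mk k A _ a)
    (h a) s

theorem linearMap_congr₄ {f g : A ⊗[k] (B ⊗[k] (C ⊗[k] D)) →ₗ[k] M}
    (h : ∀ a b c d, f (a ⊗ₜ (b ⊗ₜ (c ⊗ₜ d))) = g (a ⊗ₜ (b ⊗ₜ (c ⊗ₜ d)))) (t) : f t = g t := by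
  refine linearMap_congr₂ (fun a s => ?_) t
  exact linearMap_congr₃ (f := f ∘ₗ TensorProduct.mk k A _ a) (g := g ∘ₗ TensorProduct.mk k A _ a)
    (h a) s

end Multilinear

namespace QuasiHopfAlgebra

open QuasiBialgebra

variable {k H : Type*} [Field k] [Ring H] [Algebra k H] [QuasiHopfAlgebra k H]

local notation "S" => (antipode : H →ₗ[k] H)
local notation "Δ" => (comul : H →ₐ[k] H ⊗[k] H)
local notation "ε" => (counit : H →ₐ[k] k)
local notation "αₕ" => (α k : H)
local notation "βₕ" => (β k : H)
local notation "Φ" => (Phi k H)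
local notation "Φ⁻" => (PhiInv k H)
local notation "H²" => (H ⊗[k] H)
local notation "H³" => (H ⊗[k] (H ⊗[k] H))
local notation "H⁴" => (H ⊗[k] (H ⊗[k] (H ⊗[k] H)))
local notation "S⁻" => antipodeInv k H
local notation "AF" => antipodeFlip k H
local notation "AIF" => antipodeInvFlip k H

instance ringThree : Ring H³ := inferInstance
set_option synthInstance.maxHeartbeats 200000 in
instance ringFour : Ring H⁴ := inferInstance
instance algebraThree : Algebra k H³ := inferInstance
instance algebraFour : Algebra k H⁴ := inferInstance

/-! ### Coproduct insertions into triple and fourfold tensor powers -/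

section Faces

variable (k H)

/-- `x ↦ 1 ⊗ x`. -/
def face₀ : H² →ₐ[k] H³ := Algebra.TensorProduct.includeRight
/-- `Δ ⊗ id`. -/
def face₁ : H² →ₐ[k] H³ :=
  (Algebra.TensorProduct.assoc k k k H H H).toAlgHom.comp
    (Algebra.TensorProduct.map comul (AlgHom.id k H))
/-- `id ⊗ Δ`. -/
def face₂ : H² →ₐ[k] H³ := Algebra.TensorProduct.map (AlgHom.id k H) comul
/-- `x ↦ x ⊗ 1`. -/
def face₃ : H² →ₐ[k] H³ :=
  (Algebra.TensorProduct.assoc k k k H H H).toAlgHom.comp Algebra.TensorProduct.includeLeft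

/-- `x ↦ 1 ⊗ x`. -/
def cell₀ : H³ →ₐ[k] H⁴ := Algebra.TensorProduct.includeRight
/-- `Δ ⊗ id ⊗ id`. -/
def cell₁ : H³ →ₐ[k] H⁴ :=
  (Algebra.TensorProduct.assoc k k k H H (H ⊗[k] H)).toAlgHom.comp
    (Algebra.TensorProduct.map comul (AlgHom.id k (H ⊗[k] H)))
/-- `id ⊗ Δ ⊗ id`. -/
def cell₂ : H³ →ₐ[k] H⁴ := Algebra.TensorProduct.map (AlgHom.id k H) (face₁ k H)
/-- `id ⊗ id ⊗ Δ`. -/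
def cell₃ : H³ →ₐ[k] H⁴ := Algebra.TensorProduct.map (AlgHom.id k H) (face₂ k H)
/-- `x ↦ x ⊗ 1`. -/
def cell₄ : H³ →ₐ[k] H⁴ := Algebra.TensorProduct.map (AlgHom.id k H) (face₃ k H)

/-- `x ↦ x ⊗ 1 ⊗ 1`. -/
def leg₁₂ : H² →ₐ[k] H⁴ := (cell₄ k H).comp (face₃ k H)
/-- `x ↦ 1 ⊗ x ⊗ 1`. -/
def leg₂₃ : H² →ₐ[k] H⁴ := (cell₄ k H).comp (face₀ k H)
/-- `x ↦ 1 ⊗ 1 ⊗ x`. -/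
def leg₃₄ : H² →ₐ[k] H⁴ := (cell₀ k H).comp (face₀ k H)

/-- `ε ⊗ id ⊗ id`. -/
def counit₁ : H³ →ₐ[k] H² :=
  (Algebra.TensorProduct.lid k H²).toAlgHom.comp
    (Algebra.TensorProduct.map counit (AlgHom.id k H²))
/-- `id ⊗ ε ⊗ id`. -/
def counit₂ : H³ →ₐ[k] H² :=
  Algebra.TensorProduct.map (AlgHom.id k H) ((Algebra.TensorProduct.lid k H).toAlgHom.comp
    (Algebra.TensorProduct.map counit (AlgHom.id k H)))
/-- `id ⊗ id ⊗ ε`. -/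
def counit₃ : H³ →ₐ[k] H² :=
  Algebra.TensorProduct.map (AlgHom.id k H) ((Algebra.TensorProduct.rid k k H).toAlgHom.comp
    (Algebra.TensorProduct.map (AlgHom.id k H) counit))

variable {k H}

theorem face₀_apply (t : H²) : face₀ k H t = 1 ⊗ₜ t := rfl
@[simp] theorem face₀_tmul (a b : H) : face₀ k H (a ⊗ₜ b) = 1 ⊗ₜ (a ⊗ₜ b) := rfl
@[simp] theorem face₃_tmul (a b : H) : face₃ k H (a ⊗ₜ b) = a ⊗ₜ (b ⊗ₜ 1) := rfl
theorem face₂_tmul (a b : H) : face₂ k H (a ⊗ₜ b) = a ⊗ₜ Δ b := rfl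
theorem cell₀_apply (t : H³) : cell₀ k H t = 1 ⊗ₜ t := rfl
@[simp] theorem cell₀_tmul (a b c : H) :
    cell₀ k H (a ⊗ₜ (b ⊗ₜ c)) = 1 ⊗ₜ (a ⊗ₜ (b ⊗ₜ c)) := rfl
@[simp] theorem cell₄_tmul (a b c : H) :
    cell₄ k H (a ⊗ₜ (b ⊗ₜ c)) = a ⊗ₜ (b ⊗ₜ (c ⊗ₜ 1)) := rfl
@[simp] theorem leg₁₂_tmul (a b : H) : leg₁₂ k H (a ⊗ₜ b) = a ⊗ₜ (b ⊗ₜ (1 ⊗ₜ 1)) := rfl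
@[simp] theorem leg₂₃_tmul (a b : H) : leg₂₃ k H (a ⊗ₜ b) = 1 ⊗ₜ (a ⊗ₜ (b ⊗ₜ 1)) := rfl
@[simp] theorem leg₃₄_tmul (a b : H) : leg₃₄ k H (a ⊗ₜ b) = 1 ⊗ₜ (1 ⊗ₜ (a ⊗ₜ b)) := rfl
@[simp] theorem counit₁_tmul (a b c : H) :
    counit₁ k H (a ⊗ₜ (b ⊗ₜ c)) = ε a • (b ⊗ₜ c) := rfl
@[simp] theorem counit₂_tmul (a b c : H) :
    counit₂ k H (a ⊗ₜ (b ⊗ₜ c)) = a ⊗ₜ (ε b • c) := rfl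
@[simp] theorem counit₃_tmul (a b c : H) :
    counit₃ k H (a ⊗ₜ (b ⊗ₜ c)) = a ⊗ₜ (ε c • b) := rfl

theorem one_two : (1 : H²) = 1 ⊗ₜ 1 := rfl
theorem one_three : (1 : H³) = 1 ⊗ₜ (1 ⊗ₜ 1) := rfl

/-- Δ(a) is not a pure tensor, so it is split off as a separate factor that can later be expanded
alone. The two factors occupy different legs and commute, whence the primed variants. -/
theorem face₁_tmul (a b : H) :
    face₁ k H (a ⊗ₜ b) = face₃ k H (Δ a) * (1 ⊗ₜ (1 ⊗ₜ b)) := by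
  change Algebra.TensorProduct.assoc k k k H H H (Δ a ⊗ₜ b) =
    Algebra.TensorProduct.assoc k k k H H H (Δ a ⊗ₜ 1) * (1 ⊗ₜ (1 ⊗ₜ b))
  induction Δ a with
  | zero => simp
  | tmul x y => simp
  | add x y hx hy => simp only [TensorProduct.add_tmul, map_add, add_mul, hx, hy]

theorem face₁_tmul' (a b : H) :
    face₁ k H (a ⊗ₜ b) = (1 ⊗ₜ (1 ⊗ₜ b)) * face₃ k H (Δ a) := by
  rw [face₁_tmul]
  induction Δ a with
  | zero => simp
  | tmul x y => simp
  | add x y hx hy => simp only [map_add, add_mul, mul_add, hx, hy]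

theorem face₂_tmul' (a b : H) :
    face₂ k H (a ⊗ₜ b) = (a ⊗ₜ (1 ⊗ₜ 1)) * face₀ k H (Δ b) := by
  rw [face₂_tmul, face₀_apply, ← one_two]; simp

theorem face₂_tmul'' (a b : H) :
    face₂ k H (a ⊗ₜ b) = face₀ k H (Δ b) * (a ⊗ₜ (1 ⊗ₜ 1)) := by
  rw [face₂_tmul, face₀_apply, ← one_two]; simp

theorem cell₁_tmul (a b c : H) :
    cell₁ k H (a ⊗ₜ (b ⊗ₜ c)) = leg₁₂ k H (Δ a) * (1 ⊗ₜ (1 ⊗ₜ (b ⊗ₜ c))) := by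
  change Algebra.TensorProduct.assoc k k k H H H² (Δ a ⊗ₜ (b ⊗ₜ c)) = _
  induction Δ a with
  | zero => simp
  | tmul x y => simp
  | add x y hx hy => simp only [TensorProduct.add_tmul, map_add, add_mul, hx, hy]

theorem cell₁_tmul' (a b c : H) :
    cell₁ k H (a ⊗ₜ (b ⊗ₜ c)) = (1 ⊗ₜ (1 ⊗ₜ (b ⊗ₜ c))) * leg₁₂ k H (Δ a) := by
  rw [cell₁_tmul]
  induction Δ a with
  | zero => simp
  | tmul x y => simp
  | add x y hx hy => simp only [map_add, add_mul, mul_add, hx, hy]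

theorem leg₂₃_apply (t : H²) : leg₂₃ k H t = 1 ⊗ₜ face₃ k H t := rfl

theorem cell₂_tmul (a b c : H) :
    cell₂ k H (a ⊗ₜ (b ⊗ₜ c)) = leg₂₃ k H (Δ b) * (a ⊗ₜ (1 ⊗ₜ (1 ⊗ₜ c))) := by
  change a ⊗ₜ face₁ k H (b ⊗ₜ c) = _
  rw [face₁_tmul, leg₂₃_apply]; simp

theorem cell₂_tmul' (a b c : H) :
    cell₂ k H (a ⊗ₜ (b ⊗ₜ c)) = (a ⊗ₜ (1 ⊗ₜ (1 ⊗ₜ c))) * leg₂₃ k H (Δ b) := by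
  change a ⊗ₜ face₁ k H (b ⊗ₜ c) = _
  rw [face₁_tmul', leg₂₃_apply]; simp

theorem cell₃_tmul (a b c : H) :
    cell₃ k H (a ⊗ₜ (b ⊗ₜ c)) = leg₃₄ k H (Δ c) * (a ⊗ₜ (b ⊗ₜ (1 ⊗ₜ 1))) := by
  change a ⊗ₜ (b ⊗ₜ Δ c) = (1 ⊗ₜ (1 ⊗ₜ Δ c)) * _
  rw [← one_two]; simp

theorem cell₃_tmul' (a b c : H) :
    cell₃ k H (a ⊗ₜ (b ⊗ₜ c)) = (a ⊗ₜ (b ⊗ₜ (1 ⊗ₜ 1))) * leg₃₄ k H (Δ c) := by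
  change a ⊗ₜ (b ⊗ₜ Δ c) = _ * (1 ⊗ₜ (1 ⊗ₜ Δ c))
  rw [← one_two]; simp

end Faces

theorem algHom_congr₃ {A : Type*} [Ring A] [Algebra k A] {F G : H³ →ₐ[k] A}
    (h : ∀ a b c, F (a ⊗ₜ (b ⊗ₜ c)) = G (a ⊗ₜ (b ⊗ₜ c))) (t : H³) : F t = G t :=
  linearMap_congr₃ (f := F.toLinearMap) (g := G.toLinearMap) h t

/-! ### The axioms in terms of the insertion maps -/

section Axioms

theorem Phi_mul_PhiInv : Φ * Φ⁻ = 1 := Units.mul_inv _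
theorem PhiInv_mul_Phi : Φ⁻ * Φ = 1 := Units.inv_mul _

theorem map_Phi_mul {A : Type*} [Ring A] [Algebra k A] (F : H³ →ₐ[k] A) : F Φ * F Φ⁻ = 1 := by
  rw [← map_mul, Phi_mul_PhiInv, map_one]
theorem map_PhiInv_mul {A : Type*} [Ring A] [Algebra k A] (F : H³ →ₐ[k] A) : F Φ⁻ * F Φ = 1 := by
  rw [← map_mul, PhiInv_mul_Phi, map_one]

theorem coassoc (h : H) : face₂ k H (Δ h) * Φ = Φ * face₁ k H (Δ h) := by
  have := quasi_coassoc (k := k) h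
  change face₂ k H (Δ h) = Φ * face₁ k H (Δ h) * Φ⁻ at this
  rw [this, mul_assoc, PhiInv_mul_Phi, mul_one]

theorem coassoc_inv (h : H) : face₁ k H (Δ h) * Φ⁻ = Φ⁻ * face₂ k H (Δ h) := by
  have := quasi_coassoc (k := k) h
  change face₂ k H (Δ h) = Φ * face₁ k H (Δ h) * Φ⁻ at this
  rw [this, ← mul_assoc, ← mul_assoc, PhiInv_mul_Phi, one_mul]

theorem tensorOne_eq (t : H³) : tensorOne k H t = cell₄ k H t :=
  algHom_congr₃ (F := (Algebra.TensorProduct.map (AlgHom.id k H)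
    (Algebra.TensorProduct.assoc k k k H H H).toAlgHom).comp
    ((Algebra.TensorProduct.assoc k k k H H² H).toAlgHom.comp
      (Algebra.TensorProduct.includeLeft))) (G := cell₄ k H) (fun _ _ _ => rfl) t

theorem pentagon :
    cell₀ k H Φ * cell₂ k H Φ * cell₄ k H Φ = cell₃ k H Φ * cell₁ k H Φ := by
  rw [← tensorOne_eq]
  exact cocycle (k := k) (H := H)

theorem contractRight_comul (h : H) : contractRight₂ (counit (k := k) (H := H)).toLinearMap (Δ h) = h := by
  have := congrArg (TensorProduct.rid k H) (id_counit_comul (k := k) h)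
  rwa [TensorProduct.rid_tmul, one_smul] at this

theorem contractLeft_comul (h : H) : contractLeft₂ (counit (k := k) (H := H)).toLinearMap (Δ h) = h := by
  have := congrArg (TensorProduct.lid k H) (counit_id_comul (k := k) h)
  rwa [TensorProduct.lid_tmul, one_smul] at this

theorem counit₂_Phi : counit₂ k H Φ = 1 := by
  have := congrArg (Algebra.TensorProduct.map (AlgHom.id k H)
    (Algebra.TensorProduct.lid k H).toAlgHom) (id_counit_id_reassociator (k := k) (H := H))
  have h : Algebra.TensorProduct.map (AlgHom.id k H) (Algebra.TensorProduct.lid k H).toAlgHom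
      ((1 : H) ⊗ₜ[k] ((1 : k) ⊗ₜ[k] (1 : H))) = 1 := by simp [one_two]
  rw [h] at this
  rw [← this]
  exact algHom_congr₃ (F := counit₂ k H) (G := (Algebra.TensorProduct.map (AlgHom.id k H)
    (Algebra.TensorProduct.lid k H).toAlgHom).comp (Algebra.TensorProduct.map (AlgHom.id k H)
      (Algebra.TensorProduct.map counit (AlgHom.id k H)))) (fun _ _ _ => rfl) _

theorem map_PhiInv_eq_one {A : Type*} [Ring A] [Algebra k A] {F : H³ →ₐ[k] A} (h : F Φ = 1) :
    F Φ⁻ = 1 := by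
  have := map_Phi_mul F
  rwa [h, one_mul] at this

end Axioms

/-! ### Linear maps that absorb coproducts -/

section Invariance

variable {M A : Type*} [AddCommGroup M] [Module k M] [Ring A] [Algebra k A]

/-- `F(t ι(Δ x)) = ε(x) F(t)`. -/
def InvRight (ι : H² →ₐ[k] A) (F : A →ₗ[k] M) : Prop := ∀ t x, F (t * ι (Δ x)) = ε x • F t

/-- `F(ι(Δ x) t) = ε(x) F(t)`. -/
def InvLeft (ι : H² →ₐ[k] A) (F : A →ₗ[k] M) : Prop := ∀ t x, F (ι (Δ x) * t) = ε x • F t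

/-- The form of the antipode axiom used everywhere: if G sees u ⊗ v only through uβS(v), then u ⊗ v
= Δ(x) can be replaced by ε(x) 1 ⊗ 1. -/
theorem comul_beta (G : H² →ₗ[k] M) (J : H → M) (hJ : IsLinearMap k J)
    (h : ∀ u v, G (u ⊗ₜ v) = J (u * βₕ * S v)) (x : H) : G (Δ x) = ε x • G 1 := by
  have : G = hJ.mk' ∘ₗ betaS S βₕ := TensorProduct.ext' fun a b => by simp [h]
  rw [this]; simp [antipode_right, one_two, antipode_one]

theorem comul_alpha (G : H² →ₗ[k] M) (J : H → M) (hJ : IsLinearMap k J)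
    (h : ∀ u v, G (u ⊗ₜ v) = J (S u * αₕ * v)) (x : H) : G (Δ x) = ε x • G 1 := by
  have : G = hJ.mk' ∘ₗ sAlpha S αₕ := TensorProduct.ext' fun a b => by simp [h]
  rw [this]; simp [antipode_left, one_two, antipode_one]

theorem invRight_three (ι : H² →ₐ[k] H³) (F : H³ →ₗ[k] M) (J : H → H → H → H → M)
    (h : ∀ a b c u v, F (a ⊗ₜ (b ⊗ₜ c) * ι (u ⊗ₜ v)) = J a b c (u * βₕ * S v))
    (hJ : ∀ a b c, IsLinearMap k (J a b c) := by
      intros; constructor <;> intros <;> simp [add_mul, mul_add, TensorProduct.add_tmul,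
        TensorProduct.tmul_add, ← TensorProduct.smul_tmul', add_smul, mul_smul, smul_comm]) :
    InvRight ι F := by
  intro t x
  refine linearMap_congr₃ (f := F ∘ₗ LinearMap.mulRight k (ι (Δ x))) (g := ε x • F)
    (fun a b c => ?_) t
  refine (comul_beta (F ∘ₗ LinearMap.mulLeft k (a ⊗ₜ (b ⊗ₜ c)) ∘ₗ ι.toLinearMap) (J a b c)
    (hJ a b c) (h a b c) x).trans ?_
  simp

theorem invLeft_three (ι : H² →ₐ[k] H³) (F : H³ →ₗ[k] M) (J : H → H → H → H → M)
    (h : ∀ a b c u v, F (ι (u ⊗ₜ v) * a ⊗ₜ (b ⊗ₜ c)) = J a b c (S u * αₕ * v))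
    (hJ : ∀ a b c, IsLinearMap k (J a b c) := by
      intros; constructor <;> intros <;> simp [add_mul, mul_add, TensorProduct.add_tmul,
        TensorProduct.tmul_add, ← TensorProduct.smul_tmul', add_smul, mul_smul, smul_comm]) :
    InvLeft ι F := by
  intro t x
  refine linearMap_congr₃ (f := F ∘ₗ LinearMap.mulLeft k (ι (Δ x))) (g := ε x • F)
    (fun a b c => ?_) t
  refine (comul_alpha (F ∘ₗ LinearMap.mulRight k (a ⊗ₜ (b ⊗ₜ c)) ∘ₗ ι.toLinearMap) (J a b c)
    (hJ a b c) (h a b c) x).trans ?_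
  simp

theorem invRight_four (ι : H² →ₐ[k] H⁴) (F : H⁴ →ₗ[k] M) (J : H → H → H → H → H → M)
    (h : ∀ a b c d u v, F (a ⊗ₜ (b ⊗ₜ (c ⊗ₜ d)) * ι (u ⊗ₜ v)) = J a b c d (u * βₕ * S v))
    (hJ : ∀ a b c d, IsLinearMap k (J a b c d) := by
      intros; constructor <;> intros <;> simp [add_mul, mul_add, TensorProduct.add_tmul,
        TensorProduct.tmul_add, ← TensorProduct.smul_tmul', add_smul, mul_smul, smul_comm]) :
    InvRight ι F := by
  intro t x
  refine linearMap_congr₄ (f := F ∘ₗ LinearMap.mulRight k (ι (Δ x))) (g := ε x • F)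
    (fun a b c d => ?_) t
  refine (comul_beta (F ∘ₗ LinearMap.mulLeft k (a ⊗ₜ (b ⊗ₜ (c ⊗ₜ d))) ∘ₗ ι.toLinearMap)
    (J a b c d) (hJ a b c d) (h a b c d) x).trans ?_
  simp

theorem invLeft_four (ι : H² →ₐ[k] H⁴) (F : H⁴ →ₗ[k] M) (J : H → H → H → H → H → M)
    (h : ∀ a b c d u v, F (ι (u ⊗ₜ v) * a ⊗ₜ (b ⊗ₜ (c ⊗ₜ d))) = J a b c d (S u * αₕ * v))
    (hJ : ∀ a b c d, IsLinearMap k (J a b c d) := by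
      intros; constructor <;> intros <;> simp [add_mul, mul_add, TensorProduct.add_tmul,
        TensorProduct.tmul_add, ← TensorProduct.smul_tmul', add_smul, mul_smul, smul_comm]) :
    InvLeft ι F := by
  intro t x
  refine linearMap_congr₄ (f := F ∘ₗ LinearMap.mulLeft k (ι (Δ x))) (g := ε x • F)
    (fun a b c d => ?_) t
  refine (comul_alpha (F ∘ₗ LinearMap.mulRight k (a ⊗ₜ (b ⊗ₜ (c ⊗ₜ d))) ∘ₗ ι.toLinearMap)
    (J a b c d) (hJ a b c d) (h a b c d) x).trans ?_
  simp

/-- In h₁ ⊗ Δ(h₂) the map absorbs Δ(h₂) as ε(h₂), and the counit axiom contracts the rest to h.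
Together with its three variants this turns quasi-coassociativity into commutation rules. -/
theorem InvRight.mul_face₂ {F : H³ →ₗ[k] M} (hF : InvRight (face₀ k H) F) (t : H³) (h : H) :
    F (t * face₂ k H (Δ h)) = F (t * h ⊗ₜ (1 ⊗ₜ 1)) := by
  conv_rhs => rw [← contractRight_comul (k := k) h]
  refine linearMap_congr₂ (f := F ∘ₗ LinearMap.mulLeft k t ∘ₗ (face₂ k H).toLinearMap)
    (g := F ∘ₗ LinearMap.mulLeft k t ∘ₗ (TensorProduct.mk k H H²).flip (1 ⊗ₜ 1) ∘ₗ
      contractRight₂ counit.toLinearMap) (fun a b => ?_) (Δ h)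
  simp [face₂_tmul', ← mul_assoc, hF _ _]

theorem InvLeft.face₂_mul {F : H³ →ₗ[k] M} (hF : InvLeft (face₀ k H) F) (t : H³) (h : H) :
    F (face₂ k H (Δ h) * t) = F (h ⊗ₜ (1 ⊗ₜ 1) * t) := by
  conv_rhs => rw [← contractRight_comul (k := k) h]
  refine linearMap_congr₂ (f := F ∘ₗ LinearMap.mulRight k t ∘ₗ (face₂ k H).toLinearMap)
    (g := F ∘ₗ LinearMap.mulRight k t ∘ₗ (TensorProduct.mk k H H²).flip (1 ⊗ₜ 1) ∘ₗ
      contractRight₂ counit.toLinearMap) (fun a b => ?_) (Δ h)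
  simp [face₂_tmul'', mul_assoc, hF _ _]

theorem InvRight.mul_face₁ {F : H³ →ₗ[k] M} (hF : InvRight (face₃ k H) F) (t : H³) (h : H) :
    F (t * face₁ k H (Δ h)) = F (t * 1 ⊗ₜ (1 ⊗ₜ h)) := by
  conv_rhs => rw [← contractLeft_comul (k := k) h]
  refine linearMap_congr₂ (f := F ∘ₗ LinearMap.mulLeft k t ∘ₗ (face₁ k H).toLinearMap)
    (g := F ∘ₗ LinearMap.mulLeft k t ∘ₗ TensorProduct.mk k H H² 1 ∘ₗ TensorProduct.mk k H H 1 ∘ₗ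
      contractLeft₂ counit.toLinearMap) (fun a b => ?_) (Δ h)
  simp [face₁_tmul', ← mul_assoc, hF _ _]

theorem InvLeft.face₁_mul {F : H³ →ₗ[k] M} (hF : InvLeft (face₃ k H) F) (t : H³) (h : H) :
    F (face₁ k H (Δ h) * t) = F (1 ⊗ₜ (1 ⊗ₜ h) * t) := by
  conv_rhs => rw [← contractLeft_comul (k := k) h]
  refine linearMap_congr₂ (f := F ∘ₗ LinearMap.mulRight k t ∘ₗ (face₁ k H).toLinearMap)
    (g := F ∘ₗ LinearMap.mulRight k t ∘ₗ TensorProduct.mk k H H² 1 ∘ₗ TensorProduct.mk k H H 1 ∘ₗ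
      contractLeft₂ counit.toLinearMap) (fun a b => ?_) (Δ h)
  simp [face₁_tmul, mul_assoc, hF _ _]

/-- Here C inserts Δ(w) at the absorbed place and c has ε(w) instead. The two algebra maps may be
exchanged under F, at Φ and Φ⁻¹ alike. -/
theorem InvRight.mul_map {ι : H² →ₐ[k] A} {F : A →ₗ[k] M} (hF : InvRight ι F) (C c : H³ →ₐ[k] A)
    (h : ∀ x y z, ∃ e w, C (x ⊗ₜ (y ⊗ₜ z)) = e * ι (Δ w) ∧ c (x ⊗ₜ (y ⊗ₜ z)) = ε w • e)
    (t : A) (s : H³) : F (t * C s) = F (t * c s) := by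
  refine linearMap_congr₃ (f := F ∘ₗ LinearMap.mulLeft k t ∘ₗ C.toLinearMap)
    (g := F ∘ₗ LinearMap.mulLeft k t ∘ₗ c.toLinearMap) (fun x y z => ?_) s
  obtain ⟨e, w, h₁, h₂⟩ := h x y z
  simp [h₁, h₂, ← mul_assoc, hF _ _]

theorem InvLeft.map_mul {ι : H² →ₐ[k] A} {F : A →ₗ[k] M} (hF : InvLeft ι F) (C c : H³ →ₐ[k] A)
    (h : ∀ x y z, ∃ e w, C (x ⊗ₜ (y ⊗ₜ z)) = ι (Δ w) * e ∧ c (x ⊗ₜ (y ⊗ₜ z)) = ε w • e)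
    (t : A) (s : H³) : F (C s * t) = F (c s * t) := by
  refine linearMap_congr₃ (f := F ∘ₗ LinearMap.mulRight k t ∘ₗ C.toLinearMap)
    (g := F ∘ₗ LinearMap.mulRight k t ∘ₗ c.toLinearMap) (fun x y z => ?_) s
  obtain ⟨e, w, h₁, h₂⟩ := h x y z
  simp [h₁, h₂, mul_assoc, hF _ _]

end Invariance

/-! ### Counits of the reassociator and absorption of its coproducts -/

section Elimination

variable {M : Type*} [AddCommGroup M] [Module k M]

variable (k H) in
/-- `a ⊗ c ↦ a ⊗ 1 ⊗ 1 ⊗ c`. -/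
def leg₁₄ : H² →ₐ[k] H⁴ :=
  Algebra.TensorProduct.map (AlgHom.id k H)
    (Algebra.TensorProduct.includeRight.comp Algebra.TensorProduct.includeRight)

@[simp] theorem leg₁₄_tmul (a b : H) : leg₁₄ k H (a ⊗ₜ[k] b) = a ⊗ₜ[k] (1 ⊗ₜ[k] (1 ⊗ₜ[k] b)) := rfl

/-- Only the middle counit of Φ is an axiom. Applying id ⊗ ε ⊗ id ⊗ id to the pentagon makes two
factors trivial by that axiom and turns two others into Φ, which cancels. -/
theorem counit₁_Phi_aux : (1 : H) ⊗ₜ[k] (counit₁ k H Φ) = 1 := by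
  let C : H⁴ →ₐ[k] H³ := Algebra.TensorProduct.map (AlgHom.id k H) (counit₁ k H)
  have h := congrArg C (pentagon (k := k) (H := H))
  simp only [map_mul] at h
  have h₀ : C (cell₀ k H Φ) = 1 ⊗ₜ[k] (counit₁ k H Φ) := rfl
  have h₂ : C (cell₂ k H Φ) = Φ := by
    refine algHom_congr₃ (F := C.comp (cell₂ k H)) (G := AlgHom.id k _) (fun a b c => ?_) Φ
    change a ⊗ₜ[k] counit₁ k H (face₁ k H (b ⊗ₜ[k] c)) = a ⊗ₜ[k] (b ⊗ₜ[k] c)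
    congr 1
    conv_rhs => rw [← contractLeft_comul (k := k) b]
    rw [face₁_tmul]
    refine linearMap_congr₂ (f := (counit₁ k H).toLinearMap ∘ₗ
      LinearMap.mulRight k (1 ⊗ₜ[k] (1 ⊗ₜ[k] c)) ∘ₗ (face₃ k H).toLinearMap)
      (g := (TensorProduct.mk k H H).flip c ∘ₗ contractLeft₂ counit.toLinearMap)
      (fun x y => ?_) (Δ b)
    simp [TensorProduct.smul_tmul']
  have h₄ : C (cell₄ k H Φ) = 1 := by
    have : C (cell₄ k H Φ) = face₃ k H (counit₂ k H Φ) :=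
      algHom_congr₃ (F := C.comp (cell₄ k H)) (G := (face₃ k H).comp (counit₂ k H))
        (fun a b c => by
          change a ⊗ₜ[k] (ε b • (c ⊗ₜ[k] 1)) = a ⊗ₜ[k] ((ε b • c) ⊗ₜ[k] 1)
          rw [TensorProduct.smul_tmul']) Φ
    rw [this, counit₂_Phi, map_one]
  have h₃ : C (cell₃ k H Φ) = 1 := by
    have : C (cell₃ k H Φ) = face₂ k H (counit₂ k H Φ) :=
      algHom_congr₃ (F := C.comp (cell₃ k H)) (G := (face₂ k H).comp (counit₂ k H))
        (fun a b c => by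
          change a ⊗ₜ[k] (ε b • (Δ c)) = a ⊗ₜ[k] (Δ (ε b • c))
          rw [map_smul]) Φ
    rw [this, counit₂_Phi, map_one]
  have h₁ : C (cell₁ k H Φ) = Φ := by
    refine algHom_congr₃ (F := C.comp (cell₁ k H)) (G := AlgHom.id k _) (fun a b c => ?_) Φ
    change C (cell₁ k H (a ⊗ₜ[k] (b ⊗ₜ[k] c))) = a ⊗ₜ[k] (b ⊗ₜ[k] c)
    conv_rhs => rw [← contractRight_comul (k := k) a]
    rw [cell₁_tmul]
    refine linearMap_congr₂ (f := C.toLinearMap ∘ₗ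
      LinearMap.mulRight k (1 ⊗ₜ[k] (1 ⊗ₜ[k] (b ⊗ₜ[k] c))) ∘ₗ (leg₁₂ k H).toLinearMap)
      (g := (TensorProduct.mk k H H²).flip (b ⊗ₜ[k] c) ∘ₗ contractRight₂ counit.toLinearMap)
      (fun x y => ?_) (Δ a)
    simp [C]
  rw [h₀, h₂, h₄, h₃, h₁, mul_one, one_mul] at h
  calc _ = 1 ⊗ₜ[k] (counit₁ k H Φ) * Φ * Φ⁻ := by rw [mul_assoc, Phi_mul_PhiInv, mul_one]
    _ = 1 := by rw [h, Phi_mul_PhiInv]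

theorem counit₁_Phi : counit₁ k H Φ = 1 := by
  have := congrArg (counit₁ k H) (counit₁_Phi_aux (k := k) (H := H))
  rw [map_one] at this
  rw [← this]
  change _ = ε 1 • counit₁ k H Φ
  rw [map_one, one_smul]

/-- The mirror image, with the counit applied to the third leg of the pentagon. -/
theorem counit₃_Phi_aux : face₃ k H (counit₃ k H Φ) = 1 := by
  let C : H⁴ →ₐ[k] H³ := Algebra.TensorProduct.map (AlgHom.id k H) (counit₂ k H)
  have h := congrArg C (pentagon (k := k) (H := H))
  simp only [map_mul] at h
  have h₀ : C (cell₀ k H Φ) = 1 := by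
    change 1 ⊗ₜ[k] (counit₂ k H Φ) = 1
    rw [counit₂_Phi]; rfl
  have h₂ : C (cell₂ k H Φ) = Φ := by
    refine algHom_congr₃ (F := C.comp (cell₂ k H)) (G := AlgHom.id k _) (fun a b c => ?_) Φ
    change a ⊗ₜ[k] counit₂ k H (face₁ k H (b ⊗ₜ[k] c)) = a ⊗ₜ[k] (b ⊗ₜ[k] c)
    congr 1
    conv_rhs => rw [← contractRight_comul (k := k) b]
    rw [face₁_tmul]
    refine linearMap_congr₂ (f := (counit₂ k H).toLinearMap ∘ₗ
      LinearMap.mulRight k (1 ⊗ₜ[k] (1 ⊗ₜ[k] c)) ∘ₗ (face₃ k H).toLinearMap)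
      (g := (TensorProduct.mk k H H).flip c ∘ₗ contractRight₂ counit.toLinearMap)
      (fun x y => ?_) (Δ b)
    simp [TensorProduct.smul_tmul']
  have h₄ : C (cell₄ k H Φ) = face₃ k H (counit₃ k H Φ) :=
    algHom_congr₃ (F := C.comp (cell₄ k H)) (G := (face₃ k H).comp (counit₃ k H))
      (fun a b c => by
        change a ⊗ₜ[k] (b ⊗ₜ[k] (ε c • (1 : H))) = a ⊗ₜ[k] ((ε c • b) ⊗ₜ[k] (1 : H))
        rw [TensorProduct.smul_tmul]) Φ
  have h₃ : C (cell₃ k H Φ) = Φ := by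
    refine algHom_congr₃ (F := C.comp (cell₃ k H)) (G := AlgHom.id k _) (fun a b c => ?_) Φ
    change C (cell₃ k H (a ⊗ₜ[k] (b ⊗ₜ[k] c))) = a ⊗ₜ[k] (b ⊗ₜ[k] c)
    conv_rhs => rw [← contractLeft_comul (k := k) c]
    rw [cell₃_tmul]
    refine linearMap_congr₂ (f := C.toLinearMap ∘ₗ
      LinearMap.mulRight k (a ⊗ₜ[k] (b ⊗ₜ[k] (1 ⊗ₜ[k] 1))) ∘ₗ (leg₃₄ k H).toLinearMap)
      (g := TensorProduct.mk k H H² a ∘ₗ TensorProduct.mk k H H b ∘ₗ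
        contractLeft₂ counit.toLinearMap)
      (fun x y => ?_) (Δ c)
    simp [C]
  have h₁ : C (cell₁ k H Φ) = 1 := by
    have : C (cell₁ k H Φ) = face₁ k H (counit₂ k H Φ) := by
      refine algHom_congr₃ (F := C.comp (cell₁ k H)) (G := (face₁ k H).comp (counit₂ k H))
        (fun a b c => ?_) Φ
      change C (cell₁ k H (a ⊗ₜ[k] (b ⊗ₜ[k] c))) = face₁ k H (a ⊗ₜ[k] (ε b • c))
      rw [cell₁_tmul, face₁_tmul]
      refine linearMap_congr₂ (f := C.toLinearMap ∘ₗ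
        LinearMap.mulRight k (1 ⊗ₜ[k] (1 ⊗ₜ[k] (b ⊗ₜ[k] c))) ∘ₗ (leg₁₂ k H).toLinearMap)
        (g := LinearMap.mulRight k (1 ⊗ₜ[k] (1 ⊗ₜ[k] (ε b • c))) ∘ₗ (face₃ k H).toLinearMap)
        (fun x y => ?_) (Δ a)
      simp [C]
    rw [this, counit₂_Phi, map_one]
  rw [h₀, h₂, h₄, h₃, h₁, one_mul, mul_one] at h
  calc _ = Φ⁻ * (Φ * face₃ k H (counit₃ k H Φ)) := by
        rw [← mul_assoc, PhiInv_mul_Phi, one_mul]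
    _ = 1 := by rw [h, PhiInv_mul_Phi]

theorem counit₃_Phi : counit₃ k H Φ = 1 := by
  have := congrArg (counit₃ k H) (counit₃_Phi_aux (k := k) (H := H))
  rw [map_one] at this
  rw [← this]
  refine (linearMap_congr₂ (f := (counit₃ k H).toLinearMap ∘ₗ (face₃ k H).toLinearMap)
    (g := LinearMap.id) (fun a b => ?_) _).symm
  simp

theorem counit₁_PhiInv : counit₁ k H Φ⁻ = 1 := map_PhiInv_eq_one (F := counit₁ k H) counit₁_Phi

/-- A map absorbing coproducts in legs 1 and 2 replaces (Δ ⊗ id ⊗ id)(Φ) by (ε ⊗ id ⊗ id)(Φ) = 1.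
The five companions do the same at the other positions and on the other side. -/
theorem InvRight.mul_cell₁ {F : H⁴ →ₗ[k] M} (hF : InvRight (leg₁₂ k H) F) (t : H⁴) :
    F (t * cell₁ k H Φ) = F t ∧ F (t * cell₁ k H Φ⁻) = F t := by
  have h := hF.mul_map (cell₁ k H) ((cell₀ k H).comp ((face₀ k H).comp (counit₁ k H)))
    (fun x y z => ⟨_, x, cell₁_tmul' x y z, by simp⟩) t
  exact ⟨by simp [h, counit₁_Phi], by simp [h, counit₁_PhiInv]⟩

theorem InvLeft.cell₁_mul {F : H⁴ →ₗ[k] M} (hF : InvLeft (leg₁₂ k H) F) (t : H⁴) :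
    F (cell₁ k H Φ * t) = F t ∧ F (cell₁ k H Φ⁻ * t) = F t := by
  have h := hF.map_mul (cell₁ k H) ((cell₀ k H).comp ((face₀ k H).comp (counit₁ k H)))
    (fun x y z => ⟨_, x, cell₁_tmul x y z, by simp⟩) t
  exact ⟨by simp [h, counit₁_Phi], by simp [h, counit₁_PhiInv]⟩

theorem counit₂_PhiInv : counit₂ k H Φ⁻ = 1 := map_PhiInv_eq_one (F := counit₂ k H) counit₂_Phi

theorem InvRight.mul_cell₂ {F : H⁴ →ₗ[k] M} (hF : InvRight (leg₂₃ k H) F) (t : H⁴) :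
    F (t * cell₂ k H Φ) = F t ∧ F (t * cell₂ k H Φ⁻) = F t := by
  have h := hF.mul_map (cell₂ k H) ((leg₁₄ k H).comp (counit₂ k H))
    (fun x y z => ⟨_, y, cell₂_tmul' x y z, by simp⟩) t
  exact ⟨by simp [h, counit₂_Phi], by simp [h, counit₂_PhiInv]⟩

theorem InvLeft.cell₂_mul {F : H⁴ →ₗ[k] M} (hF : InvLeft (leg₂₃ k H) F) (t : H⁴) :
    F (cell₂ k H Φ * t) = F t ∧ F (cell₂ k H Φ⁻ * t) = F t := by
  have h := hF.map_mul (cell₂ k H) ((leg₁₄ k H).comp (counit₂ k H))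
    (fun x y z => ⟨_, y, cell₂_tmul x y z, by simp⟩) t
  exact ⟨by simp [h, counit₂_Phi], by simp [h, counit₂_PhiInv]⟩

theorem counit₃_PhiInv : counit₃ k H Φ⁻ = 1 := map_PhiInv_eq_one (F := counit₃ k H) counit₃_Phi

theorem InvRight.mul_cell₃ {F : H⁴ →ₗ[k] M} (hF : InvRight (leg₃₄ k H) F) (t : H⁴) :
    F (t * cell₃ k H Φ) = F t ∧ F (t * cell₃ k H Φ⁻) = F t := by
  have h := hF.mul_map (cell₃ k H) ((leg₁₂ k H).comp (counit₃ k H))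
    (fun x y z => ⟨_, z, cell₃_tmul' x y z, by simp [TensorProduct.smul_tmul']⟩) t
  exact ⟨by simp [h, counit₃_Phi], by simp [h, counit₃_PhiInv]⟩

theorem InvLeft.cell₃_mul {F : H⁴ →ₗ[k] M} (hF : InvLeft (leg₃₄ k H) F) (t : H⁴) :
    F (cell₃ k H Φ * t) = F t ∧ F (cell₃ k H Φ⁻ * t) = F t := by
  have h := hF.map_mul (cell₃ k H) ((leg₁₂ k H).comp (counit₃ k H))
    (fun x y z => ⟨_, z, cell₃_tmul x y z, by simp [TensorProduct.smul_tmul']⟩) t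
  exact ⟨by simp [h, counit₃_Phi], by simp [h, counit₃_PhiInv]⟩

end Elimination

/-! ### Rearrangements of the pentagon -/

section Pentagons

variable (k H) in
/-- The reassociator as a unit. -/
def phi : H³ˣ := reassociator

/-- In the group of units the pentagon can be solved for any product of its factors; the variants
below isolate the product met in an expression and rewrite it in absorbable factors. -/
theorem pentagon_units :
    Units.map (cell₀ k H).toMonoidHom (phi k H) * Units.map (cell₂ k H).toMonoidHom (phi k H) *
      Units.map (cell₄ k H).toMonoidHom (phi k H) =
    Units.map (cell₃ k H).toMonoidHom (phi k H) * Units.map (cell₁ k H).toMonoidHom (phi k H) :=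
  Units.ext pentagon

theorem pentagon₁₄ : cell₁ k H Φ * cell₄ k H Φ⁻ =
    cell₃ k H Φ⁻ * cell₀ k H Φ * cell₂ k H Φ := by
  have : ∀ {G : Type _} [Group G] {a b c d e : G}, a * b * c = d * e →
      e * c⁻¹ = d⁻¹ * a * b := fun {G _ a b c d e} h => by
    have : e = d⁻¹ * (a * b * c) := by rw [h]; group
    rw [this]; group
  exact congrArg Units.val (this (pentagon_units (k := k) (H := H)))

theorem pentagon₄₁ : cell₄ k H Φ * cell₁ k H Φ⁻ =
    cell₂ k H Φ⁻ * cell₀ k H Φ⁻ * cell₃ k H Φ := by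
  have : ∀ {G : Type _} [Group G] {a b c d e : G}, a * b * c = d * e →
      c * e⁻¹ = b⁻¹ * a⁻¹ * d := fun {G _ a b c d e} h => by
    have : c = b⁻¹ * a⁻¹ * (d * e) := by rw [← h]; group
    rw [this]; group
  exact congrArg Units.val (this (pentagon_units (k := k) (H := H)))

theorem pentagon₀ : cell₀ k H Φ =
    cell₃ k H Φ * cell₁ k H Φ * cell₄ k H Φ⁻ * cell₂ k H Φ⁻ := by
  have : ∀ {G : Type _} [Group G] {a b c d e : G}, a * b * c = d * e →
      a = d * e * c⁻¹ * b⁻¹ := fun {G _ a b c d e} h => by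
    rw [← h]; group
  exact congrArg Units.val (this (pentagon_units (k := k) (H := H)))

theorem pentagon₀_inv : cell₀ k H Φ⁻ =
    cell₂ k H Φ * cell₄ k H Φ * cell₁ k H Φ⁻ * cell₃ k H Φ⁻ := by
  have : ∀ {G : Type _} [Group G] {a b c d e : G}, a * b * c = d * e →
      a⁻¹ = b * c * e⁻¹ * d⁻¹ := fun {G _ a b c d e} h => by
    have : a = d * e * c⁻¹ * b⁻¹ := by rw [← h]; group
    rw [this]; group
  exact congrArg Units.val (this (pentagon_units (k := k) (H := H)))

theorem pentagon₄_inv : cell₄ k H Φ⁻ =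
    cell₁ k H Φ⁻ * cell₃ k H Φ⁻ * cell₀ k H Φ * cell₂ k H Φ := by
  have : ∀ {G : Type _} [Group G] {a b c d e : G}, a * b * c = d * e →
      c⁻¹ = e⁻¹ * d⁻¹ * a * b := fun {G _ a b c d e} h => by
    have : c = b⁻¹ * a⁻¹ * (d * e) := by rw [← h]; group
    rw [this]; group
  exact congrArg Units.val (this (pentagon_units (k := k) (H := H)))

end Pentagons

/-! ### The canonical elements p_R, q_R and q_L -/

section Canonical

variable {M : Type*} [AddCommGroup M] [Module k M]

theorem antipode_anti (a b : H) : S (a * b) = S b * S a := QuasiHopfAlgebra.antipode_mul a b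
theorem antipode_unit : S 1 = 1 := QuasiHopfAlgebra.antipode_one

@[simp] theorem antipodeFlip_tmul (a b : H) : antipodeFlip k H (a ⊗ₜ[k] b) = S b ⊗ₜ[k] S a := rfl

theorem antipodeFlip_mul (x y : H²) :
    antipodeFlip k H (x * y) = antipodeFlip k H y * antipodeFlip k H x := by
  refine linearMap_congr₂ (f := antipodeFlip k H ∘ₗ LinearMap.mulRight k y)
    (g := LinearMap.mulLeft k (antipodeFlip k H y) ∘ₗ antipodeFlip k H) (fun a b => ?_) x
  refine linearMap_congr₂ (f := antipodeFlip k H ∘ₗ LinearMap.mulLeft k (a ⊗ₜ[k] b))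
    (g := LinearMap.mulRight k (antipodeFlip k H (a ⊗ₜ[k] b)) ∘ₗ antipodeFlip k H)
    (fun c d => ?_) y
  simp [antipode_anti]

theorem antipodeFlip_one : antipodeFlip k H 1 = 1 := by
  simp [one_two, antipode_unit]

variable (k H) in
/-- `a ⊗ b ⊗ c ↦ a ⊗ b β S(c)`. -/
def pMap : H³ →ₗ[k] H² := TensorProduct.map LinearMap.id (betaS S βₕ)

variable (k H) in
/-- `a ⊗ b ⊗ c ↦ S(b) α c ⊗ S(a)`. -/
def qMap : H³ →ₗ[k] H² := lin₃ fun a b c => (S b * αₕ * c) ⊗ₜ[k] S a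

variable (k H) in
/-- `a ⊗ b ⊗ c ↦ S(a) α b ⊗ c`. -/
def qLMap : H³ →ₗ[k] H² := lin₃ fun a b c => (S a * αₕ * b) ⊗ₜ[k] c

variable (k H) in
/-- `S(X²) α X³ ⊗ S(X¹)`, the image of `q_R` under `a ⊗ b ↦ S(b) ⊗ S(a)`. -/
def antipodeQR : H² := qMap k H Φ

variable (k H) in
/-- `q_L = S(x¹) α x² ⊗ x³`. -/
def qL : H² := qLMap k H Φ⁻

@[simp] theorem pMap_tmul (a b c : H) : pMap k H (a ⊗ₜ[k] (b ⊗ₜ[k] c)) = a ⊗ₜ[k] (b * βₕ * S c) := rfl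
@[simp] theorem qMap_tmul (a b c : H) :
    qMap k H (a ⊗ₜ[k] (b ⊗ₜ[k] c)) = (S b * αₕ * c) ⊗ₜ[k] S a := rfl
@[simp] theorem qLMap_tmul (a b c : H) :
    qLMap k H (a ⊗ₜ[k] (b ⊗ₜ[k] c)) = (S a * αₕ * b) ⊗ₜ[k] c := rfl

theorem pR_eq : pR k H = pMap k H Φ⁻ :=
  linearMap_congr₃ (f := TensorProduct.map LinearMap.id (betaS S βₕ)) (g := pMap k H)
    (fun _ _ _ => rfl) Φ⁻

theorem pMap_invRight : InvRight (face₀ k H) (pMap k H) :=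
  invRight_three _ _ (fun a b c y => a ⊗ₜ[k] (b * y * S c))
    (by intros; simp [antipode_anti, mul_assoc])

theorem qMap_invLeft : InvLeft (face₀ k H) (qMap k H) :=
  invLeft_three _ _ (fun a b c y => (S b * y * c) ⊗ₜ[k] S a)
    (by intros; simp [antipode_anti, mul_assoc])

theorem pMap_face₁_mul (a b : H) (t : H³) :
    pMap k H (face₁ k H (a ⊗ₜ[k] b) * t) = Δ a * pMap k H t * (1 ⊗ₜ[k] S b) := by
  rw [face₁_tmul]
  refine linearMap_congr₂ (f := pMap k H ∘ₗ LinearMap.mulRight k t ∘ₗ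
    LinearMap.mulRight k (1 ⊗ₜ[k] (1 ⊗ₜ[k] b)) ∘ₗ (face₃ k H).toLinearMap)
    (g := LinearMap.mulRight k (1 ⊗ₜ[k] S b) ∘ₗ LinearMap.mulRight k (pMap k H t))
    (fun x y => ?_) (Δ a)
  refine linearMap_congr₃ (f := pMap k H ∘ₗ LinearMap.mulLeft k _)
    (g := LinearMap.mulRight k (1 ⊗ₜ[k] S b) ∘ₗ LinearMap.mulLeft k (x ⊗ₜ[k] y) ∘ₗ pMap k H)
    (fun u v w => ?_) t
  simp [antipode_anti, mul_assoc]

theorem qMap_mul_face₁ (a b : H) (t : H³) :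
    qMap k H (t * face₁ k H (a ⊗ₜ[k] b)) = antipodeFlip k H (Δ a) * qMap k H t * (b ⊗ₜ[k] 1) := by
  rw [face₁_tmul]
  refine linearMap_congr₂ (f := qMap k H ∘ₗ LinearMap.mulLeft k t ∘ₗ
    LinearMap.mulRight k (1 ⊗ₜ[k] (1 ⊗ₜ[k] b)) ∘ₗ (face₃ k H).toLinearMap)
    (g := LinearMap.mulRight k (b ⊗ₜ[k] 1) ∘ₗ LinearMap.mulRight k (qMap k H t) ∘ₗ antipodeFlip k H)
    (fun x y => ?_) (Δ a)
  refine linearMap_congr₃ (f := qMap k H ∘ₗ LinearMap.mulRight k _)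
    (g := LinearMap.mulRight k (b ⊗ₜ[k] 1) ∘ₗ LinearMap.mulLeft k (antipodeFlip k H (x ⊗ₜ[k] y)) ∘ₗ
      qMap k H) (fun u v w => ?_) t
  simp [antipode_anti, mul_assoc]

/-- `Δ(h₁) p_R (1 ⊗ S(h₂)) = p_R (h ⊗ 1)`. -/
theorem comul_mul_pR (h : H) :
    (lin₂ (k := k) fun a b => Δ a * pR k H * (1 ⊗ₜ[k] S b)) (Δ h) = pR k H * (h ⊗ₜ[k] 1) := by
  have h₁ : (lin₂ (k := k) fun a b => Δ a * pR k H * (1 ⊗ₜ[k] S b)) (Δ h) =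
      pMap k H (face₁ k H (Δ h) * Φ⁻) :=
    linearMap_congr₂ (g := pMap k H ∘ₗ LinearMap.mulRight k Φ⁻ ∘ₗ (face₁ k H).toLinearMap)
      (fun a b => by simp [pMap_face₁_mul, pR_eq]) (Δ h)
  rw [h₁, coassoc_inv, pMap_invRight.mul_face₂, pR_eq]
  refine linearMap_congr₃ (f := pMap k H ∘ₗ LinearMap.mulRight k (h ⊗ₜ[k] (1 ⊗ₜ[k] 1)))
    (g := LinearMap.mulRight k (h ⊗ₜ[k] 1) ∘ₗ pMap k H) (fun u v w => ?_) Φ⁻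
  simp

/-- `(S ⊗ S)(Δᵒᵖ(h₁)) Q (h₂ ⊗ 1) = Q (1 ⊗ S(h))` for `Q = S(X²) α X³ ⊗ S(X¹)`. -/
theorem antipodeFlip_mul_antipodeQR (h : H) :
    (lin₂ (k := k) fun a b => antipodeFlip k H (Δ a) * antipodeQR k H * (b ⊗ₜ[k] 1)) (Δ h) =
      antipodeQR k H * (1 ⊗ₜ[k] S h) := by
  have h₁ : (lin₂ (k := k) fun a b => antipodeFlip k H (Δ a) * antipodeQR k H * (b ⊗ₜ[k] 1)) (Δ h) =
      qMap k H (Φ * face₁ k H (Δ h)) :=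
    linearMap_congr₂ (g := qMap k H ∘ₗ LinearMap.mulLeft k Φ ∘ₗ (face₁ k H).toLinearMap)
      (fun a b => by simp [qMap_mul_face₁, antipodeQR]) (Δ h)
  rw [h₁, ← coassoc, qMap_invLeft.face₂_mul, antipodeQR]
  refine linearMap_congr₃ (f := qMap k H ∘ₗ LinearMap.mulLeft k (h ⊗ₜ[k] (1 ⊗ₜ[k] 1)))
    (g := LinearMap.mulRight k (1 ⊗ₜ[k] S h) ∘ₗ qMap k H) (fun u v w => ?_) Φ
  simp [antipode_anti]

/-- `Δ(X¹) p_R (1 ⊗ S(X²) α X³) = 1`. -/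
theorem comul_pR_Phi :
    (lin₃ (k := k) fun a b c => Δ a * pR k H * (1 ⊗ₜ[k] (S b * αₕ * c))) Φ = 1 := by
  let F : H⁴ →ₗ[k] H² := lin₄ fun a b c d => a ⊗ₜ[k] (b * βₕ * S c * αₕ * d)
  have key : ∀ t : H³, (lin₃ (k := k) fun a b c => Δ a * pMap k H t * (1 ⊗ₜ[k] (S b * αₕ * c))) Φ =
      F (cell₁ k H Φ * cell₄ k H t) := fun t => by
    refine linearMap_congr₃ (g := F ∘ₗ LinearMap.mulRight k (cell₄ k H t) ∘ₗ
      (cell₁ k H).toLinearMap) (fun a b c => ?_) Φ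
    refine linearMap_congr₃ (f := LinearMap.mulRight k (1 ⊗ₜ[k] (S b * αₕ * c)) ∘ₗ
      LinearMap.mulLeft k (Δ a) ∘ₗ pMap k H) (g := F ∘ₗ
      LinearMap.mulLeft k (cell₁ k H (a ⊗ₜ[k] (b ⊗ₜ[k] c))) ∘ₗ (cell₄ k H).toLinearMap)
      (fun u v w => ?_) t
    simp only [LinearMap.comp_apply, LinearMap.mulLeft_apply, LinearMap.mulRight_apply,
      AlgHom.toLinearMap_apply, cell₁_tmul]
    refine linearMap_congr₂ (f := LinearMap.mulRight k (1 ⊗ₜ[k] (S b * αₕ * c)) ∘ₗ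
      LinearMap.mulRight k (pMap k H (u ⊗ₜ[k] (v ⊗ₜ[k] w)))) (g := F ∘ₗ
      LinearMap.mulRight k (cell₄ k H (u ⊗ₜ[k] (v ⊗ₜ[k] w))) ∘ₗ
      LinearMap.mulRight k (1 ⊗ₜ[k] (1 ⊗ₜ[k] (b ⊗ₜ[k] c))) ∘ₗ (leg₁₂ k H).toLinearMap)
      (fun x y => ?_) (Δ a)
    simp [F, antipode_anti, mul_assoc]
  have hR : InvRight (leg₂₃ k H) F :=
    invRight_four _ _ (fun a b c d y => a ⊗ₜ[k] (b * y * S c * αₕ * d))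
      (by intros; simp [F, antipode_anti, mul_assoc])
  have hL : InvLeft (leg₃₄ k H) F :=
    invLeft_four _ _ (fun a b c d y => a ⊗ₜ[k] (b * βₕ * S c * y * d))
      (by intros; simp [F, antipode_anti, mul_assoc])
  -- In F the element β absorbs the right factor and α absorbs the left factor of the rewritten
  -- product. What remains is 1 ⊗ Φ, that is, ∑ X¹βS(X²)αX³ = 1.
  rw [pR_eq, key, pentagon₁₄, (hR.mul_cell₂ _).1, (hL.cell₃_mul _).2]
  have := linearMap_congr₃ (f := F ∘ₗ (cell₀ k H).toLinearMap)
    (g := TensorProduct.mk k H H 1 ∘ₗ betaSAlpha S αₕ βₕ) (fun a b c => by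
      simp [F, mul_assoc]) Φ
  refine this.trans ?_
  have h := antipode_reassociator (k := k) (H := H)
  change betaSAlpha S αₕ βₕ Φ = 1 at h
  simp [h, one_two]

/-- `(S ⊗ S)(Δᵒᵖ(p¹)) Q (p² ⊗ 1) = 1` for `Q = S(X²) α X³ ⊗ S(X¹)`. -/
theorem antipodeFlip_antipodeQR_pR :
    (lin₂ (k := k) fun a b => antipodeFlip k H (Δ a) * antipodeQR k H * (b ⊗ₜ[k] 1)) (pR k H) = 1 := by
  let F : H⁴ →ₗ[k] H² := lin₄ fun a b c d => (S b * αₕ * c * βₕ * S d) ⊗ₜ[k] S a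
  have key : ∀ t : H³, (lin₂ (k := k) fun a b => antipodeFlip k H (Δ a) * qMap k H t * (b ⊗ₜ[k] 1))
      (pMap k H Φ⁻) = F (cell₄ k H t * cell₁ k H Φ⁻) := fun t => by
    refine linearMap_congr₃ (f := (lin₂ (k := k) fun a b => antipodeFlip k H (Δ a) * qMap k H t *
      (b ⊗ₜ[k] 1)) ∘ₗ pMap k H) (g := F ∘ₗ
      LinearMap.mulLeft k (cell₄ k H t) ∘ₗ (cell₁ k H).toLinearMap) (fun a b c => ?_) Φ⁻
    simp only [LinearMap.comp_apply, LinearMap.mulLeft_apply,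
      AlgHom.toLinearMap_apply, cell₁_tmul, pMap_tmul, lin₂_tmul]
    refine linearMap_congr₃ (f := LinearMap.mulRight k ((b * βₕ * S c) ⊗ₜ[k] 1) ∘ₗ
      LinearMap.mulLeft k (antipodeFlip k H (Δ a)) ∘ₗ qMap k H) (g := F ∘ₗ
      LinearMap.mulRight k _ ∘ₗ (cell₄ k H).toLinearMap)
      (fun u v w => ?_) t
    refine linearMap_congr₂ (f := LinearMap.mulRight k ((b * βₕ * S c) ⊗ₜ[k] 1) ∘ₗ
      LinearMap.mulRight k (qMap k H (u ⊗ₜ[k] (v ⊗ₜ[k] w))) ∘ₗ antipodeFlip k H) (g := F ∘ₗ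
      LinearMap.mulLeft k (cell₄ k H (u ⊗ₜ[k] (v ⊗ₜ[k] w))) ∘ₗ
      LinearMap.mulRight k (1 ⊗ₜ[k] (1 ⊗ₜ[k] (b ⊗ₜ[k] c))) ∘ₗ (leg₁₂ k H).toLinearMap)
      (fun x y => ?_) (Δ a)
    simp [F, antipode_anti, mul_assoc]
  have hR : InvRight (leg₃₄ k H) F :=
    invRight_four _ _ (fun a b c d y => (S b * αₕ * c * y * S d) ⊗ₜ[k] S a)
      (by intros; simp [F, antipode_anti, mul_assoc])
  have hL : InvLeft (leg₂₃ k H) F :=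
    invLeft_four _ _ (fun a b c d y => (S b * y * c * βₕ * S d) ⊗ₜ[k] S a)
      (by intros; simp [F, antipode_anti, mul_assoc])
  -- The same cancellation leaves 1 ⊗ Φ⁻¹, evaluated by the other normalisation ∑ S(x¹)αx²βS(x³) =
  -- 1.
  rw [pR_eq, antipodeQR, key, pentagon₄₁, (hR.mul_cell₃ _).1, (hL.cell₂_mul _).2]
  have := linearMap_congr₃ (f := F ∘ₗ (cell₀ k H).toLinearMap)
    (g := (TensorProduct.mk k H H).flip 1 ∘ₗ sAlphaBetaS S αₕ βₕ) (fun a b c => by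
      simp [F, mul_assoc, antipode_unit]) Φ⁻
  refine this.trans ?_
  have h := antipode_reassociator_inv (k := k) (H := H)
  change sAlphaBetaS S αₕ βₕ Φ⁻ = 1 at h
  simp [h, one_two]

theorem betaSAlpha_Phi : betaSAlpha S αₕ βₕ Φ = 1 := antipode_reassociator
theorem sAlphaBetaS_PhiInv : sAlphaBetaS S αₕ βₕ Φ⁻ = 1 := antipode_reassociator_inv

/-- If `G` is invariant under left multiplication by `Δ(h)`, then `G(p_R (1 ⊗ α)) = G(1)`. -/
theorem apply_pR_mul_alpha (G : H² →ₗ[k] M) (hG : ∀ t h, G (Δ h * t) = ε h • G t) :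
    G (pR k H * (1 ⊗ₜ[k] αₕ)) = G 1 := by
  let F : H⁴ →ₗ[k] M := G ∘ₗ lin₄ fun a b c d => a ⊗ₜ[k] (b * βₕ * S c * αₕ * d)
  have key : G (pR k H * (1 ⊗ₜ[k] αₕ)) = F (cell₄ k H Φ⁻) := by
    rw [pR_eq]
    refine linearMap_congr₃ (f := G ∘ₗ LinearMap.mulRight k (1 ⊗ₜ[k] αₕ) ∘ₗ pMap k H)
      (g := F ∘ₗ (cell₄ k H).toLinearMap) (fun a b c => ?_) Φ⁻
    simp [F]
  have hR : InvRight (leg₂₃ k H) F :=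
    invRight_four _ _ (fun a b c d y => G (a ⊗ₜ[k] (b * y * S c * αₕ * d)))
      (by intros; simp [F, antipode_anti, mul_assoc])
  have hL : InvLeft (leg₃₄ k H) F :=
    invLeft_four _ _ (fun a b c d y => G (a ⊗ₜ[k] (b * βₕ * S c * y * d)))
      (by intros; simp [F, antipode_anti, mul_assoc])
  -- The assumption on G supplies the third absorption: the first two legs of F are exactly where G
  -- receives its left multiplication.
  have hL' : InvLeft (leg₁₂ k H) F := fun t h => by
    refine linearMap_congr₄ (f := F ∘ₗ LinearMap.mulLeft k (leg₁₂ k H (Δ h))) (g := ε h • F)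
      (fun a b c d => ?_) t
    have := hG (a ⊗ₜ[k] (b * βₕ * S c * αₕ * d)) h
    refine Eq.trans ?_ this
    refine linearMap_congr₂ (f := F ∘ₗ LinearMap.mulRight k (a ⊗ₜ[k] (b ⊗ₜ[k] (c ⊗ₜ[k] d))) ∘ₗ
      (leg₁₂ k H).toLinearMap) (g := G ∘ₗ LinearMap.mulRight k (a ⊗ₜ[k] (b * βₕ * S c * αₕ * d)))
      (fun u v => ?_) (Δ h)
    simp [F, mul_assoc]
  rw [key, pentagon₄_inv, (hR.mul_cell₂ _).1, mul_assoc, (hL'.cell₁_mul _).2, (hL.cell₃_mul _).2]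
  have := linearMap_congr₃ (f := F ∘ₗ (cell₀ k H).toLinearMap)
    (g := G ∘ₗ TensorProduct.mk k H H 1 ∘ₗ betaSAlpha S αₕ βₕ) (fun a b c => by
      simp [F, mul_assoc]) Φ
  refine this.trans ?_
  simp [betaSAlpha_Phi, one_two]

/-- If `G` is invariant under right multiplication by `Δ(h)`, then `G((β ⊗ 1) q_L) = G(1)`. -/
theorem apply_beta_mul_qL (G : H² →ₗ[k] M) (hG : ∀ t h, G (t * Δ h) = ε h • G t) :
    G ((βₕ ⊗ₜ[k] 1) * qL k H) = G 1 := by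
  let F : H⁴ →ₗ[k] M := G ∘ₗ lin₄ fun a b c d => (a * βₕ * S b * αₕ * c) ⊗ₜ[k] d
  have key : G ((βₕ ⊗ₜ[k] 1) * qL k H) = F (cell₀ k H Φ⁻) := by
    rw [qL]
    refine linearMap_congr₃ (f := G ∘ₗ LinearMap.mulLeft k (βₕ ⊗ₜ[k] 1) ∘ₗ qLMap k H)
      (g := F ∘ₗ (cell₀ k H).toLinearMap) (fun a b c => ?_) Φ⁻
    simp [F, mul_assoc]
  have hL : InvLeft (leg₂₃ k H) F :=
    invLeft_four _ _ (fun a b c d y => G ((a * βₕ * S b * y * c) ⊗ₜ[k] d))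
      (by intros; simp [F, antipode_anti, mul_assoc])
  have hR : InvRight (leg₁₂ k H) F :=
    invRight_four _ _ (fun a b c d y => G ((a * y * S b * αₕ * c) ⊗ₜ[k] d))
      (by intros; simp [F, antipode_anti, mul_assoc])
  have hR' : InvRight (leg₃₄ k H) F := fun t h => by
    refine linearMap_congr₄ (f := F ∘ₗ LinearMap.mulRight k (leg₃₄ k H (Δ h))) (g := ε h • F)
      (fun a b c d => ?_) t
    have := hG ((a * βₕ * S b * αₕ * c) ⊗ₜ[k] d) h
    refine Eq.trans ?_ this
    refine linearMap_congr₂ (f := F ∘ₗ LinearMap.mulLeft k (a ⊗ₜ[k] (b ⊗ₜ[k] (c ⊗ₜ[k] d))) ∘ₗ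
      (leg₃₄ k H).toLinearMap) (g := G ∘ₗ LinearMap.mulLeft k ((a * βₕ * S b * αₕ * c) ⊗ₜ[k] d))
      (fun u v => ?_) (Δ h)
    simp [F, mul_assoc]
  rw [key, pentagon₀_inv, (hR'.mul_cell₃ _).2, (hR.mul_cell₁ _).2, (hL.cell₂_mul _).1]
  have := linearMap_congr₃ (f := F ∘ₗ (cell₄ k H).toLinearMap)
    (g := G ∘ₗ (TensorProduct.mk k H H).flip 1 ∘ₗ betaSAlpha S αₕ βₕ) (fun a b c => by
      simp [F, mul_assoc]) Φ
  refine this.trans ?_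
  simp [betaSAlpha_Phi, one_two]

end Canonical

/-! ### Bijectivity of the antipode -/

section Bijective

variable {C : Type*} [Ring C] [Algebra k C]

/-- The antipode is an epimorphism: algebra maps that agree on its image are equal. -/
theorem algHom_eq_of_comp_antipode {φ ψ : H →ₐ[k] C} (h : ∀ x, φ (S x) = ψ (S x)) : φ = ψ := by
  -- At Φ this interpolates between ψ and φ applied to ∑ X¹βS(X²)αX³ = 1. The cut lies just after
  -- the antipode, where the two maps can be exchanged.
  let L : H³ →ₗ[k] C := lin₃ fun a b c => ψ (a * βₕ * S b) * φ (αₕ * c)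
  have hR : InvRight (face₃ k H) L :=
    invRight_three _ _ (fun a b c y => ψ (a * y * S b) * φ (αₕ * c))
      (by intros; simp [L, antipode_anti, mul_assoc])
  have hL : InvLeft (face₀ k H) L :=
    invLeft_three _ _ (fun a b c y => ψ (a * βₕ * S b) * φ (y * c))
      (by intros; simp [L, antipode_anti, mul_assoc, h])
  -- Quasi-coassociativity moves Δ(x) across Φ; absorption on both sides leaves x in the outer left
  -- leg and in the outer right leg.
  have hcomm : ∀ x, ψ x * L Φ = L Φ * φ x := fun x => by
    have h₁ := hL.face₂_mul Φ x
    rw [coassoc, hR.mul_face₁] at h₁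
    have h₂ := linearMap_congr₃ (f := L ∘ₗ LinearMap.mulLeft k (x ⊗ₜ[k] (1 ⊗ₜ[k] 1)))
      (g := LinearMap.mulLeft k (ψ x) ∘ₗ L) (fun a b c => by simp [L, mul_assoc]) Φ
    have h₃ := linearMap_congr₃ (f := L ∘ₗ LinearMap.mulRight k (1 ⊗ₜ[k] (1 ⊗ₜ[k] x)))
      (g := LinearMap.mulRight k (φ x) ∘ₗ L) (fun a b c => by simp [L, mul_assoc]) Φ
    exact h₂.symm.trans (h₁.symm.trans h₃)
  -- The pentagon compares F at 1 ⊗ Φ, which is ψ(α) L(Φ), with F at Φ⁻¹ ⊗ 1, where ∑ S(x¹)αx²βS(x³)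
  -- = 1 leaves φ(α).
  have halpha : ψ αₕ * L Φ = φ αₕ := by
    let F : H⁴ →ₗ[k] C := lin₄ fun a b c d => ψ (S a * αₕ * b * βₕ * S c) * φ (αₕ * d)
    have h₀ := linearMap_congr₃ (f := LinearMap.mulLeft k (ψ αₕ) ∘ₗ L)
      (g := F ∘ₗ (cell₀ k H).toLinearMap)
      (fun a b c => by simp [L, F, mul_assoc, antipode_unit]) Φ
    have hR : InvRight (leg₂₃ k H) F :=
      invRight_four _ _ (fun a b c d y => ψ (S a * αₕ * b * y * S c) * φ (αₕ * d))
        (by intros; simp [F, antipode_anti, mul_assoc])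
    have hL : InvLeft (leg₃₄ k H) F :=
      invLeft_four _ _ (fun a b c d y => ψ (S a * αₕ * b * βₕ * S c) * φ (y * d))
        (by intros; simp [F, antipode_anti, mul_assoc, h])
    have hL' : InvLeft (leg₁₂ k H) F :=
      invLeft_four _ _ (fun a b c d y => ψ (S a * y * b * βₕ * S c) * φ (αₕ * d))
        (by intros; simp [F, antipode_anti, mul_assoc])
    have h₁ := linearMap_congr₃ (f := F ∘ₗ (cell₄ k H).toLinearMap)
      (g := LinearMap.mulRight k (φ αₕ) ∘ₗ ψ.toLinearMap ∘ₗ sAlphaBetaS S αₕ βₕ)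
      (fun a b c => by simp [F, mul_assoc]) Φ⁻
    have h₂ : F (cell₀ k H Φ) = F (cell₄ k H Φ⁻) := by
      rw [pentagon₀, (hR.mul_cell₂ _).2, mul_assoc, (hL.cell₃_mul _).1,
        (hL'.cell₁_mul _).1]
    refine h₀.trans (h₂.trans (h₁.trans ?_))
    simp [sAlphaBetaS_PhiInv]
  -- Multiply ψ(∑ S(x¹)αx²βS(x³)) = 1 by L(Φ): it passes x²βS(x³) by intertwining, turns ψ(α) into
  -- φ(α), and S(x¹) has the same image under both maps.
  have hone : L Φ = 1 := by
    have h₁ := linearMap_congr₃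
      (f := LinearMap.mulRight k (L Φ) ∘ₗ ψ.toLinearMap ∘ₗ sAlphaBetaS S αₕ βₕ)
      (g := φ.toLinearMap ∘ₗ sAlphaBetaS S αₕ βₕ) (fun a b c => by
        have := hcomm (b * βₕ * S c)
        simp only [map_mul] at this
        simp only [LinearMap.comp_apply, LinearMap.mulRight_apply, AlgHom.toLinearMap_apply,
          sAlphaBetaS_tmul, map_mul, mul_assoc] at this ⊢
        rw [this, ← h, ← halpha]
        simp only [mul_assoc]) Φ⁻
    simpa [sAlphaBetaS_PhiInv] using h₁
  refine AlgHom.ext fun x => ?_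
  have := hcomm x
  rw [hone, one_mul, mul_one] at this
  exact this.symm

variable (k H) in
/-- The square of the antipode. -/
def antipodeSq : H →ₐ[k] H :=
  AlgHom.ofLinearMap (S ∘ₗ S) (by simp [antipode_unit]) (by simp [antipode_anti])

/-- The epimorphism property is used twice, first for φ ∘ S and ψ ∘ S, which are algebra maps into
the opposite algebra of C. -/
theorem algHom_eq_of_comp_antipodeSq {φ ψ : H →ₐ[k] C}
    (h : φ.comp (antipodeSq k H) = ψ.comp (antipodeSq k H)) : φ = ψ := by
  refine algHom_eq_of_comp_antipode fun x => ?_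
  let flip : (H →ₐ[k] C) → (H →ₐ[k] Cᵐᵒᵖ) := fun θ =>
    AlgHom.ofLinearMap ((MulOpposite.opLinearEquiv k).toLinearMap ∘ₗ θ.toLinearMap ∘ₗ S)
      (by simp [antipode_unit]) (by simp [antipode_anti])
  have : flip φ = flip ψ := algHom_eq_of_comp_antipode fun y =>
    congrArg MulOpposite.op (DFunLike.congr_fun h y)
  exact MulOpposite.op_injective (DFunLike.congr_fun this x)

theorem algHom_eq_of_comp_antipodeSq_pow (n : ℕ) {φ ψ : H →ₐ[k] C}
    (h : φ.comp (antipodeSq k H ^ n) = ψ.comp (antipodeSq k H ^ n)) : φ = ψ := by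
  induction n with
  | zero => exact h
  | succ n ih =>
    refine ih (algHom_eq_of_comp_antipodeSq ?_)
    rw [pow_succ] at h
    exact h

theorem antipode_bijective [FiniteDimensional k H] : Function.Bijective S := by
  suffices Function.Injective S from ⟨this, LinearMap.injective_iff_surjective.1 this⟩
  have hpow : ∀ n, (antipodeSq k H ^ n).toLinearMap = (antipodeSq k H).toLinearMap ^ n := fun n => by
    induction n with
    | zero => rfl
    | succ n ih => rw [pow_succ, pow_succ, ← ih]; rfl
  -- Fitting: kernel and range of a high power of S² are complementary. The bound n ≥ 1 is needed at
  -- the end, where S is split off from T.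
  obtain ⟨n, hn, hcompl⟩ := ((Filter.eventually_ge_atTop 1).and
    (antipodeSq k H).toLinearMap.eventually_isCompl_ker_pow_range_pow).exists
  set T := antipodeSq k H ^ n with hT
  rw [← hpow] at hcompl
  let σ : T.range →ₐ[k] T.range := (T.rangeRestrict).comp T.range.val
  have hσ : Function.Injective σ := by
    rw [injective_iff_map_eq_zero]
    rintro ⟨_, x, rfl⟩ hx
    have h₁ : T (T x) = 0 := congrArg Subtype.val hx
    have h₂ := Submodule.disjoint_def.1 hcompl.disjoint (T x) h₁ ⟨x, rfl⟩
    exact Subtype.ext h₂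
  have hσ' : Function.Bijective σ := ⟨hσ, LinearMap.injective_iff_surjective (f := σ.toLinearMap).1 hσ⟩
  let e := AlgEquiv.ofBijective σ hσ'
  -- T is bijective on its own range, so applying T and then undoing it inside the range is an
  -- algebra projection of H onto that range.
  let π : H →ₐ[k] H := T.range.val.comp (e.symm.toAlgHom.comp T.rangeRestrict)
  -- Both maps restrict to the identity on the range of T, so the epimorphism property of T
  -- identifies them.
  have hπ : π = AlgHom.id k H := by
    refine algHom_eq_of_comp_antipodeSq_pow n (AlgHom.ext fun x => ?_)
    change ((e.symm (T.rangeRestrict (T x)) : T.range) : H) = T x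
    have : T.rangeRestrict (T x) = e (T.rangeRestrict x) := rfl
    rw [this, e.symm_apply_apply]; rfl
  have hTinj : Function.Injective T := fun x y hxy => by
    have : T.rangeRestrict x = T.rangeRestrict y := Subtype.ext hxy
    have h₂ : π x = π y := by
      change ((e.symm (T.rangeRestrict x) : T.range) : H) = e.symm (T.rangeRestrict y)
      rw [this]
    rwa [hπ] at h₂
  obtain ⟨m, rfl⟩ := Nat.exists_eq_add_of_le' hn
  intro x y hxy
  refine hTinj ?_
  have : ∀ z, T z = (antipodeSq k H ^ m) (S (S z)) := fun z => by rw [hT, pow_succ]; rfl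
  rw [this, this, hxy]

end Bijective

/-! ### Counit values of α, β and S -/

section CounitValues

/-- Apply ε to ∑ X¹βS(X²)αX³ = 1; the counits on the outer legs of Φ leave S(1) = 1. -/
theorem counit_alpha_mul_beta : ε αₕ * ε βₕ = 1 := by
  have h₁ := linearMap_congr₃ (f := (counit (k := k) (H := H)).toLinearMap ∘ₗ betaSAlpha S αₕ βₕ)
    (g := (ε αₕ * ε βₕ) • (counit (k := k) (H := H)).toLinearMap ∘ₗ S ∘ₗ
      contractRight₂ (counit (k := k) (H := H)).toLinearMap ∘ₗ (counit₁ k H).toLinearMap)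
    (fun a b c => by simp; ring) Φ
  simp [betaSAlpha_Phi, counit₁_Phi, one_two, antipode_unit] at h₁
  exact h₁.symm

/-- Applying ε to ∑ S(h₁)αh₂ = ε(h)α gives the claim up to the factor ε(α), which is invertible by
`counit_alpha_mul_beta`. -/
theorem counit_antipode (h : H) : ε (S h) = ε h := by
  have h₁ := congrArg ε (antipode_left (k := k) h)
  have h₂ := linearMap_congr₂ (f := (counit (k := k) (H := H)).toLinearMap ∘ₗ sAlpha S αₕ)
    (g := ε αₕ • (counit (k := k) (H := H)).toLinearMap ∘ₗ S ∘ₗ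
      contractRight₂ (counit (k := k) (H := H)).toLinearMap)
    (fun a b => by simp; ring) (Δ h)
  have h₃ := h₂.symm.trans h₁
  simp only [LinearMap.smul_apply, LinearMap.comp_apply, contractRight_comul] at h₃
  simp only [map_smul, smul_eq_mul, AlgHom.toLinearMap_apply] at h₃
  have h₄ := congrArg (· * ε βₕ) h₃
  have h₅ := counit_alpha_mul_beta (k := k) (H := H)
  calc ε (S h) = (ε αₕ * ε βₕ) * ε (S h) := by rw [h₅, one_mul]
    _ = ε αₕ * ε (S h) * ε βₕ := by ring
    _ = ε h * (ε αₕ * ε βₕ) := by rw [h₃]; ring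
    _ = ε h := by rw [h₅, mul_one]

end CounitValues

/-! ### The inverse antipode -/

section Inverse

variable [FiniteDimensional k H]

theorem antipode_isUnit : IsUnit (antipode : Module.End k H) :=
  (Module.End.isUnit_iff _).2 antipode_bijective

@[simp] theorem antipode_antipodeInv (h : H) : S (S⁻ h) = h :=
  DFunLike.congr_fun (Ring.mul_inverse_cancel _ (antipode_isUnit (k := k) (H := H))) h

@[simp] theorem antipodeInv_antipode (h : H) : S⁻ (S h) = h :=
  DFunLike.congr_fun (Ring.inverse_mul_cancel _ (antipode_isUnit (k := k) (H := H))) h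

theorem antipodeInv_anti (a b : H) : S⁻ (a * b) = S⁻ b * S⁻ a := by
  apply (antipode_bijective (k := k) (H := H)).1
  simp [antipode_anti]

theorem antipodeInv_unit : S⁻ 1 = 1 := by
  apply (antipode_bijective (k := k) (H := H)).1
  simp [antipode_unit]

theorem counit_antipodeInv (h : H) : ε (S⁻ h) = ε h := by
  rw [← counit_antipode, antipode_antipodeInv]

@[simp] theorem antipodeInvFlip_tmul (a b : H) : AIF (a ⊗ₜ[k] b) = S⁻ b ⊗ₜ[k] S⁻ a := rfl

@[simp] theorem antipodeFlip_antipodeInvFlip (t : H²) : AF (AIF t) = t :=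
  linearMap_congr₂ (f := AF ∘ₗ AIF) (g := LinearMap.id) (fun a b => by simp) t

@[simp] theorem antipodeInvFlip_antipodeFlip (t : H²) : AIF (AF t) = t :=
  linearMap_congr₂ (f := AIF ∘ₗ AF) (g := LinearMap.id) (fun a b => by simp) t

theorem antipodeInvFlip_mul (x y : H²) : AIF (x * y) = AIF y * AIF x := by
  conv_lhs => rw [← antipodeFlip_antipodeInvFlip x, ← antipodeFlip_antipodeInvFlip y,
    ← antipodeFlip_mul, antipodeInvFlip_antipodeFlip]

theorem antipodeInvFlip_one : AIF 1 = 1 := by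
  simp [one_two, antipodeInv_unit]

/-- Flipping with S removes the inverse antipode from q_R. The relations of q_R were therefore
available before S was known to be bijective, and are carried over by this equality. -/
theorem antipodeFlip_qR : AF (qR k H) = antipodeQR k H :=
  linearMap_congr₃ (f := AF ∘ₗ TensorProduct.map LinearMap.id
    (LinearMap.mul' k H ∘ₗ
      TensorProduct.map (S⁻ ∘ₗ LinearMap.mulLeft k (α k)) LinearMap.id ∘ₗ
      (TensorProduct.comm k H H).toLinearMap)) (g := qMap k H)
    (fun a b c => by simp [antipode_anti, mul_assoc]) Φ

end Inverse

/-! ### The elements γ and δ and their invariance -/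

section Twist

variable {M : Type*} [AddCommGroup M] [Module k M]

variable (k H) in
/-- `a ⊗ b ⊗ c ⊗ d ↦ S(b) α c ⊗ S(a) α d`. -/
def gamMap : H⁴ →ₗ[k] H² := lin₄ fun a b c d => (S b * αₕ * c) ⊗ₜ[k] (S a * αₕ * d)

variable (k H) in
/-- `a ⊗ b ⊗ c ⊗ d ↦ a β S(d) ⊗ b β S(c)`. -/
def delMap : H⁴ →ₗ[k] H² := lin₄ fun a b c d => (a * βₕ * S d) ⊗ₜ[k] (b * βₕ * S c)

theorem gam_eq : gam k H = gamMap k H (cell₄ k H Φ * cell₁ k H Φ⁻) := by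
  rw [gam, tensorOne_eq]
  exact linearMap_congr₄ (f := TensorProduct.map (sAlpha antipode (α k)) (sAlpha antipode (α k)) ∘ₗ
    innerOuter k H) (g := gamMap k H) (fun _ _ _ _ => rfl) _

theorem del_eq : del k H = delMap k H (cell₁ k H Φ * cell₄ k H Φ⁻) := by
  rw [del, tensorOne_eq]
  exact linearMap_congr₄ (f := (TensorProduct.comm k H H).toLinearMap ∘ₗ
    TensorProduct.map (betaS antipode (β k)) (betaS antipode (β k)) ∘ₗ innerOuter k H)
    (g := delMap k H) (fun _ _ _ _ => rfl) _

variable (k H) in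
/-- `a ⊗ b ⊗ c ↦ (S ⊗ S)(Δᵒᵖ(a)) Q (b ⊗ α c)`. -/
def gamMapLeft : H³ →ₗ[k] H² := lin₃ fun a b c => AF (Δ a) * antipodeQR k H * (b ⊗ₜ[k] (αₕ * c))

variable (k H) in
/-- `a ⊗ b ⊗ c ↦ Δ(a) p_R (β S(c) ⊗ S(b))`. -/
def delMapLeft : H³ →ₗ[k] H² := lin₃ fun a b c => Δ a * pR k H * ((βₕ * S c) ⊗ₜ[k] S b)

/-- `γ = (S ⊗ S)(Δᵒᵖ(x¹)) Q (x² ⊗ α x³)`. -/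
theorem gam_eq_left : gam k H = gamMapLeft k H Φ⁻ := by
  rw [gam_eq]
  refine linearMap_congr₃ (f := gamMap k H ∘ₗ LinearMap.mulLeft k (cell₄ k H Φ) ∘ₗ
    (cell₁ k H).toLinearMap) (g := gamMapLeft k H) (fun a b c => ?_) Φ⁻
  simp only [LinearMap.comp_apply, LinearMap.mulLeft_apply, AlgHom.toLinearMap_apply, cell₁_tmul,
    gamMapLeft, lin₃_tmul]
  refine linearMap_congr₂ (f := gamMap k H ∘ₗ LinearMap.mulLeft k (cell₄ k H Φ) ∘ₗ
    LinearMap.mulRight k (1 ⊗ₜ[k] (1 ⊗ₜ[k] (b ⊗ₜ[k] c))) ∘ₗ (leg₁₂ k H).toLinearMap)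
    (g := LinearMap.mulRight k (b ⊗ₜ[k] (αₕ * c)) ∘ₗ LinearMap.mulRight k (antipodeQR k H) ∘ₗ AF)
    (fun x y => ?_) (Δ a)
  refine linearMap_congr₃ (f := gamMap k H ∘ₗ LinearMap.mulRight k _ ∘ₗ (cell₄ k H).toLinearMap)
    (g := LinearMap.mulRight k (b ⊗ₜ[k] (αₕ * c)) ∘ₗ LinearMap.mulLeft k (AF (x ⊗ₜ[k] y)) ∘ₗ qMap k H)
    (fun u v w => ?_) Φ
  simp [gamMap, antipode_anti, mul_assoc]

/-- `δ = Δ(X¹) p_R (β S(X³) ⊗ S(X²))`. -/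
theorem del_eq_left : del k H = delMapLeft k H Φ := by
  rw [del_eq]
  refine linearMap_congr₃ (f := delMap k H ∘ₗ LinearMap.mulRight k (cell₄ k H Φ⁻) ∘ₗ
    (cell₁ k H).toLinearMap) (g := delMapLeft k H) (fun a b c => ?_) Φ
  simp only [LinearMap.comp_apply, LinearMap.mulRight_apply, AlgHom.toLinearMap_apply, cell₁_tmul,
    delMapLeft, lin₃_tmul]
  refine linearMap_congr₂ (f := delMap k H ∘ₗ LinearMap.mulRight k (cell₄ k H Φ⁻) ∘ₗ
    LinearMap.mulRight k (1 ⊗ₜ[k] (1 ⊗ₜ[k] (b ⊗ₜ[k] c))) ∘ₗ (leg₁₂ k H).toLinearMap)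
    (g := LinearMap.mulRight k ((βₕ * S c) ⊗ₜ[k] S b) ∘ₗ LinearMap.mulRight k (pR k H))
    (fun x y => ?_) (Δ a)
  rw [pR_eq]
  refine linearMap_congr₃ (f := delMap k H ∘ₗ LinearMap.mulLeft k _ ∘ₗ (cell₄ k H).toLinearMap)
    (g := LinearMap.mulRight k ((βₕ * S c) ⊗ₜ[k] S b) ∘ₗ LinearMap.mulLeft k (x ⊗ₜ[k] y) ∘ₗ pMap k H)
    (fun u v w => ?_) Φ⁻
  simp [delMap, antipode_anti, mul_assoc]

/-- `γ = (S(X²) ⊗ S(X¹) α) q_L Δ(X³)`. -/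
theorem gam_eq_right : gam k H =
    (lin₃ (k := k) fun a b c => (S b ⊗ₜ[k] (S a * αₕ)) * qL k H * Δ c) Φ := by
  have hL : InvLeft (leg₂₃ k H) (gamMap k H) :=
    invLeft_four _ _ (fun a b c d y => (S b * y * c) ⊗ₜ[k] (S a * αₕ * d))
      (by intros; simp [gamMap, antipode_anti, mul_assoc])
  rw [gam_eq, pentagon₄₁, mul_assoc, (hL.cell₂_mul _).2]
  refine linearMap_congr₃ (f := gamMap k H ∘ₗ LinearMap.mulLeft k (cell₀ k H Φ⁻) ∘ₗ
    (cell₃ k H).toLinearMap) (fun a b c => ?_) Φ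
  simp only [LinearMap.comp_apply, LinearMap.mulLeft_apply, AlgHom.toLinearMap_apply, cell₃_tmul,
    lin₃_tmul]
  refine linearMap_congr₂ (f := gamMap k H ∘ₗ LinearMap.mulLeft k (cell₀ k H Φ⁻) ∘ₗ
    LinearMap.mulRight k (a ⊗ₜ[k] (b ⊗ₜ[k] (1 ⊗ₜ[k] 1))) ∘ₗ (leg₃₄ k H).toLinearMap)
    (g := LinearMap.mulLeft k (S b ⊗ₜ[k] (S a * αₕ) * qL k H)) (fun x y => ?_) (Δ c)
  refine linearMap_congr₃ (f := gamMap k H ∘ₗ LinearMap.mulRight k _ ∘ₗ (cell₀ k H).toLinearMap)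
    (g := LinearMap.mulRight k (x ⊗ₜ[k] y) ∘ₗ LinearMap.mulLeft k (S b ⊗ₜ[k] (S a * αₕ)) ∘ₗ qLMap k H)
    (fun u v w => ?_) Φ⁻
  simp [gamMap, antipode_anti, mul_assoc]

variable (k H) in
/-- `S(X³) ⊗ X¹ β S(X²)`, the image of `p_L` under `a ⊗ b ↦ S(b) ⊗ S(a)`. -/
def antipodePL : H² := (lin₃ (k := k) fun a b c => S c ⊗ₜ[k] (a * βₕ * S b)) Φ

/-- `δ = (x¹ β ⊗ x²) P (S ⊗ S)(Δᵒᵖ(x³))` for `P = S(X³) ⊗ X¹ β S(X²)`. -/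
theorem del_eq_right : del k H =
    (lin₃ (k := k) fun a b c => ((a * βₕ) ⊗ₜ[k] b) * antipodePL k H * AF (Δ c)) Φ⁻ := by
  have hR : InvRight (leg₂₃ k H) (delMap k H) :=
    invRight_four _ _ (fun a b c d y => (a * βₕ * S d) ⊗ₜ[k] (b * y * S c))
      (by intros; simp [delMap, antipode_anti, mul_assoc])
  rw [del_eq, pentagon₁₄, (hR.mul_cell₂ _).1]
  refine linearMap_congr₃ (f := delMap k H ∘ₗ LinearMap.mulRight k (cell₀ k H Φ) ∘ₗ
    (cell₃ k H).toLinearMap) (fun a b c => ?_) Φ⁻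
  simp only [LinearMap.comp_apply, LinearMap.mulRight_apply, AlgHom.toLinearMap_apply, cell₃_tmul,
    lin₃_tmul]
  refine linearMap_congr₂ (f := delMap k H ∘ₗ LinearMap.mulRight k (cell₀ k H Φ) ∘ₗ
    LinearMap.mulRight k (a ⊗ₜ[k] (b ⊗ₜ[k] (1 ⊗ₜ[k] 1))) ∘ₗ (leg₃₄ k H).toLinearMap)
    (g := LinearMap.mulLeft k ((a * βₕ) ⊗ₜ[k] b * antipodePL k H) ∘ₗ AF) (fun x y => ?_) (Δ c)
  refine linearMap_congr₃ (f := delMap k H ∘ₗ LinearMap.mulLeft k _ ∘ₗ (cell₀ k H).toLinearMap)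
    (g := LinearMap.mulRight k (AF (x ⊗ₜ[k] y)) ∘ₗ LinearMap.mulLeft k ((a * βₕ) ⊗ₜ[k] b) ∘ₗ
      lin₃ (k := k) fun a b c => S c ⊗ₜ[k] (a * βₕ * S b))
    (fun u v w => ?_) Φ
  simp [delMap, antipode_anti, mul_assoc]

variable (k H) in
/-- `a ⊗ b ↦ (S ⊗ S)(Δᵒᵖ(a)) γ Δ(b)`. -/
def gamSandwich : H² →ₗ[k] H² := lin₂ fun a b => AF (Δ a) * gam k H * Δ b

variable (k H) in
/-- `a ⊗ b ↦ Δ(a) δ (S ⊗ S)(Δᵒᵖ(b))`. -/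
def delSandwich : H² →ₗ[k] H² := lin₂ fun a b => Δ a * del k H * AF (Δ b)

/-- `(S ⊗ S)(Δᵒᵖ(h₁)) γ Δ(h₂) = ε(h) γ`. -/
theorem gamSandwich_comul (h : H) : gamSandwich k H (Δ h) = ε h • gam k H := by
  have h₁ : ∀ t : H³, (lin₂ (k := k) fun a b => AF (Δ a) * gamMapLeft k H t * Δ b) (Δ h) =
      gamMapLeft k H (t * face₂ k H (Δ h)) := fun t => by
    refine linearMap_congr₂ (g := gamMapLeft k H ∘ₗ LinearMap.mulLeft k t ∘ₗ
      (face₂ k H).toLinearMap) (fun a b => ?_) (Δ h)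
    simp only [LinearMap.comp_apply, LinearMap.mulLeft_apply, AlgHom.toLinearMap_apply,
      face₂_tmul', lin₂_tmul]
    refine linearMap_congr₂ (f := LinearMap.mulLeft k (AF (Δ a) * gamMapLeft k H t))
      (g := gamMapLeft k H ∘ₗ LinearMap.mulLeft k t ∘ₗ
        LinearMap.mulLeft k (a ⊗ₜ[k] (1 ⊗ₜ[k] 1)) ∘ₗ (face₀ k H).toLinearMap) (fun x y => ?_) (Δ b)
    refine linearMap_congr₃ (f := LinearMap.mulRight k (x ⊗ₜ[k] y) ∘ₗ LinearMap.mulLeft k (AF (Δ a)) ∘ₗ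
      gamMapLeft k H) (g := gamMapLeft k H ∘ₗ LinearMap.mulRight k _) (fun u v w => ?_) t
    simp [gamMapLeft, antipodeFlip_mul, mul_assoc]
  -- The two halves of Δ(h₁) pass through Q and become S(h₁) in the second leg, next to αh₂, where
  -- the antipode axiom applies.
  have h₂ : ∀ t : H³, gamMapLeft k H (face₁ k H (Δ h) * t) = ε h • gamMapLeft k H t := fun t => by
    refine linearMap_congr₃ (f := gamMapLeft k H ∘ₗ LinearMap.mulLeft k _)
      (g := ε h • gamMapLeft k H) (fun u v w => ?_) t
    have h₃ : (lin₂ (k := k) fun a b => AF (Δ u) * (antipodeQR k H * (1 ⊗ₜ[k] S a)) *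
        (v ⊗ₜ[k] (αₕ * b * w))) (Δ h) = gamMapLeft k H (face₁ k H (Δ h) * (u ⊗ₜ[k] (v ⊗ₜ[k] w))) := by
      refine linearMap_congr₂ (g := gamMapLeft k H ∘ₗ LinearMap.mulRight k (u ⊗ₜ[k] (v ⊗ₜ[k] w)) ∘ₗ
        (face₁ k H).toLinearMap) (fun a b => ?_) (Δ h)
      simp only [LinearMap.comp_apply, LinearMap.mulRight_apply, AlgHom.toLinearMap_apply,
        face₁_tmul, lin₂_tmul, ← antipodeFlip_mul_antipodeQR]
      refine linearMap_congr₂ (f := LinearMap.mulRight k (v ⊗ₜ[k] (αₕ * b * w)) ∘ₗ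
        LinearMap.mulLeft k (AF (Δ u)) ∘ₗ
        lin₂ (k := k) fun a b => AF (Δ a) * antipodeQR k H * (b ⊗ₜ[k] 1))
        (g := gamMapLeft k H ∘ₗ LinearMap.mulRight k (u ⊗ₜ[k] (v ⊗ₜ[k] w)) ∘ₗ
          LinearMap.mulRight k (1 ⊗ₜ[k] (1 ⊗ₜ[k] b)) ∘ₗ (face₃ k H).toLinearMap) (fun x y => ?_) (Δ a)
      simp [gamMapLeft, antipodeFlip_mul, mul_assoc]
    refine h₃.symm.trans ?_
    have h₄ := comul_alpha (lin₂ (k := k) fun a b => AF (Δ u) * (antipodeQR k H * (1 ⊗ₜ[k] S a)) *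
        (v ⊗ₜ[k] (αₕ * b * w))) (fun y => AF (Δ u) * antipodeQR k H * (v ⊗ₜ[k] (y * w)))
        (by constructor <;> intros <;> simp [add_mul, mul_add, TensorProduct.tmul_add])
        (fun a b => by simp [mul_assoc]) h
    rw [h₄]
    simp [gamMapLeft, antipode_unit, one_two, mul_assoc]
  refine Eq.trans ?_ ((h₁ Φ⁻).trans ?_)
  · rw [← gam_eq_left]; rfl
  -- Quasi-coassociativity moves the coproduct from the right of Φ⁻¹ to its left, where it is
  -- absorbed.
  · rw [← coassoc_inv, h₂, gam_eq_left]

/-- `Δ(h₁) δ (S ⊗ S)(Δᵒᵖ(h₂)) = ε(h) δ`. -/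
theorem delSandwich_comul (h : H) : delSandwich k H (Δ h) = ε h • del k H := by
  have h₁ : ∀ t : H³, (lin₂ (k := k) fun a b => Δ a * delMapLeft k H t * AF (Δ b)) (Δ h) =
      delMapLeft k H (face₂ k H (Δ h) * t) := fun t => by
    refine linearMap_congr₂ (g := delMapLeft k H ∘ₗ LinearMap.mulRight k t ∘ₗ
      (face₂ k H).toLinearMap) (fun a b => ?_) (Δ h)
    simp only [LinearMap.comp_apply, LinearMap.mulRight_apply, AlgHom.toLinearMap_apply,
      face₂_tmul', lin₂_tmul]
    refine linearMap_congr₂ (f := LinearMap.mulLeft k (Δ a * delMapLeft k H t) ∘ₗ AF)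
      (g := delMapLeft k H ∘ₗ LinearMap.mulRight k t ∘ₗ
        LinearMap.mulLeft k (a ⊗ₜ[k] (1 ⊗ₜ[k] 1)) ∘ₗ (face₀ k H).toLinearMap) (fun x y => ?_) (Δ b)
    refine linearMap_congr₃ (f := LinearMap.mulRight k (AF (x ⊗ₜ[k] y)) ∘ₗ LinearMap.mulLeft k (Δ a) ∘ₗ
      delMapLeft k H) (g := delMapLeft k H ∘ₗ LinearMap.mulLeft k _) (fun u v w => ?_) t
    simp [delMapLeft, antipode_anti, mul_assoc]
  -- Dually, Δ(h₁₁) p_R (1 ⊗ S(h₁₂)) = p_R (h₁ ⊗ 1) puts h₁ directly in front of βS(h₂).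
  have h₂ : ∀ t : H³, delMapLeft k H (t * face₁ k H (Δ h)) = ε h • delMapLeft k H t := fun t => by
    refine linearMap_congr₃ (f := delMapLeft k H ∘ₗ LinearMap.mulRight k _)
      (g := ε h • delMapLeft k H) (fun u v w => ?_) t
    have h₃ : (lin₂ (k := k) fun a b => Δ u * (pR k H * (a ⊗ₜ[k] 1)) *
        ((βₕ * S b * S w) ⊗ₜ[k] S v)) (Δ h) = delMapLeft k H ((u ⊗ₜ[k] (v ⊗ₜ[k] w)) * face₁ k H (Δ h)) := by
      refine linearMap_congr₂ (g := delMapLeft k H ∘ₗ LinearMap.mulLeft k (u ⊗ₜ[k] (v ⊗ₜ[k] w)) ∘ₗ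
        (face₁ k H).toLinearMap) (fun a b => ?_) (Δ h)
      simp only [LinearMap.comp_apply, LinearMap.mulLeft_apply, AlgHom.toLinearMap_apply,
        face₁_tmul, lin₂_tmul, ← comul_mul_pR]
      refine linearMap_congr₂ (f := LinearMap.mulRight k ((βₕ * S b * S w) ⊗ₜ[k] S v) ∘ₗ
        LinearMap.mulLeft k (Δ u) ∘ₗ
        lin₂ (k := k) fun a b => Δ a * pR k H * (1 ⊗ₜ[k] S b))
        (g := delMapLeft k H ∘ₗ LinearMap.mulLeft k (u ⊗ₜ[k] (v ⊗ₜ[k] w)) ∘ₗ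
          LinearMap.mulRight k (1 ⊗ₜ[k] (1 ⊗ₜ[k] b)) ∘ₗ (face₃ k H).toLinearMap) (fun x y => ?_) (Δ a)
      simp [delMapLeft, antipode_anti, mul_assoc]
    refine h₃.symm.trans ?_
    have h₄ := comul_beta (lin₂ (k := k) fun a b => Δ u * (pR k H * (a ⊗ₜ[k] 1)) *
        ((βₕ * S b * S w) ⊗ₜ[k] S v)) (fun y => Δ u * pR k H * ((y * S w) ⊗ₜ[k] S v))
        (by constructor <;> intros <;> simp [add_mul, mul_add, TensorProduct.add_tmul,
              ← TensorProduct.smul_tmul'])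
        (fun a b => by simp [mul_assoc]) h
    rw [h₄]
    simp [delMapLeft, antipode_unit, one_two, mul_assoc]
  refine Eq.trans ?_ ((h₁ Φ).trans ?_)
  · rw [← del_eq_left]; rfl
  · rw [coassoc, h₂, del_eq_left]

end Twist

/-! ### The twist f: intertwining and invertibility -/

section Twist

variable {M : Type*} [AddCommGroup M] [Module k M]

variable (k H) in
/-- `a ⊗ b ⊗ c ↦ (S ⊗ S)(Δᵒᵖ(a)) γ Δ(b β S(c))`. -/
def twistMap : H³ →ₗ[k] H² := lin₃ fun a b c => AF (Δ a) * gam k H * Δ (b * βₕ * S c)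

variable (k H) in
/-- `a ⊗ b ⊗ c ↦ Δ(S(a) α b) δ (S ⊗ S)(Δᵒᵖ(c))`. -/
def twistInvMap : H³ →ₗ[k] H² := lin₃ fun a b c => Δ (S a * αₕ * b) * del k H * AF (Δ c)

theorem twistF_eq : twistF k H = twistMap k H Φ⁻ := by
  have h : LinearMap.mul' k H² ∘ₗ TensorProduct.map
      (LinearMap.mulRight k (gam k H) ∘ₗ antipodeFlip k H ∘ₗ (Δ).toLinearMap)
      ((Δ).toLinearMap ∘ₗ betaS S βₕ) = twistMap k H :=
    LinearMap.ext fun t => linearMap_congr₃ (fun a b c => by simp [twistMap]) t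
  rw [← h]; rfl

theorem twistFInv_eq : twistFInv k H = twistInvMap k H Φ⁻ :=
  linearMap_congr₃ (f := LinearMap.mul' k (H ⊗[k] H) ∘ₗ
    TensorProduct.map
      (LinearMap.mulRight k (del k H) ∘ₗ comul.toLinearMap ∘ₗ sAlpha antipode (α k))
      (antipodeFlip k H ∘ₗ comul.toLinearMap) ∘ₗ (TensorProduct.assoc k H H H).symm.toLinearMap)
    (g := twistInvMap k H) (fun _ _ _ => rfl) _

theorem gamSandwich_comul_mul (t : H²) (h : H) :
    gamSandwich k H (Δ h * t) = ε h • gamSandwich k H t := by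
  refine linearMap_congr₂ (f := gamSandwich k H ∘ₗ LinearMap.mulLeft k (Δ h))
    (g := ε h • gamSandwich k H) (fun a b => ?_) t
  have h₁ := linearMap_congr₂ (f := gamSandwich k H ∘ₗ LinearMap.mulRight k (a ⊗ₜ[k] b))
    (g := LinearMap.mulRight k (Δ b) ∘ₗ LinearMap.mulLeft k (AF (Δ a)) ∘ₗ gamSandwich k H)
    (fun x y => by simp [gamSandwich, antipodeFlip_mul, mul_assoc]) (Δ h)
  refine h₁.trans ?_
  simp [gamSandwich_comul]
  simp [gamSandwich]

theorem delSandwich_mul_comul (t : H²) (h : H) :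
    delSandwich k H (t * Δ h) = ε h • delSandwich k H t := by
  refine linearMap_congr₂ (f := delSandwich k H ∘ₗ LinearMap.mulRight k (Δ h))
    (g := ε h • delSandwich k H) (fun a b => ?_) t
  have h₁ := linearMap_congr₂ (f := delSandwich k H ∘ₗ LinearMap.mulLeft k (a ⊗ₜ[k] b))
    (g := LinearMap.mulRight k (AF (Δ b)) ∘ₗ LinearMap.mulLeft k (Δ a) ∘ₗ delSandwich k H)
    (fun x y => by simp [delSandwich, antipodeFlip_mul, mul_assoc]) (Δ h)
  refine h₁.trans ?_
  simp [delSandwich_comul]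
  simp [delSandwich]

/-- `f Δ(S(h)) = (S ⊗ S)(Δᵒᵖ(h)) f`. -/
theorem twistF_mul_comul_antipode (h : H) : twistF k H * Δ (S h) = AF (Δ h) * twistF k H := by
  have hR : InvRight (face₀ k H) (twistMap k H) :=
    invRight_three _ _ (fun a b c y => AF (Δ a) * gam k H * Δ (b * y * S c))
      (by intros; simp [twistMap, antipode_anti, mul_assoc])
  -- The coproduct in the first two legs is absorbed by the invariance of γ, not by a visible α.
  have hL : InvLeft (face₃ k H) (twistMap k H) := fun t x => by
    refine linearMap_congr₃ (f := twistMap k H ∘ₗ LinearMap.mulLeft k _)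
      (g := ε x • twistMap k H) (fun a b c => ?_) t
    have h₁ := gamSandwich_comul_mul (a ⊗ₜ[k] (b * βₕ * S c)) x
    refine Eq.trans ?_ h₁
    refine linearMap_congr₂ (f := twistMap k H ∘ₗ LinearMap.mulRight k (a ⊗ₜ[k] (b ⊗ₜ[k] c)) ∘ₗ
      (face₃ k H).toLinearMap) (g := gamSandwich k H ∘ₗ LinearMap.mulRight k (a ⊗ₜ[k] (b * βₕ * S c)))
      (fun u v => ?_) (Δ x)
    simp [gamSandwich, twistMap, mul_assoc]
  -- Evaluate at (Δ ⊗ id)(Δ(h)) Φ⁻¹ = Φ⁻¹ (id ⊗ Δ)(Δ(h)). The left form reduces to 1 ⊗ 1 ⊗ h, giving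
  -- Δ(S(h)) on the right of f; the right form reduces to h ⊗ 1 ⊗ 1, giving (S ⊗ S)(Δᵒᵖ(h)) on its
  -- left.
  have h₁ := hL.face₁_mul Φ⁻ h
  rw [coassoc_inv, hR.mul_face₂] at h₁
  have h₂ := linearMap_congr₃ (f := twistMap k H ∘ₗ LinearMap.mulLeft k (1 ⊗ₜ[k] (1 ⊗ₜ[k] h)))
    (g := LinearMap.mulRight k (Δ (S h)) ∘ₗ twistMap k H)
    (fun a b c => by simp [twistMap, antipode_anti, mul_assoc]) Φ⁻
  have h₃ := linearMap_congr₃ (f := twistMap k H ∘ₗ LinearMap.mulRight k (h ⊗ₜ[k] (1 ⊗ₜ[k] 1)))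
    (g := LinearMap.mulLeft k (AF (Δ h)) ∘ₗ twistMap k H)
    (fun a b c => by simp [twistMap, antipodeFlip_mul, mul_assoc]) Φ⁻
  rw [twistF_eq]
  exact h₂.symm.trans (h₁.symm.trans h₃)

/-- `f⁻¹ (S ⊗ S)(Δᵒᵖ(h)) = Δ(S(h)) f⁻¹`. -/
theorem twistFInv_mul_antipodeFlip (h : H) :
    twistFInv k H * AF (Δ h) = Δ (S h) * twistFInv k H := by
  have hL : InvLeft (face₃ k H) (twistInvMap k H) :=
    invLeft_three _ _ (fun a b c y => Δ (S a * y * b) * del k H * AF (Δ c))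
      (by intros; simp [twistInvMap, antipode_anti, mul_assoc])
  have hR : InvRight (face₀ k H) (twistInvMap k H) := fun t x => by
    refine linearMap_congr₃ (f := twistInvMap k H ∘ₗ LinearMap.mulRight k _)
      (g := ε x • twistInvMap k H) (fun a b c => ?_) t
    have h₁ := delSandwich_mul_comul ((S a * αₕ * b) ⊗ₜ[k] c) x
    refine Eq.trans ?_ h₁
    refine linearMap_congr₂ (f := twistInvMap k H ∘ₗ LinearMap.mulLeft k (a ⊗ₜ[k] (b ⊗ₜ[k] c)) ∘ₗ
      (face₀ k H).toLinearMap) (g := delSandwich k H ∘ₗ LinearMap.mulLeft k ((S a * αₕ * b) ⊗ₜ[k] c))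
      (fun u v => ?_) (Δ x)
    simp [delSandwich, twistInvMap, mul_assoc]
  have h₁ := hL.face₁_mul Φ⁻ h
  rw [coassoc_inv, hR.mul_face₂] at h₁
  have h₂ := linearMap_congr₃ (f := twistInvMap k H ∘ₗ LinearMap.mulLeft k (1 ⊗ₜ[k] (1 ⊗ₜ[k] h)))
    (g := LinearMap.mulRight k (AF (Δ h)) ∘ₗ twistInvMap k H)
    (fun a b c => by simp [twistInvMap, antipodeFlip_mul, mul_assoc]) Φ⁻
  have h₃ := linearMap_congr₃ (f := twistInvMap k H ∘ₗ LinearMap.mulRight k (h ⊗ₜ[k] (1 ⊗ₜ[k] 1)))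
    (g := LinearMap.mulLeft k (Δ (S h)) ∘ₗ twistInvMap k H)
    (fun a b c => by simp [twistInvMap, antipode_anti, mul_assoc]) Φ⁻
  rw [twistFInv_eq]
  exact h₂.symm.trans (h₁.symm.trans h₃)

/-- `γ = f Δ(α)`. -/
theorem twistF_mul_comul_alpha : twistF k H * Δ αₕ = gam k H := by
  -- Inserting p_R(1 ⊗ α) for 1 ⊗ 1 in the sandwich of γ changes nothing, by invariance, and the
  -- inserted form is fΔ(α) by the definition of f.
  have h₁ := apply_pR_mul_alpha (gamSandwich k H) gamSandwich_comul_mul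
  have h₂ : gamSandwich k H (1 : H²) = gam k H := by
    simp [one_two, gamSandwich, antipode_unit]; simp [← one_two]
  rw [← h₂, ← h₁, pR_eq, twistF_eq]
  refine linearMap_congr₃ (f := LinearMap.mulRight k (Δ αₕ) ∘ₗ twistMap k H)
    (g := gamSandwich k H ∘ₗ LinearMap.mulRight k (1 ⊗ₜ[k] αₕ) ∘ₗ pMap k H) (fun a b c => ?_) Φ⁻
  simp [twistMap, gamSandwich, mul_assoc]

/-- `δ = Δ(β) f⁻¹`. -/
theorem comul_beta_mul_twistFInv : Δ βₕ * twistFInv k H = del k H := by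
  have h₁ := apply_beta_mul_qL (delSandwich k H) delSandwich_mul_comul
  have h₂ : delSandwich k H (1 : H²) = del k H := by
    simp [one_two, delSandwich, antipode_unit]; simp [← one_two]
  rw [← h₂, ← h₁, qL, twistFInv_eq]
  refine linearMap_congr₃ (f := LinearMap.mulLeft k (Δ βₕ) ∘ₗ twistInvMap k H)
    (g := delSandwich k H ∘ₗ LinearMap.mulLeft k (βₕ ⊗ₜ[k] 1) ∘ₗ qLMap k H) (fun a b c => ?_) Φ⁻
  simp [twistInvMap, delSandwich, mul_assoc]

/-- `Δ(X¹) δ (S ⊗ S)(Δᵒᵖ(X²)) Q (X³ ⊗ 1) = p_R`. -/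
theorem del_mul_antipodeQR :
    (lin₃ (k := k) fun a b c => Δ a * del k H * AF (Δ b) * antipodeQR k H * (c ⊗ₜ[k] 1)) Φ =
      pR k H := by
  let F : H⁴ →ₗ[k] H² := lin₄ fun a b c d => Δ a * pR k H * ((βₕ * S c * αₕ * d) ⊗ₜ[k] S b)
  have h₁ : (lin₃ (k := k) fun a b c => Δ a * del k H * AF (Δ b) * antipodeQR k H * (c ⊗ₜ[k] 1)) Φ =
      F (cell₀ k H Φ * (cell₂ k H Φ * cell₄ k H Φ)) := by
    refine linearMap_congr₃ (g := F ∘ₗ LinearMap.mulLeft k (cell₀ k H Φ) ∘ₗ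
      LinearMap.mulRight k (cell₄ k H Φ) ∘ₗ (cell₂ k H).toLinearMap) (fun a b c => ?_) Φ
    simp only [LinearMap.comp_apply, LinearMap.mulLeft_apply, LinearMap.mulRight_apply,
      AlgHom.toLinearMap_apply, cell₂_tmul, lin₃_tmul, del_eq_left, antipodeQR]
    refine linearMap_congr₃ (f := LinearMap.mulRight k (c ⊗ₜ[k] 1) ∘ₗ
      LinearMap.mulRight k (qMap k H Φ) ∘ₗ LinearMap.mulRight k (AF (Δ b)) ∘ₗ
      LinearMap.mulLeft k (Δ a) ∘ₗ delMapLeft k H)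
      (g := F ∘ₗ LinearMap.mulLeft k (cell₀ k H Φ) ∘ₗ
      LinearMap.mulLeft k (leg₂₃ k H (Δ b) * (a ⊗ₜ[k] (1 ⊗ₜ[k] (1 ⊗ₜ[k] c)))) ∘ₗ (cell₄ k H).toLinearMap)
      (fun u v w => ?_) Φ
    refine linearMap_congr₂ (f := LinearMap.mulRight k (c ⊗ₜ[k] 1) ∘ₗ
      LinearMap.mulRight k (qMap k H Φ) ∘ₗ
      LinearMap.mulLeft k (Δ a * delMapLeft k H (u ⊗ₜ[k] (v ⊗ₜ[k] w))) ∘ₗ AF)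
      (g := F ∘ₗ LinearMap.mulLeft k (cell₀ k H Φ) ∘ₗ LinearMap.mulRight k (u ⊗ₜ[k] (v ⊗ₜ[k] (w ⊗ₜ[k] 1))) ∘ₗ
      LinearMap.mulRight k (a ⊗ₜ[k] (1 ⊗ₜ[k] (1 ⊗ₜ[k] c))) ∘ₗ (leg₂₃ k H).toLinearMap)
      (fun x y => ?_) (Δ b)
    refine linearMap_congr₃ (f := LinearMap.mulRight k (c ⊗ₜ[k] 1) ∘ₗ
      LinearMap.mulLeft k _ ∘ₗ qMap k H)
      (g := F ∘ₗ LinearMap.mulRight k _ ∘ₗ (cell₀ k H).toLinearMap) (fun l m n => ?_) Φ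
    simp [F, delMapLeft, antipode_anti, mul_assoc]
  have hL : InvLeft (leg₃₄ k H) F :=
    invLeft_four _ _ (fun a b c d y => Δ a * pR k H * ((βₕ * S c * y * d) ⊗ₜ[k] S b))
      (by intros; simp [F, antipode_anti, mul_assoc])
  -- The α in F absorbs one of the two factors left by the pentagon. In the other, the relation of
  -- p_R collects X¹ in the first leg, so that X¹βS(X²)αX³ appears there.
  rw [h₁, ← mul_assoc, pentagon, (hL.cell₃_mul _).1]
  have h₂ := linearMap_congr₃ (f := F ∘ₗ (cell₁ k H).toLinearMap)
    (g := LinearMap.mulLeft k (pR k H) ∘ₗ (TensorProduct.mk k H H).flip 1 ∘ₗ betaSAlpha S αₕ βₕ)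
    (fun a b c => by
      simp only [LinearMap.comp_apply, LinearMap.mulLeft_apply, LinearMap.flip_apply,
        TensorProduct.mk_apply, betaSAlpha_tmul, AlgHom.toLinearMap_apply, cell₁_tmul]
      have h₃ := linearMap_congr₂ (f := F ∘ₗ LinearMap.mulRight k (1 ⊗ₜ[k] (1 ⊗ₜ[k] (b ⊗ₜ[k] c))) ∘ₗ
        (leg₁₂ k H).toLinearMap) (g := LinearMap.mulRight k ((βₕ * S b * αₕ * c) ⊗ₜ[k] 1) ∘ₗ
        lin₂ (k := k) fun a b => Δ a * pR k H * (1 ⊗ₜ[k] S b))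
        (fun x y => by simp [F, mul_assoc]) (Δ a)
      refine h₃.trans ?_
      rw [LinearMap.comp_apply, comul_mul_pR]
      simp [mul_assoc]) Φ
  refine h₂.trans ?_
  simp [betaSAlpha_Phi, ← one_two]

/-- `Δ(X¹) δ (S ⊗ S)(Δᵒᵖ(X²)) γ Δ(X³) = 1`. -/
theorem comul_del_gam_comul :
    (lin₃ (k := k) fun a b c => Δ a * del k H * AF (Δ b) * gam k H * Δ c) Φ = 1 := by
  let F : H⁴ →ₗ[k] H² := lin₄ fun a b c d =>
    Δ a * del k H * AF (Δ b) * antipodeQR k H * (c ⊗ₜ[k] (αₕ * d))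
  have h₁ : (lin₃ (k := k) fun a b c => Δ a * del k H * AF (Δ b) * gam k H * Δ c) Φ =
      F (cell₀ k H Φ⁻ * cell₃ k H Φ) := by
    refine linearMap_congr₃ (g := F ∘ₗ LinearMap.mulLeft k (cell₀ k H Φ⁻) ∘ₗ
      (cell₃ k H).toLinearMap) (fun a b c => ?_) Φ
    simp only [LinearMap.comp_apply, LinearMap.mulLeft_apply,
      AlgHom.toLinearMap_apply, cell₃_tmul, lin₃_tmul, gam_eq_left]
    refine linearMap_congr₂ (f := LinearMap.mulLeft k (Δ a * del k H * AF (Δ b) *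
      gamMapLeft k H Φ⁻)) (g := F ∘ₗ LinearMap.mulLeft k (cell₀ k H Φ⁻) ∘ₗ
      LinearMap.mulRight k (a ⊗ₜ[k] (b ⊗ₜ[k] (1 ⊗ₜ[k] 1))) ∘ₗ (leg₃₄ k H).toLinearMap)
      (fun x y => ?_) (Δ c)
    refine linearMap_congr₃ (f := LinearMap.mulRight k (x ⊗ₜ[k] y) ∘ₗ
      LinearMap.mulLeft k _ ∘ₗ gamMapLeft k H)
      (g := F ∘ₗ LinearMap.mulRight k _ ∘ₗ (cell₀ k H).toLinearMap) (fun l m n => ?_) Φ⁻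
    simp [F, gamMapLeft, antipodeFlip_mul, mul_assoc]
  have h₂ : cell₀ k H Φ⁻ * cell₃ k H Φ = cell₂ k H Φ * (cell₄ k H Φ * cell₁ k H Φ⁻) := by
    rw [pentagon₀_inv, mul_assoc, map_PhiInv_mul, mul_one, mul_assoc]
  -- The entry α of F becomes a parameter: the factor (id ⊗ Δ ⊗ id)(Φ) will turn it into S(X²)αX³
  -- while splitting off Δ(X¹).
  let G : H → H⁴ →ₗ[k] H² := fun s => lin₄ fun a b c d =>
    Δ a * del k H * AF (Δ b) * antipodeQR k H * (c ⊗ₜ[k] (s * d))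
  have hG : ∀ s, InvRight (leg₁₂ k H) (G s) := fun s t x => by
    refine linearMap_congr₄ (f := G s ∘ₗ LinearMap.mulRight k (leg₁₂ k H (Δ x))) (g := ε x • G s)
      (fun a b c d => ?_) t
    have h₃ := congrArg (· * (antipodeQR k H * (c ⊗ₜ[k] (s * d))))
      (delSandwich_mul_comul (a ⊗ₜ[k] b) x)
    refine Eq.trans ?_ (h₃.trans ?_)
    · refine linearMap_congr₂ (f := G s ∘ₗ LinearMap.mulLeft k (a ⊗ₜ[k] (b ⊗ₜ[k] (c ⊗ₜ[k] d))) ∘ₗ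
        (leg₁₂ k H).toLinearMap) (g := LinearMap.mulRight k (antipodeQR k H * (c ⊗ₜ[k] (s * d))) ∘ₗ
        delSandwich k H ∘ₗ LinearMap.mulLeft k (a ⊗ₜ[k] b)) (fun u v => ?_) (Δ x)
      simp [G, delSandwich, mul_assoc]
    · simp [G, delSandwich, mul_assoc]
  have h₃ : ∀ s, G s (cell₄ k H Φ * cell₁ k H Φ⁻) = pR k H * (1 ⊗ₜ[k] s) := fun s => by
    rw [((hG s).mul_cell₁ _).2, ← del_mul_antipodeQR]
    refine linearMap_congr₃ (f := G s ∘ₗ (cell₄ k H).toLinearMap)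
      (g := LinearMap.mulRight k (1 ⊗ₜ[k] s) ∘ₗ lin₃ (k := k) fun a b c =>
        Δ a * del k H * AF (Δ b) * antipodeQR k H * (c ⊗ₜ[k] 1)) (fun a b c => ?_) Φ
    simp [G, mul_assoc]
  have h₄ : ∀ a b c t, F (cell₂ k H (a ⊗ₜ[k] (b ⊗ₜ[k] c)) * t) = Δ a * G (S b * αₕ * c) t :=
    fun a b c t => by
      refine linearMap_congr₄ (f := F ∘ₗ LinearMap.mulLeft k (cell₂ k H (a ⊗ₜ[k] (b ⊗ₜ[k] c))))
        (g := LinearMap.mulLeft k (Δ a) ∘ₗ G (S b * αₕ * c)) (fun u v w z => ?_) t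
      have h₅ := congrArg (Δ a * Δ u * del k H * AF (Δ v) * · * (w ⊗ₜ[k] (αₕ * (c * z))))
        (antipodeFlip_mul_antipodeQR b)
      refine Eq.trans ?_ (h₅.trans ?_)
      · simp only [LinearMap.comp_apply, LinearMap.mulLeft_apply, cell₂_tmul]
        refine linearMap_congr₂ (f := F ∘ₗ LinearMap.mulRight k (u ⊗ₜ[k] (v ⊗ₜ[k] (w ⊗ₜ[k] z))) ∘ₗ
          LinearMap.mulRight k (a ⊗ₜ[k] (1 ⊗ₜ[k] (1 ⊗ₜ[k] c))) ∘ₗ (leg₂₃ k H).toLinearMap)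
          (g := LinearMap.mulRight k (w ⊗ₜ[k] (αₕ * (c * z))) ∘ₗ
            LinearMap.mulLeft k (Δ a * Δ u * del k H * AF (Δ v)) ∘ₗ
            lin₂ (k := k) fun a b => AF (Δ a) * antipodeQR k H * (b ⊗ₜ[k] 1))
          (fun x y => ?_) (Δ b)
        simp [F, antipodeFlip_mul, mul_assoc]
      · simp [G, mul_assoc]
  -- With s = S(X²)αX³ the sum has become ∑ Δ(X¹) p_R (1 ⊗ S(X²)αX³).
  rw [h₁, h₂, ← comul_pR_Phi]
  refine linearMap_congr₃ (f := F ∘ₗ LinearMap.mulRight k (cell₄ k H Φ * cell₁ k H Φ⁻) ∘ₗ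
    (cell₂ k H).toLinearMap) (fun a b c => ?_) Φ
  simp [h₄, h₃, mul_assoc]

/-- The intertwining relations of f and f⁻¹ cancel on coproducts of elements S(x), and these are all
elements. -/
theorem comul_comm_twist [FiniteDimensional k H] (h : H) :
    twistFInv k H * twistF k H * Δ h = Δ h * (twistFInv k H * twistF k H) := by
  rw [← antipode_antipodeInv (k := k) h, mul_assoc, twistF_mul_comul_antipode, ← mul_assoc,
    twistFInv_mul_antipodeFlip, mul_assoc]

/-- Put δ = Δ(β)f⁻¹ and γ = fΔ(α) into `comul_del_gam_comul`. Moving f⁻¹ past the flipped coproduct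
and then f⁻¹f past Δ(αX³) leaves Δ(∑ X¹βS(X²)αX³) f⁻¹f, which is f⁻¹f. -/
theorem twistFInv_mul_twistF [FiniteDimensional k H] : twistFInv k H * twistF k H = 1 := by
  have h₁ := comul_del_gam_comul (k := k) (H := H)
  rw [← h₁]
  have h₂ := linearMap_congr₃ (f := LinearMap.mulRight k (twistFInv k H * twistF k H) ∘ₗ
      (Δ).toLinearMap ∘ₗ betaSAlpha S αₕ βₕ)
    (g := lin₃ (k := k) fun a b c => Δ a * del k H * AF (Δ b) * gam k H * Δ c) (fun a b c => by
      simp only [← comul_beta_mul_twistFInv, ← twistF_mul_comul_alpha, lin₃_tmul]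
      simp only [LinearMap.comp_apply, LinearMap.mulRight_apply, betaSAlpha_tmul,
        AlgHom.toLinearMap_apply, map_mul]
      have h₃ : Δ a * (Δ βₕ * twistFInv k H) * AF (Δ b) * (twistF k H * Δ αₕ) * Δ c =
          Δ a * Δ βₕ * (twistFInv k H * AF (Δ b)) * twistF k H * Δ αₕ * Δ c := by
        simp only [mul_assoc]
      have h₄ := comul_comm_twist (k := k) (αₕ * c)
      rw [h₃, twistFInv_mul_antipodeFlip]
      simp only [map_mul, mul_assoc] at h₄ ⊢
      rw [h₄]) Φ
  rw [← h₂]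
  simp [betaSAlpha_Phi]

/-- H ⊗ H is finite-dimensional, hence Artinian, so a one-sided inverse is two-sided. -/
theorem twistF_mul_twistFInv [FiniteDimensional k H] : twistF k H * twistFInv k H = 1 := by
  have : IsArtinianRing H² := IsArtinianRing.of_finite k _
  exact mul_eq_one_comm.1 twistFInv_mul_twistF

end Twist

/-! ### Cancellation through α and β -/

section Uniqueness

variable {A : Type*} [Ring A] [Algebra k A]

/-- Multiply T by J(∑ S(x¹)αx²βS(x³)) = 1: only the products T J(S(x¹)) J(α) matter. It reduces an
identity to its behaviour under S(x) and under α. -/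
theorem eq_of_mul_antipode_mul_alpha (J : H →ₐ[k] A) {T T' : A}
    (h : ∀ x, T * J (S x) * J αₕ = T' * J (S x) * J αₕ) : T = T' := by
  have h₁ := linearMap_congr₃ (f := LinearMap.mulLeft k T ∘ₗ J.toLinearMap ∘ₗ sAlphaBetaS S αₕ βₕ)
    (g := LinearMap.mulLeft k T' ∘ₗ J.toLinearMap ∘ₗ sAlphaBetaS S αₕ βₕ) (fun a b c => by
      have := congrArg (· * J (b * βₕ * S c)) (h a)
      simpa [mul_assoc] using this) Φ⁻
  simpa [sAlphaBetaS_PhiInv] using h₁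

theorem eq_of_beta_mul (J : H →ₐ[k] A) {T T' : A}
    (h : ∀ x, J βₕ * (J x * T) = J βₕ * (J x * T')) : T = T' := by
  have h₁ := linearMap_congr₃
    (f := LinearMap.mulRight k T ∘ₗ J.toLinearMap ∘ₗ sAlphaBetaS S αₕ βₕ)
    (g := LinearMap.mulRight k T' ∘ₗ J.toLinearMap ∘ₗ sAlphaBetaS S αₕ βₕ) (fun a b c => by
      have := congrArg (J (S a * αₕ * b) * ·) (h (S c))
      simpa [mul_assoc] using this) Φ⁻
  simpa [sAlphaBetaS_PhiInv] using h₁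

/-- Uses the image of ∑ X¹βS(X²)αX³ = 1 under S⁻¹, whose last two factors are S⁻¹(β) and S⁻¹(X¹). -/
theorem eq_of_antipodeInv_beta_mul [FiniteDimensional k H] (J : H →ₐ[k] A) {T T' : A}
    (h : ∀ x, J (S⁻ βₕ) * (J (S⁻ x) * T) = J (S⁻ βₕ) * (J (S⁻ x) * T')) : T = T' := by
  have h₁ := linearMap_congr₃
    (f := LinearMap.mulRight k T ∘ₗ J.toLinearMap ∘ₗ S⁻ ∘ₗ betaSAlpha S αₕ βₕ)
    (g := LinearMap.mulRight k T' ∘ₗ J.toLinearMap ∘ₗ S⁻ ∘ₗ betaSAlpha S αₕ βₕ) (fun a b c => by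
      have := congrArg (J (S⁻ (S b * αₕ * c)) * ·) (h a)
      simpa [mul_assoc, antipodeInv_anti] using this) Φ
  simpa [betaSAlpha_Phi, antipodeInv_unit] using h₁

end Uniqueness

/-! ### Relations for U and V -/

section UV

variable [FiniteDimensional k H]

theorem U_eq : U k H = twistFInv k H * antipodeQR k H := by rw [U, antipodeFlip_qR]

/-- `U (1 ⊗ S(h)) = Δ(S(h₁)) U (h₂ ⊗ 1)`. -/
theorem U_mul_antipode (h : H) : U k H * (1 ⊗ₜ[k] S h) =
    (lin₂ (k := k) fun a b => Δ (S a) * U k H * (b ⊗ₜ[k] 1)) (Δ h) := by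
  rw [U_eq, mul_assoc, ← antipodeFlip_mul_antipodeQR]
  refine linearMap_congr₂ (f := LinearMap.mulLeft k (twistFInv k H) ∘ₗ
    lin₂ (k := k) fun a b => AF (Δ a) * antipodeQR k H * (b ⊗ₜ[k] 1)) (fun a b => ?_) (Δ h)
  simp only [LinearMap.comp_apply, LinearMap.mulLeft_apply, lin₂_tmul]
  rw [← mul_assoc, ← mul_assoc, twistFInv_mul_antipodeFlip]
  simp only [mul_assoc]

/-- The formula of `gam_eq_left`, solved for Q(1 ⊗ α) by inserting Φ⁻¹Φ = 1. The next lemma solves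
`del_eq_left` in the same way. -/
theorem antipodeQR_mul_alpha : antipodeQR k H * (1 ⊗ₜ[k] αₕ) =
    (lin₃ (k := k) fun a b c => AF (Δ a) * gam k H * (b ⊗ₜ[k] c)) Φ := by
  have h : gamMapLeft k H (Φ⁻ * Φ) = antipodeQR k H * (1 ⊗ₜ[k] αₕ) := by
    rw [PhiInv_mul_Phi]
    simp [gamMapLeft, one_three, antipodeFlip_one]
  rw [← h, gam_eq_left]
  refine linearMap_congr₃ (f := gamMapLeft k H ∘ₗ LinearMap.mulLeft k Φ⁻) (fun a b c => ?_) Φ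
  refine linearMap_congr₃ (f := gamMapLeft k H ∘ₗ LinearMap.mulRight k (a ⊗ₜ[k] (b ⊗ₜ[k] c)))
    (g := LinearMap.mulRight k (b ⊗ₜ[k] c) ∘ₗ LinearMap.mulLeft k (AF (Δ a)) ∘ₗ gamMapLeft k H)
    (fun u v w => ?_) Φ⁻
  simp [gamMapLeft, antipodeFlip_mul, mul_assoc]

theorem pR_mul_beta : pR k H * (βₕ ⊗ₜ[k] 1) =
    (lin₃ (k := k) fun a b c => Δ a * del k H * (S c ⊗ₜ[k] S b)) Φ⁻ := by
  have h : delMapLeft k H (Φ⁻ * Φ) = pR k H * (βₕ ⊗ₜ[k] 1) := by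
    rw [PhiInv_mul_Phi]
    simp [delMapLeft, one_three, antipode_unit]
  rw [← h, del_eq_left]
  refine linearMap_congr₃ (f := delMapLeft k H ∘ₗ LinearMap.mulRight k Φ) (fun a b c => ?_) Φ⁻
  refine linearMap_congr₃ (f := delMapLeft k H ∘ₗ LinearMap.mulLeft k (a ⊗ₜ[k] (b ⊗ₜ[k] c)))
    (g := LinearMap.mulRight k (S c ⊗ₜ[k] S b) ∘ₗ LinearMap.mulLeft k (Δ a) ∘ₗ delMapLeft k H)
    (fun u v w => ?_) Φ
  simp [delMapLeft, antipode_anti, mul_assoc]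

theorem twistFInv_mul_gam : twistFInv k H * gam k H = Δ αₕ := by
  rw [← twistF_mul_comul_alpha, ← mul_assoc, twistFInv_mul_twistF, one_mul]

theorem del_mul_twistF : del k H * twistF k H = Δ βₕ := by
  rw [← comul_beta_mul_twistFInv, mul_assoc, twistFInv_mul_twistF, mul_one]

/-- `U (1 ⊗ α) = Δ(S(X¹) α) (X² ⊗ X³)`. -/
theorem U_mul_alpha : U k H * (1 ⊗ₜ[k] αₕ) =
    (lin₃ (k := k) fun a b c => Δ (S a * αₕ) * (b ⊗ₜ[k] c)) Φ := by
  rw [U_eq, mul_assoc, antipodeQR_mul_alpha]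
  refine linearMap_congr₃ (f := LinearMap.mulLeft k (twistFInv k H) ∘ₗ
    lin₃ (k := k) fun a b c => AF (Δ a) * gam k H * (b ⊗ₜ[k] c)) (fun a b c => ?_) Φ
  simp only [LinearMap.comp_apply, LinearMap.mulLeft_apply, lin₃_tmul]
  rw [← mul_assoc, ← mul_assoc, twistFInv_mul_antipodeFlip, mul_assoc (Δ (S a)),
    twistFInv_mul_gam, map_mul]

theorem antipodeFlip_comul_antipodeInv (h : H) :
    AF (Δ (S⁻ h)) * twistF k H = twistF k H * Δ h := by
  rw [← twistF_mul_comul_antipode, antipode_antipodeInv]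

/-- `V Δ(S⁻¹(b)) = (S⁻¹ ⊗ S⁻¹)((f Δ(b) p_R)ᵒᵖ)`. -/
theorem V_mul_comul_antipodeInv (b : H) :
    V k H * Δ (S⁻ b) = AIF (twistF k H * Δ b * pR k H) := by
  rw [← antipodeFlip_comul_antipodeInv, mul_assoc, antipodeInvFlip_mul, ← V,
    antipodeInvFlip_antipodeFlip]

/-- `(1 ⊗ S⁻¹(h)) V = (h₂ ⊗ 1) V Δ(S⁻¹(h₁))`. -/
theorem antipodeInv_mul_V (h : H) : (1 ⊗ₜ[k] S⁻ h) * V k H =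
    (lin₂ (k := k) fun a b => (b ⊗ₜ[k] 1) * V k H * Δ (S⁻ a)) (Δ h) := by
  have h₁ : (1 ⊗ₜ[k] S⁻ h) * V k H = AIF (twistF k H * (pR k H * (h ⊗ₜ[k] 1))) := by
    rw [← mul_assoc, antipodeInvFlip_mul, ← V]
    simp [antipodeInv_unit]
  rw [h₁, ← comul_mul_pR]
  refine linearMap_congr₂ (f := AIF ∘ₗ LinearMap.mulLeft k (twistF k H) ∘ₗ
    lin₂ (k := k) fun a b => Δ a * pR k H * (1 ⊗ₜ[k] S b)) (fun a b => ?_) (Δ h)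
  simp only [LinearMap.comp_apply, LinearMap.mulLeft_apply, lin₂_tmul]
  rw [mul_assoc (b ⊗ₜ[k] 1), V_mul_comul_antipodeInv, ← mul_assoc, ← mul_assoc,
    antipodeInvFlip_mul]
  simp [antipodeInv_unit]

/-- `(1 ⊗ S⁻¹(β)) V = (x² ⊗ x³) Δ(S⁻¹(x¹ β))`. -/
theorem antipodeInv_beta_mul_V : (1 ⊗ₜ[k] S⁻ βₕ) * V k H =
    (lin₃ (k := k) fun a b c => (b ⊗ₜ[k] c) * Δ (S⁻ (a * βₕ))) Φ⁻ := by
  have h₁ : (1 ⊗ₜ[k] S⁻ βₕ) * V k H = AIF (twistF k H * (pR k H * (βₕ ⊗ₜ[k] 1))) := by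
    rw [← mul_assoc, antipodeInvFlip_mul, ← V]
    simp [antipodeInv_unit]
  rw [h₁, pR_mul_beta]
  refine linearMap_congr₃ (f := AIF ∘ₗ LinearMap.mulLeft k (twistF k H) ∘ₗ
    lin₃ (k := k) fun a b c => Δ a * del k H * (S c ⊗ₜ[k] S b)) (fun a b c => ?_) Φ⁻
  simp only [LinearMap.comp_apply, LinearMap.mulLeft_apply, lin₃_tmul]
  have h₂ : AF (Δ (S⁻ (a * βₕ))) = twistF k H * (Δ a * del k H) := by
    calc _ = AF (Δ (S⁻ (a * βₕ))) * twistF k H * twistFInv k H := by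
          rw [mul_assoc, twistF_mul_twistFInv, mul_one]
      _ = _ := by rw [antipodeFlip_comul_antipodeInv, map_mul, ← comul_beta_mul_twistFInv]
                  simp only [mul_assoc]
  rw [← mul_assoc, ← h₂, antipodeInvFlip_mul]
  simp

/-- `(ε ⊗ id)(U) = 1`. -/
theorem counit_U : contractLeft₂ (counit (k := k) (H := H)).toLinearMap (U k H) = 1 := by
  let e : H² →ₐ[k] H := (Algebra.TensorProduct.lid k H).toAlgHom.comp
    (Algebra.TensorProduct.map counit (AlgHom.id k H))
  have he : ∀ a b, e (a ⊗ₜ[k] b) = ε a • b := fun _ _ => rfl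
  have he' : ∀ h, e (Δ h) = h := contractLeft_comul
  change e (U k H) = 1
  -- It suffices that (ε ⊗ id)(U) commutes with S(x) and fixes α from the left; both come from
  -- applying ε ⊗ id to a relation of U.
  refine eq_of_mul_antipode_mul_alpha (AlgHom.id k H) fun x => ?_
  have h₁ : e (U k H) * S x = S x * e (U k H) := by
    have h₂ := congrArg e (U_mul_antipode (k := k) x)
    rw [map_mul, he, map_one, one_smul] at h₂
    rw [h₂]
    have h₃ := linearMap_congr₂ (f := e.toLinearMap ∘ₗ
      lin₂ (k := k) fun a b => Δ (S a) * U k H * (b ⊗ₜ[k] 1))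
      (g := LinearMap.mulRight k (e (U k H)) ∘ₗ S ∘ₗ contractRight₂ counit.toLinearMap)
      (fun a b => by simp [he, he']) (Δ x)
    refine h₃.trans ?_
    simp [contractRight_comul]
  have h₄ : e (U k H) * αₕ = αₕ := by
    have h₂ := congrArg e (U_mul_alpha (k := k) (H := H))
    rw [map_mul, he, map_one, one_smul] at h₂
    rw [h₂]
    have h₃ := linearMap_congr₃ (f := e.toLinearMap ∘ₗ
      lin₃ (k := k) fun a b c => Δ (S a * αₕ) * (b ⊗ₜ[k] c))
      (g := sAlpha S αₕ ∘ₗ (counit₂ k H).toLinearMap)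
      (fun a b c => by simp [he, he', mul_assoc]) Φ
    refine h₃.trans ?_
    simp [counit₂_Phi, one_two, antipode_unit]
  simp only [AlgHom.id_apply]
  rw [h₁, mul_assoc, h₄, one_mul]

/-- `(ε ⊗ id)(V) = 1`. -/
theorem counit_V : contractLeft₂ (counit (k := k) (H := H)).toLinearMap (V k H) = 1 := by
  let e : H² →ₐ[k] H := (Algebra.TensorProduct.lid k H).toAlgHom.comp
    (Algebra.TensorProduct.map counit (AlgHom.id k H))
  have he : ∀ a b, e (a ⊗ₜ[k] b) = ε a • b := fun _ _ => rfl
  have he' : ∀ h, e (Δ h) = h := contractLeft_comul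
  change e (V k H) = 1
  refine eq_of_antipodeInv_beta_mul (AlgHom.id k H) fun x => ?_
  have h₁ : S⁻ x * e (V k H) = e (V k H) * S⁻ x := by
    have h₂ := congrArg e (antipodeInv_mul_V (k := k) x)
    rw [map_mul, he, map_one, one_smul] at h₂
    rw [h₂]
    have h₃ := linearMap_congr₂ (f := e.toLinearMap ∘ₗ
      lin₂ (k := k) fun a b => (b ⊗ₜ[k] 1) * V k H * Δ (S⁻ a))
      (g := LinearMap.mulLeft k (e (V k H)) ∘ₗ S⁻ ∘ₗ contractRight₂ counit.toLinearMap)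
      (fun a b => by simp [he, he']) (Δ x)
    refine h₃.trans ?_
    simp [contractRight_comul]
  have h₄ : S⁻ βₕ * e (V k H) = S⁻ βₕ := by
    have h₂ := congrArg e (antipodeInv_beta_mul_V (k := k) (H := H))
    rw [map_mul, he, map_one, one_smul] at h₂
    rw [h₂]
    have h₃ := linearMap_congr₃ (f := e.toLinearMap ∘ₗ
      lin₃ (k := k) fun a b c => (b ⊗ₜ[k] c) * Δ (S⁻ (a * βₕ)))
      (g := (lin₂ (k := k) fun a b => b * S⁻ (a * βₕ)) ∘ₗ (counit₂ k H).toLinearMap)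
      (fun a b c => by simp [he, he']) Φ⁻
    refine h₃.trans ?_
    simp [counit₂_PhiInv, one_two]
  simp only [AlgHom.id_apply]
  rw [h₁, ← mul_assoc, h₄, mul_one]

end UV

/-! ### Coassociativity relation for U -/

section ThreeLegs

variable (k H) in
/-- `x ↦ 1 ⊗ 1 ⊗ x`. -/
def leg₃ : H →ₐ[k] H³ := (face₀ k H).comp Algebra.TensorProduct.includeRight

@[simp] theorem leg₃_apply (x : H) : leg₃ k H x = 1 ⊗ₜ[k] (1 ⊗ₜ[k] x) := rfl

theorem face₁_one_tmul (x : H) : face₁ k H (1 ⊗ₜ[k] x) = 1 ⊗ₜ[k] (1 ⊗ₜ[k] x) := by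
  rw [face₁_tmul, map_one, map_one, one_mul]

theorem face₁_tmul_one (x : H) : face₁ k H (x ⊗ₜ[k] 1) = face₃ k H (Δ x) := by
  rw [face₁_tmul, ← one_three, mul_one]

theorem face₂_one_tmul (x : H) : face₂ k H (1 ⊗ₜ[k] x) = face₀ k H (Δ x) := rfl

theorem face₂_tmul_one (x : H) : face₂ k H (x ⊗ₜ[k] 1) = x ⊗ₜ[k] (1 ⊗ₜ[k] 1) := by
  rw [face₂_tmul, map_one, one_two]

/-- `a ⊗ b ⊗ c ↦ (Δ ⊗ id)(Δ(S(a))) T (b ⊗ c ⊗ 1)`. -/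
def sandwichU (T : H³) : H³ →ₗ[k] H³ :=
  lin₃ fun a b c => face₁ k H (Δ (S a)) * T * (b ⊗ₜ[k] (c ⊗ₜ[k] 1))

theorem sandwichU_mul (T s t : H³) :
    sandwichU (k := k) T (s * t) = sandwichU (k := k) (sandwichU (k := k) T s) t := by
  refine linearMap_congr₃ (f := sandwichU (k := k) T ∘ₗ LinearMap.mulLeft k s) (fun a b c => ?_) t
  refine linearMap_congr₃ (f := sandwichU (k := k) T ∘ₗ LinearMap.mulRight k (a ⊗ₜ[k] (b ⊗ₜ[k] c)))
    (g := LinearMap.mulRight k (b ⊗ₜ[k] (c ⊗ₜ[k] 1)) ∘ₗ LinearMap.mulLeft k (face₁ k H (Δ (S a))) ∘ₗ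
      sandwichU (k := k) T) (fun u v w => ?_) s
  simp [sandwichU, antipode_anti, mul_assoc]

theorem sandwichU_mul_leg (T t : H³) (x : H) :
    sandwichU (k := k) (T * leg₃ k H x) t = sandwichU (k := k) T t * leg₃ k H x := by
  refine linearMap_congr₃ (f := sandwichU (k := k) (T * leg₃ k H x))
    (g := LinearMap.mulRight k (leg₃ k H x) ∘ₗ sandwichU (k := k) T) (fun a b c => ?_) t
  simp [sandwichU, mul_assoc]

variable [FiniteDimensional k H]

/-- `a ⊗ b ⊗ c ↦ (b ⊗ c ⊗ 1) T (id ⊗ Δ)(Δ(S⁻¹(a)))`. -/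
def sandwichV (T : H³) : H³ →ₗ[k] H³ :=
  lin₃ fun a b c => (b ⊗ₜ[k] (c ⊗ₜ[k] 1)) * T * face₂ k H (Δ (S⁻ a))

theorem sandwichV_mul (T s t : H³) :
    sandwichV (k := k) T (s * t) = sandwichV (k := k) (sandwichV (k := k) T t) s := by
  refine linearMap_congr₃ (f := sandwichV (k := k) T ∘ₗ LinearMap.mulRight k t) (fun a b c => ?_) s
  refine linearMap_congr₃ (f := sandwichV (k := k) T ∘ₗ LinearMap.mulLeft k (a ⊗ₜ[k] (b ⊗ₜ[k] c)))
    (g := LinearMap.mulRight k (face₂ k H (Δ (S⁻ a))) ∘ₗ LinearMap.mulLeft k (b ⊗ₜ[k] (c ⊗ₜ[k] 1)) ∘ₗ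
      sandwichV (k := k) T) (fun u v w => ?_) t
  simp [sandwichV, antipodeInv_anti, ← mul_assoc]

theorem leg_mul_sandwichV (T t : H³) (x : H) :
    sandwichV (k := k) (leg₃ k H x * T) t = leg₃ k H x * sandwichV (k := k) T t := by
  refine linearMap_congr₃ (f := sandwichV (k := k) (leg₃ k H x * T))
    (g := LinearMap.mulLeft k (leg₃ k H x) ∘ₗ sandwichV (k := k) T) (fun a b c => ?_) t
  simp only [sandwichV, lin₃_tmul, LinearMap.comp_apply, LinearMap.mulLeft_apply, ← mul_assoc]
  simp

theorem face₁_U_mul_leg (x : H) : face₁ k H (U k H) * leg₃ k H (S x) =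
    sandwichU (k := k) (face₁ k H (U k H)) (face₂ k H (Δ x)) := by
  rw [leg₃_apply, ← face₁_one_tmul, ← map_mul, U_mul_antipode]
  refine linearMap_congr₂ (f := (face₁ k H).toLinearMap ∘ₗ
    lin₂ (k := k) fun a b => Δ (S a) * U k H * (b ⊗ₜ[k] 1))
    (g := sandwichU (k := k) (face₁ k H (U k H)) ∘ₗ (face₂ k H).toLinearMap) (fun a b => ?_) (Δ x)
  simp only [LinearMap.comp_apply, lin₂_tmul, AlgHom.toLinearMap_apply, map_mul, face₁_tmul_one,
    face₂_tmul]
  refine linearMap_congr₂ (f := LinearMap.mulLeft k (face₁ k H (Δ (S a)) * face₁ k H (U k H)) ∘ₗ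
    (face₃ k H).toLinearMap) (g := sandwichU (k := k) (face₁ k H (U k H)) ∘ₗ
    TensorProduct.mk k H H² a) (fun u v => ?_) (Δ b)
  simp [sandwichU, mul_assoc]

/-- The relation of U is used twice, first in legs 2 and 3, then under id ⊗ Δ. The coproduct that
reaches Φ⁻¹ from the right leaves it on the left in the other bracketing. Compared with
`face₁_U_mul_leg`, the two bracketings of the iterated coproduct of x are interchanged, which is the
discrepancy conjugation by Φ corrects. -/
theorem face₂_U_mul_leg (x : H) :
    Φ⁻ * face₂ k H (U k H) * face₀ k H (U k H) * leg₃ k H (S x) =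
    sandwichU (k := k) (Φ⁻ * face₂ k H (U k H) * face₀ k H (U k H)) (face₁ k H (Δ x)) := by
  have h₁ : leg₃ k H (S x) = face₀ k H (1 ⊗ₜ[k] S x) := rfl
  rw [h₁, mul_assoc, ← map_mul, U_mul_antipode]
  refine linearMap_congr₂ (f := LinearMap.mulLeft k (Φ⁻ * face₂ k H (U k H)) ∘ₗ
    (face₀ k H).toLinearMap ∘ₗ lin₂ (k := k) fun a b => Δ (S a) * U k H * (b ⊗ₜ[k] 1))
    (g := sandwichU (k := k) (Φ⁻ * face₂ k H (U k H) * face₀ k H (U k H)) ∘ₗ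
      (face₁ k H).toLinearMap) (fun a b => ?_) (Δ x)
  simp only [LinearMap.comp_apply, lin₂_tmul, AlgHom.toLinearMap_apply, map_mul, face₁_tmul,
    LinearMap.mulLeft_apply]
  have h₂ : Φ⁻ * face₂ k H (U k H) * (face₀ k H (Δ (S a)) * face₀ k H (U k H) *
      face₀ k H (b ⊗ₜ[k] 1)) = Φ⁻ * face₂ k H (U k H * (1 ⊗ₜ[k] S a)) * (face₀ k H (U k H) *
      face₀ k H (b ⊗ₜ[k] 1)) := by
    rw [map_mul, face₂_one_tmul]; simp only [mul_assoc]
  rw [h₂, U_mul_antipode]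
  refine linearMap_congr₂ (f := LinearMap.mulRight k (face₀ k H (U k H) * face₀ k H (b ⊗ₜ[k] 1)) ∘ₗ
    LinearMap.mulLeft k Φ⁻ ∘ₗ (face₂ k H).toLinearMap ∘ₗ
    lin₂ (k := k) fun a b => Δ (S a) * U k H * (b ⊗ₜ[k] 1))
    (g := sandwichU (k := k) (Φ⁻ * face₂ k H (U k H) * face₀ k H (U k H)) ∘ₗ
      LinearMap.mulRight k (1 ⊗ₜ[k] (1 ⊗ₜ[k] b)) ∘ₗ (face₃ k H).toLinearMap) (fun u v => ?_) (Δ a)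
  simp only [LinearMap.comp_apply, lin₂_tmul, AlgHom.toLinearMap_apply, map_mul, sandwichU,
    LinearMap.mulLeft_apply, LinearMap.mulRight_apply, face₃_tmul, face₀_tmul,
    face₂_tmul_one, Algebra.TensorProduct.tmul_mul_tmul, lin₃_tmul, one_mul, mul_one]
  have h₃ : ∀ t : H², (v ⊗ₜ[k] (1 ⊗ₜ[k] 1)) * face₀ k H t * (1 ⊗ₜ[k] (b ⊗ₜ[k] 1)) =
      face₀ k H t * (v ⊗ₜ[k] (b ⊗ₜ[k] 1)) := fun t => by
    rw [← one_two, face₀_apply]; simp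
  have h₄ := coassoc_inv (k := k) (S u)
  calc _ = (Φ⁻ * face₂ k H (Δ (S u))) * face₂ k H (U k H) *
        ((v ⊗ₜ[k] (1 ⊗ₜ[k] 1)) * face₀ k H (U k H) * (1 ⊗ₜ[k] (b ⊗ₜ[k] 1))) := by
          simp only [mul_assoc]
    _ = _ := by rw [h₃, ← h₄]; simp only [mul_assoc]

variable (k H) in
/-- `a ⊗ b ⊗ c ↦ Δ(S(a) α) (b ⊗ c)`. -/
def alphaComul : H³ →ₗ[k] H² := lin₃ fun a b c => Δ (S a * αₕ) * (b ⊗ₜ[k] c)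

@[simp] theorem alphaComul_tmul (a b c : H) :
    alphaComul k H (a ⊗ₜ[k] (b ⊗ₜ[k] c)) = Δ (S a * αₕ) * (b ⊗ₜ[k] c) := rfl

theorem U_mul_alpha' : U k H * (1 ⊗ₜ[k] αₕ) = alphaComul k H Φ := U_mul_alpha

/-- `U (1 ⊗ S(h) α) = Δ(S(X¹ h₁) α) (X² h₂ ⊗ X³)`. -/
theorem U_mul_antipode_alpha (h : H) : U k H * (1 ⊗ₜ[k] (S h * αₕ)) =
    alphaComul k H (Φ * face₃ k H (Δ h)) := by
  have h₁ : U k H * (1 ⊗ₜ[k] (S h * αₕ)) = (U k H * (1 ⊗ₜ[k] S h)) * (1 ⊗ₜ[k] αₕ) := by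
    rw [mul_assoc]; simp
  rw [h₁, U_mul_antipode]
  refine linearMap_congr₂ (f := LinearMap.mulRight k (1 ⊗ₜ[k] αₕ) ∘ₗ
    lin₂ (k := k) fun a b => Δ (S a) * U k H * (b ⊗ₜ[k] 1))
    (g := alphaComul k H ∘ₗ LinearMap.mulLeft k Φ ∘ₗ
      (face₃ k H).toLinearMap) (fun a b => ?_) (Δ h)
  have h₂ : Δ (S a) * U k H * (b ⊗ₜ[k] 1) * (1 ⊗ₜ[k] αₕ) =
      Δ (S a) * (U k H * (1 ⊗ₜ[k] αₕ)) * (b ⊗ₜ[k] 1) := by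
    simp [mul_assoc]
  simp only [LinearMap.comp_apply, lin₂_tmul, LinearMap.mulRight_apply, h₂, U_mul_alpha']
  refine linearMap_congr₃ (f := LinearMap.mulRight k (b ⊗ₜ[k] 1) ∘ₗ LinearMap.mulLeft k (Δ (S a)) ∘ₗ
    alphaComul k H)
    (g := alphaComul k H ∘ₗ
      LinearMap.mulRight k (a ⊗ₜ[k] (b ⊗ₜ[k] 1))) (fun u v w => ?_) Φ
  simp [antipode_anti, mul_assoc]

variable (k H) in
/-- `a ⊗ b ⊗ c ⊗ d ↦ (Δ ⊗ id)(Δ(S(a) α)) (b ⊗ c ⊗ d)`. -/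
def alphaSandwich : H⁴ →ₗ[k] H³ :=
  lin₄ fun a b c d => face₁ k H (Δ (S a * αₕ)) * (b ⊗ₜ[k] (c ⊗ₜ[k] d))

theorem face₂_U_mul_face₀_U_mul_alpha : Φ⁻ * face₂ k H (U k H) * face₀ k H (U k H) * leg₃ k H αₕ =
    alphaSandwich k H (cell₀ k H Φ⁻ * (cell₃ k H Φ * cell₁ k H Φ)) := by
  have h₁ : leg₃ k H αₕ = face₀ k H (1 ⊗ₜ[k] αₕ) := rfl
  rw [h₁, mul_assoc, ← map_mul, U_mul_alpha']
  refine linearMap_congr₃ (f := LinearMap.mulLeft k (Φ⁻ * face₂ k H (U k H)) ∘ₗ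
    (face₀ k H).toLinearMap ∘ₗ alphaComul k H)
    (g := alphaSandwich k H ∘ₗ LinearMap.mulLeft k (cell₀ k H Φ⁻) ∘ₗ LinearMap.mulLeft k (cell₃ k H Φ) ∘ₗ
      (cell₁ k H).toLinearMap) (fun a b c => ?_) Φ
  simp only [LinearMap.comp_apply, alphaComul_tmul, LinearMap.mulLeft_apply, AlgHom.toLinearMap_apply,
    map_mul (face₀ k H), cell₁_tmul]
  rw [← face₂_one_tmul, ← mul_assoc, mul_assoc Φ⁻, ← map_mul, U_mul_antipode_alpha]
  refine linearMap_congr₂ (f := LinearMap.mulRight k (face₀ k H (b ⊗ₜ[k] c)) ∘ₗ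
    LinearMap.mulLeft k Φ⁻ ∘ₗ (face₂ k H).toLinearMap ∘ₗ
    alphaComul k H ∘ₗ LinearMap.mulLeft k Φ ∘ₗ
    (face₃ k H).toLinearMap) (g := alphaSandwich k H ∘ₗ LinearMap.mulLeft k (cell₀ k H Φ⁻) ∘ₗ
    LinearMap.mulLeft k (cell₃ k H Φ) ∘ₗ LinearMap.mulRight k (1 ⊗ₜ[k] (1 ⊗ₜ[k] (b ⊗ₜ[k] c))) ∘ₗ
    (leg₁₂ k H).toLinearMap) (fun x y => ?_) (Δ a)
  refine linearMap_congr₃ (f := LinearMap.mulRight k (face₀ k H (b ⊗ₜ[k] c)) ∘ₗ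
    LinearMap.mulLeft k Φ⁻ ∘ₗ (face₂ k H).toLinearMap ∘ₗ
    alphaComul k H ∘ₗ
    LinearMap.mulRight k (face₃ k H (x ⊗ₜ[k] y))) (g := alphaSandwich k H ∘ₗ LinearMap.mulLeft k (cell₀ k H Φ⁻) ∘ₗ
    LinearMap.mulRight k (leg₁₂ k H (x ⊗ₜ[k] y) * (1 ⊗ₜ[k] (1 ⊗ₜ[k] (b ⊗ₜ[k] c)))) ∘ₗ
    (cell₃ k H).toLinearMap) (fun u v w => ?_) Φ
  simp only [LinearMap.comp_apply, LinearMap.mulLeft_apply, LinearMap.mulRight_apply,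
    AlgHom.toLinearMap_apply, cell₃_tmul, face₃_tmul, Algebra.TensorProduct.tmul_mul_tmul,
    alphaComul_tmul, map_mul (face₂ k H), face₂_tmul'', mul_one]
  rw [← mul_assoc, ← coassoc_inv]
  refine linearMap_congr₂ (f := LinearMap.mulRight k (face₀ k H (b ⊗ₜ[k] c)) ∘ₗ
    LinearMap.mulLeft k (face₁ k H (Δ (S (u * x) * αₕ)) * Φ⁻) ∘ₗ
    LinearMap.mulRight k ((v * y) ⊗ₜ[k] (1 ⊗ₜ[k] 1)) ∘ₗ (face₀ k H).toLinearMap)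
    (g := alphaSandwich k H ∘ₗ LinearMap.mulLeft k (cell₀ k H Φ⁻) ∘ₗ
      LinearMap.mulRight k (leg₁₂ k H (x ⊗ₜ[k] y) * (1 ⊗ₜ[k] (1 ⊗ₜ[k] (b ⊗ₜ[k] c)))) ∘ₗ
      LinearMap.mulRight k (u ⊗ₜ[k] (v ⊗ₜ[k] (1 ⊗ₜ[k] 1))) ∘ₗ (leg₃₄ k H).toLinearMap)
    (fun l m => ?_) (Δ w)
  refine linearMap_congr₃ (f := LinearMap.mulRight k (face₀ k H (b ⊗ₜ[k] c)) ∘ₗ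
    LinearMap.mulRight k (face₀ k H (l ⊗ₜ[k] m) * ((v * y) ⊗ₜ[k] (1 ⊗ₜ[k] 1))) ∘ₗ
    LinearMap.mulLeft k (face₁ k H (Δ (S (u * x) * αₕ))))
    (g := alphaSandwich k H ∘ₗ LinearMap.mulRight k _ ∘ₗ (cell₀ k H).toLinearMap) (fun p q r => ?_) Φ⁻
  simp [alphaSandwich, mul_assoc]

theorem sandwichU_mul_alpha : sandwichU (k := k) (face₁ k H (U k H)) Φ * leg₃ k H αₕ =
    alphaSandwich k H (cell₂ k H Φ * cell₄ k H Φ) := by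
  have key : ∀ (a b c : H) (t : H³), sandwichU (k := k) (face₁ k H
      (alphaComul k H t)) (a ⊗ₜ[k] (b ⊗ₜ[k] c)) =
      alphaSandwich k H (cell₂ k H t * cell₄ k H (a ⊗ₜ[k] (b ⊗ₜ[k] c))) := fun a b c t => by
    simp only [sandwichU, lin₃_tmul]
    refine linearMap_congr₃ (f := LinearMap.mulRight k (b ⊗ₜ[k] (c ⊗ₜ[k] (1 : H))) ∘ₗ
      LinearMap.mulLeft k (face₁ k H (Δ (S a))) ∘ₗ (face₁ k H).toLinearMap ∘ₗ
      alphaComul k H)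
      (g := alphaSandwich k H ∘ₗ LinearMap.mulRight k (cell₄ k H (a ⊗ₜ[k] (b ⊗ₜ[k] c))) ∘ₗ (cell₂ k H).toLinearMap)
      (fun u v w => ?_) t
    simp only [LinearMap.comp_apply, LinearMap.mulLeft_apply, LinearMap.mulRight_apply,
      AlgHom.toLinearMap_apply, cell₂_tmul, alphaComul_tmul, map_mul (face₁ k H), face₁_tmul]
    refine linearMap_congr₂ (f := LinearMap.mulRight k (b ⊗ₜ[k] (c ⊗ₜ[k] (1 : H))) ∘ₗ
      LinearMap.mulLeft k (face₁ k H (Δ (S a))) ∘ₗ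
      LinearMap.mulLeft k (face₁ k H (Δ (S u * αₕ))) ∘ₗ
      LinearMap.mulRight k ((1 : H) ⊗ₜ[k] ((1 : H) ⊗ₜ[k] w)) ∘ₗ (face₃ k H).toLinearMap)
      (g := alphaSandwich k H ∘ₗ LinearMap.mulRight k (cell₄ k H (a ⊗ₜ[k] (b ⊗ₜ[k] c))) ∘ₗ
        LinearMap.mulRight k (u ⊗ₜ[k] (1 ⊗ₜ[k] (1 ⊗ₜ[k] w))) ∘ₗ (leg₂₃ k H).toLinearMap)
      (fun l m => ?_) (Δ v)
    simp [alphaSandwich, antipode_anti, mul_assoc]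
  rw [← sandwichU_mul_leg, leg₃_apply, ← face₁_one_tmul, ← map_mul, U_mul_alpha']
  exact linearMap_congr₃ (g := alphaSandwich k H ∘ₗ
    LinearMap.mulLeft k (cell₂ k H Φ) ∘ₗ (cell₄ k H).toLinearMap) (fun a b c => key a b c Φ) Φ

/-- `Φ⁻¹ (id ⊗ Δ)(U) (1 ⊗ U) = (Δ ⊗ id)(Δ(S(X¹)) U) (X² ⊗ X³ ⊗ 1)`. -/
theorem face₂_U_mul_face₀_U : Φ⁻ * face₂ k H (U k H) * face₀ k H (U k H) =
    sandwichU (k := k) (face₁ k H (U k H)) Φ := by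
  -- After multiplication by α in the last leg, both sides are one map evaluated at the two sides of
  -- the pentagon, with its factor 1 ⊗ Φ moved across.
  have key : Φ⁻ * face₂ k H (U k H) * face₀ k H (U k H) * leg₃ k H αₕ =
      sandwichU (k := k) (face₁ k H (U k H)) Φ * leg₃ k H αₕ := by
    rw [face₂_U_mul_face₀_U_mul_alpha, sandwichU_mul_alpha, ← pentagon]
    congr 1
    simp only [← mul_assoc]
    rw [map_PhiInv_mul, one_mul]
  -- Both sides obey the same rule for S(x) in the last leg, up to quasi-coassociativity, so
  -- agreement after α is enough.
  refine eq_of_mul_antipode_mul_alpha (leg₃ k H) fun x => ?_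
  rw [face₂_U_mul_leg, ← sandwichU_mul_leg _ _ (S x), face₁_U_mul_leg, ← sandwichU_mul, coassoc,
    sandwichU_mul, ← sandwichU_mul_leg, ← sandwichU_mul_leg, key]

end ThreeLegs

/-! ### Coassociativity relation for V -/

section ThreeLegsV

variable [FiniteDimensional k H]

theorem face₂_antipodeInv_mul_V (x : H) :
    face₀ k H (Δ (S⁻ x)) * face₂ k H (V k H) =
    (lin₂ (k := k) fun a b => (b ⊗ₜ[k] (1 ⊗ₜ[k] 1)) * face₂ k H (V k H) *
      face₂ k H (Δ (S⁻ a))) (Δ x) := by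
  rw [← face₂_one_tmul, ← map_mul, antipodeInv_mul_V]
  refine linearMap_congr₂ (f := (face₂ k H).toLinearMap ∘ₗ
    lin₂ (k := k) fun a b => (b ⊗ₜ[k] 1) * V k H * Δ (S⁻ a)) (fun a b => ?_) (Δ x)
  simp [face₂_tmul_one]

theorem tmul_one_mul_face₀ (v b : H) (t : H²) :
    (1 ⊗ₜ[k] (b ⊗ₜ[k] 1)) * face₀ k H t * (v ⊗ₜ[k] (1 ⊗ₜ[k] 1)) =
      (v ⊗ₜ[k] (b ⊗ₜ[k] 1)) * face₀ k H t := by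
  rw [← one_two, face₀_apply]; simp

/-- The relation of V applied in legs 2 and 3 and then under id ⊗ Δ. With `leg_mul_face₁_V` it shows
how the two sides of the final identity react to S⁻¹(x) in the last leg. -/
theorem leg_mul_face₀_V (x : H) : leg₃ k H (S⁻ x) * (face₀ k H (V k H) * face₂ k H (V k H)) =
    sandwichV (k := k) (face₀ k H (V k H) * face₂ k H (V k H)) (face₁ k H (Δ x)) := by
  have h₁ : leg₃ k H (S⁻ x) = face₀ k H (1 ⊗ₜ[k] S⁻ x) := rfl
  rw [h₁, ← mul_assoc, ← map_mul, antipodeInv_mul_V]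
  refine linearMap_congr₂ (f := LinearMap.mulRight k (face₂ k H (V k H)) ∘ₗ
    (face₀ k H).toLinearMap ∘ₗ lin₂ (k := k) fun a b => (b ⊗ₜ[k] 1) * V k H * Δ (S⁻ a))
    (g := sandwichV (k := k) (face₀ k H (V k H) * face₂ k H (V k H)) ∘ₗ
      (face₁ k H).toLinearMap) (fun a b => ?_) (Δ x)
  simp only [LinearMap.comp_apply, lin₂_tmul, AlgHom.toLinearMap_apply, map_mul, face₁_tmul,
    LinearMap.mulRight_apply]
  rw [mul_assoc, face₂_antipodeInv_mul_V]
  refine linearMap_congr₂ (f := LinearMap.mulLeft k (face₀ k H (b ⊗ₜ[k] (1 : H)) * face₀ k H (V k H)) ∘ₗ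
    lin₂ (k := k) fun a b => (b ⊗ₜ[k] (1 ⊗ₜ[k] 1)) * face₂ k H (V k H) *
      face₂ k H (Δ (S⁻ a)))
    (g := sandwichV (k := k) (face₀ k H (V k H) * face₂ k H (V k H)) ∘ₗ
      LinearMap.mulRight k (1 ⊗ₜ[k] (1 ⊗ₜ[k] b)) ∘ₗ (face₃ k H).toLinearMap) (fun u v => ?_) (Δ a)
  simp only [LinearMap.comp_apply, lin₂_tmul, AlgHom.toLinearMap_apply, sandwichV,
    LinearMap.mulLeft_apply, LinearMap.mulRight_apply, face₃_tmul, face₀_tmul,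
    Algebra.TensorProduct.tmul_mul_tmul, lin₃_tmul, one_mul, mul_one]
  rw [← mul_assoc, ← mul_assoc, tmul_one_mul_face₀]
  simp only [mul_assoc]

theorem leg_mul_face₁_V (x : H) : leg₃ k H (S⁻ x) * (face₁ k H (V k H) * Φ⁻) =
    sandwichV (k := k) (face₁ k H (V k H) * Φ⁻) (face₂ k H (Δ x)) := by
  rw [leg₃_apply, ← face₁_one_tmul, ← mul_assoc, ← map_mul, antipodeInv_mul_V]
  refine linearMap_congr₂ (f := LinearMap.mulRight k Φ⁻ ∘ₗ
    (face₁ k H).toLinearMap ∘ₗ lin₂ (k := k) fun a b => (b ⊗ₜ[k] 1) * V k H * Δ (S⁻ a))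
    (g := sandwichV (k := k) (face₁ k H (V k H) * Φ⁻) ∘ₗ
      (face₂ k H).toLinearMap) (fun a b => ?_) (Δ x)
  simp only [LinearMap.comp_apply, lin₂_tmul, AlgHom.toLinearMap_apply, map_mul, face₂_tmul,
    LinearMap.mulRight_apply, face₁_tmul_one]
  rw [mul_assoc, coassoc_inv]
  refine linearMap_congr₂ (f := LinearMap.mulRight k (Φ⁻ * face₂ k H (Δ (S⁻ a))) ∘ₗ
    LinearMap.mulRight k (face₁ k H (V k H)) ∘ₗ (face₃ k H).toLinearMap)
    (g := sandwichV (k := k) (face₁ k H (V k H) * Φ⁻) ∘ₗ TensorProduct.mk k H H² a)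
    (fun u v => ?_) (Δ b)
  simp [sandwichV, mul_assoc]

variable (k H) in
/-- `a ⊗ b ⊗ c ↦ (b ⊗ c) Δ(S⁻¹(a β))`. -/
def betaComul : H³ →ₗ[k] H² := lin₃ fun a b c => (b ⊗ₜ[k] c) * Δ (S⁻ (a * βₕ))

@[simp] theorem betaComul_tmul (a b c : H) :
    betaComul k H (a ⊗ₜ[k] (b ⊗ₜ[k] c)) = (b ⊗ₜ[k] c) * Δ (S⁻ (a * βₕ)) := rfl

variable (k H) in
/-- `a ⊗ b ⊗ c ⊗ d ↦ (b ⊗ c ⊗ d) (id ⊗ Δ)(Δ(S⁻¹(a β)))`. -/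
def betaSandwich : H⁴ →ₗ[k] H³ :=
  lin₄ fun a b c d => (b ⊗ₜ[k] (c ⊗ₜ[k] d)) * face₂ k H (Δ (S⁻ (a * βₕ)))

@[simp] theorem betaSandwich_tmul (a b c d : H) :
    betaSandwich k H (a ⊗ₜ[k] (b ⊗ₜ[k] (c ⊗ₜ[k] d))) =
      (b ⊗ₜ[k] (c ⊗ₜ[k] d)) * face₂ k H (Δ (S⁻ (a * βₕ))) := rfl

theorem antipodeInv_beta_mul_V' : (1 ⊗ₜ[k] S⁻ βₕ) * V k H = betaComul k H Φ⁻ :=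
  antipodeInv_beta_mul_V

/-- `(1 ⊗ S⁻¹(h β)) V = (h₂ x² ⊗ x³) Δ(S⁻¹(h₁ x¹ β))`. -/
theorem antipodeInv_mul_beta_mul_V (h : H) : (1 ⊗ₜ[k] (S⁻ (h * βₕ))) * V k H =
    betaComul k H (face₃ k H (Δ h) * Φ⁻) := by
  have h₁ : ((1 : H) ⊗ₜ[k] (S⁻ (h * βₕ))) * V k H = (1 ⊗ₜ[k] S⁻ βₕ) * ((1 ⊗ₜ[k] (S⁻ h)) * V k H) := by
    rw [← mul_assoc]; simp [antipodeInv_anti]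
  rw [h₁, antipodeInv_mul_V]
  refine linearMap_congr₂ (f := LinearMap.mulLeft k (1 ⊗ₜ[k] S⁻ βₕ) ∘ₗ
    lin₂ (k := k) fun a b => (b ⊗ₜ[k] 1) * V k H * Δ (S⁻ a))
    (g := betaComul k H ∘ₗ LinearMap.mulRight k Φ⁻ ∘ₗ (face₃ k H).toLinearMap)
    (fun a b => ?_) (Δ h)
  have h₂ : (1 ⊗ₜ[k] S⁻ βₕ) * ((b ⊗ₜ[k] 1) * V k H * Δ (S⁻ a)) =
      (b ⊗ₜ[k] 1) * ((1 ⊗ₜ[k] S⁻ βₕ) * V k H) * Δ (S⁻ a) := by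
    simp [← mul_assoc]
  simp only [LinearMap.comp_apply, lin₂_tmul, LinearMap.mulLeft_apply, h₂,
    antipodeInv_beta_mul_V']
  refine linearMap_congr₃ (f := LinearMap.mulRight k (Δ (S⁻ a)) ∘ₗ LinearMap.mulLeft k (b ⊗ₜ[k] (1 : H)) ∘ₗ
    betaComul k H) (g := betaComul k H ∘ₗ
      LinearMap.mulLeft k (a ⊗ₜ[k] (b ⊗ₜ[k] (1 : H)))) (fun u v w => ?_) Φ⁻
  simp [antipodeInv_anti, ← mul_assoc]

theorem leg_beta_mul_face₁_V : leg₃ k H (S⁻ βₕ) * (face₁ k H (V k H) * Φ⁻) =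
    betaSandwich k H (cell₂ k H Φ⁻ * cell₀ k H Φ⁻) := by
  have key : ∀ t : H³, face₁ k H (betaComul k H t) * Φ⁻ =
      betaSandwich k H (cell₂ k H t * cell₀ k H Φ⁻) := fun t => by
    refine linearMap_congr₃ (f := LinearMap.mulRight k Φ⁻ ∘ₗ (face₁ k H).toLinearMap ∘ₗ
      betaComul k H) (g := betaSandwich k H ∘ₗ LinearMap.mulRight k (cell₀ k H Φ⁻) ∘ₗ
      (cell₂ k H).toLinearMap) (fun a b c => ?_) t
    simp only [LinearMap.comp_apply, LinearMap.mulRight_apply,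
      AlgHom.toLinearMap_apply, cell₂_tmul, betaComul_tmul, map_mul (face₁ k H), face₁_tmul]
    rw [mul_assoc, coassoc_inv]
    refine linearMap_congr₂ (f := LinearMap.mulRight k (Φ⁻ * face₂ k H (Δ (S⁻ (a * βₕ)))) ∘ₗ
      LinearMap.mulRight k ((1 : H) ⊗ₜ[k] ((1 : H) ⊗ₜ[k] c)) ∘ₗ (face₃ k H).toLinearMap)
      (g := betaSandwich k H ∘ₗ LinearMap.mulRight k (cell₀ k H Φ⁻) ∘ₗ
        LinearMap.mulRight k (a ⊗ₜ[k] ((1 : H) ⊗ₜ[k] ((1 : H) ⊗ₜ[k] c))) ∘ₗ (leg₂₃ k H).toLinearMap)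
      (fun x y => ?_) (Δ b)
    refine linearMap_congr₃ (f := LinearMap.mulLeft k _ ∘ₗ
      LinearMap.mulRight k (face₂ k H (Δ (S⁻ (a * βₕ)))))
      (g := betaSandwich k H ∘ₗ LinearMap.mulLeft k _ ∘ₗ (cell₀ k H).toLinearMap)
      (fun p q r => ?_) Φ⁻
    simp [← mul_assoc]
  rw [leg₃_apply, ← face₁_one_tmul, ← mul_assoc, ← map_mul, antipodeInv_beta_mul_V']
  exact key Φ⁻

theorem leg_beta_mul_face₀_V :
    leg₃ k H (S⁻ βₕ) * sandwichV (k := k) (face₀ k H (V k H) * face₂ k H (V k H)) Φ =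
    betaSandwich k H (cell₄ k H Φ * (cell₁ k H Φ⁻ * cell₃ k H Φ⁻)) := by
  have key₁ : ∀ t : H³, face₂ k H (betaComul k H t) = betaSandwich k H (cell₃ k H t) := fun t => by
    refine linearMap_congr₃ (f := (face₂ k H).toLinearMap ∘ₗ
      betaComul k H) (g := betaSandwich k H ∘ₗ (cell₃ k H).toLinearMap) (fun a b c => ?_) t
    simp only [LinearMap.comp_apply, AlgHom.toLinearMap_apply, cell₃_tmul, betaComul_tmul,
      map_mul (face₂ k H), face₂_tmul'']
    refine linearMap_congr₂ (f := LinearMap.mulRight k (face₂ k H (Δ (S⁻ (a * βₕ)))) ∘ₗ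
      LinearMap.mulRight k (b ⊗ₜ[k] ((1 : H) ⊗ₜ[k] (1 : H))) ∘ₗ (face₀ k H).toLinearMap)
      (g := betaSandwich k H ∘ₗ
        LinearMap.mulRight k (a ⊗ₜ[k] (b ⊗ₜ[k] ((1 : H) ⊗ₜ[k] (1 : H)))) ∘ₗ (leg₃₄ k H).toLinearMap)
      (fun x y => ?_) (Δ c)
    simp
  have key₂ : ∀ s : H³, face₀ k H (betaComul k H s) * face₂ k H (V k H) =
      betaSandwich k H (cell₁ k H s * cell₃ k H Φ⁻) := fun s => by
    refine linearMap_congr₃ (f := LinearMap.mulRight k (face₂ k H (V k H)) ∘ₗ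
      (face₀ k H).toLinearMap ∘ₗ betaComul k H) (g := betaSandwich k H ∘ₗ
      LinearMap.mulRight k (cell₃ k H Φ⁻) ∘ₗ (cell₁ k H).toLinearMap) (fun a b c => ?_) s
    simp only [LinearMap.comp_apply, AlgHom.toLinearMap_apply, cell₁_tmul', betaComul_tmul,
      map_mul (face₀ k H), LinearMap.mulRight_apply]
    rw [mul_assoc, ← face₂_one_tmul, ← map_mul, antipodeInv_mul_beta_mul_V, key₁, map_mul]
    have h₁ : cell₃ k H (face₃ k H (Δ a)) = leg₁₂ k H (Δ a) := by
      refine linearMap_congr₂ (f := (cell₃ k H).toLinearMap ∘ₗ (face₃ k H).toLinearMap)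
        (g := (leg₁₂ k H).toLinearMap) (fun x y => ?_) (Δ a)
      simp [cell₃_tmul]
    rw [h₁, mul_assoc]
    generalize leg₁₂ k H (Δ a) * cell₃ k H Φ⁻ = t
    refine linearMap_congr₄ (f := LinearMap.mulLeft k (face₀ k H (b ⊗ₜ[k] c)) ∘ₗ betaSandwich k H)
      (g := betaSandwich k H ∘ₗ LinearMap.mulLeft k ((1 : H) ⊗ₜ[k] ((1 : H) ⊗ₜ[k] (b ⊗ₜ[k] c))))
      (fun p q r s => ?_) t
    simp [← mul_assoc]
  rw [← leg_mul_sandwichV, ← mul_assoc]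
  have h₁ : leg₃ k H (S⁻ βₕ) = face₀ k H (1 ⊗ₜ[k] S⁻ βₕ) := rfl
  rw [h₁, ← map_mul, antipodeInv_beta_mul_V', key₂]
  refine linearMap_congr₃ (f := sandwichV (k := k) _)
    (g := betaSandwich k H ∘ₗ LinearMap.mulRight k (cell₁ k H Φ⁻ * cell₃ k H Φ⁻) ∘ₗ
      (cell₄ k H).toLinearMap) (fun a b c => ?_) Φ
  simp only [sandwichV, lin₃_tmul]
  generalize cell₁ k H Φ⁻ * cell₃ k H Φ⁻ = t
  refine linearMap_congr₄ (f := LinearMap.mulRight k (face₂ k H (Δ (S⁻ a))) ∘ₗ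
    LinearMap.mulLeft k (b ⊗ₜ[k] (c ⊗ₜ[k] (1 : H))) ∘ₗ betaSandwich k H)
    (g := betaSandwich k H ∘ₗ LinearMap.mulLeft k (cell₄ k H (a ⊗ₜ[k] (b ⊗ₜ[k] c))))
    (fun p q r s => ?_) t
  simp [← mul_assoc, antipodeInv_anti]

/-- `(X² ⊗ X³ ⊗ 1) (1 ⊗ V) (id ⊗ Δ)(V Δ(S⁻¹(X¹))) = (Δ ⊗ id)(V) Φ⁻¹`. -/
theorem face₀_V_mul_face₂_V :
    sandwichV (k := k) (face₀ k H (V k H) * face₂ k H (V k H)) Φ = face₁ k H (V k H) * Φ⁻ := by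
  -- Here β plays the role that α has for U: once S⁻¹(β) sits in the last leg, the identity is the
  -- pentagon.
  have key : leg₃ k H (S⁻ βₕ) *
      sandwichV (k := k) (face₀ k H (V k H) * face₂ k H (V k H)) Φ =
      leg₃ k H (S⁻ βₕ) * (face₁ k H (V k H) * Φ⁻) := by
    rw [leg_beta_mul_face₀_V, leg_beta_mul_face₁_V, pentagon₀_inv]
    congr 1
    simp only [← mul_assoc]
    rw [map_PhiInv_mul, one_mul]
  refine eq_of_antipodeInv_beta_mul (leg₃ k H) fun x => ?_
  rw [leg_mul_face₁_V, ← leg_mul_sandwichV _ _ (S⁻ x), leg_mul_face₀_V, ← sandwichV_mul, ← coassoc,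
    sandwichV_mul, ← leg_mul_sandwichV _ (face₂ k H (Δ x)),
    ← leg_mul_sandwichV _ (face₂ k H (Δ x)), key]

end ThreeLegsV

/-! ### Right quasi-Hopf bimodules and their coinvariants -/

section HopfBimodule

variable {M : Type*} [AddCommGroup M] [Module k M]

section Actions

variable {X : Type*} [Ring X] [Algebra k X]

/-- The left action of `H ⊗ X` on `M ⊗ X`. -/
def leftAct (L : H →ₗ[k] M →ₗ[k] M) : H ⊗[k] X →ₗ[k] M ⊗[k] X →ₗ[k] M ⊗[k] X :=
  TensorProduct.map₂ L (LinearMap.mul k X)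

/-- The right action of `H ⊗ X` on `M ⊗ X`. -/
def rightAct (R : M →ₗ[k] H →ₗ[k] M) : M ⊗[k] X →ₗ[k] H ⊗[k] X →ₗ[k] M ⊗[k] X :=
  TensorProduct.map₂ R (LinearMap.mul k X)

@[simp] theorem leftAct_tmul (L : H →ₗ[k] M →ₗ[k] M) (a : H) (x : X) (m : M) (y : X) :
    leftAct L (a ⊗ₜ[k] x) (m ⊗ₜ[k] y) = L a m ⊗ₜ[k] (x * y) := rfl

@[simp] theorem rightAct_tmul (R : M →ₗ[k] H →ₗ[k] M) (a : H) (x : X) (m : M) (y : X) :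
    rightAct R (m ⊗ₜ[k] y) (a ⊗ₜ[k] x) = R m a ⊗ₜ[k] (y * x) := rfl

end Actions

variable (k H) in
/-- `m ⊗ c ↦ ε(c) m`. -/
def counitRight : M ⊗[k] H →ₗ[k] M :=
  (TensorProduct.rid k M).toLinearMap ∘ₗ TensorProduct.map LinearMap.id counit.toLinearMap

@[simp] theorem counitRight_tmul (m : M) (c : H) :
    counitRight k H (m ⊗ₜ[k] c) = ε c • m := rfl

/-- `M` with the actions `L`, `R` and the coaction `ρ` is a right quasi-Hopf `H`-bimodule. -/
structure IsHopfBimodule (L : H →ₗ[k] M →ₗ[k] M) (R : M →ₗ[k] H →ₗ[k] M)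
    (ρ : M →ₗ[k] M ⊗[k] H) : Prop where
  one_left : ∀ m, L 1 m = m
  mul_left : ∀ a b m, L (a * b) m = L a (L b m)
  one_right : ∀ m, R m 1 = m
  mul_right : ∀ m a b, R m (a * b) = R (R m a) b
  left_right : ∀ a m b, R (L a m) b = L a (R m b)
  coact_left : ∀ h m, ρ (L h m) = leftAct L (Δ h) (ρ m)
  coact_right : ∀ m h, ρ (R m h) = rightAct R (ρ m) (Δ h)
  counit_coact : ∀ m, counitRight k H (ρ m) = m
  coassoc_coact : ∀ m, leftAct L Φ (TensorProduct.assoc k M H H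
    (TensorProduct.map ρ LinearMap.id (ρ m))) =
      rightAct R (TensorProduct.map LinearMap.id (Δ).toLinearMap (ρ m)) Φ

namespace IsHopfBimodule

variable {L : H →ₗ[k] M →ₗ[k] M} {R : M →ₗ[k] H →ₗ[k] M} {ρ : M →ₗ[k] M ⊗[k] H}
  (hM : IsHopfBimodule L R ρ)

section

variable {X : Type*} [Ring X] [Algebra k X]
include hM

theorem leftAct_mul (s t : H ⊗[k] X) (x : M ⊗[k] X) :
    leftAct L (s * t) x = leftAct L s (leftAct L t x) := by
  refine linearMap_congr₂ (f := (leftAct L).flip x ∘ₗ LinearMap.mulRight k t)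
    (g := (leftAct L).flip (leftAct L t x)) (fun a b => ?_) s
  refine linearMap_congr₂ (f := (leftAct L).flip x ∘ₗ LinearMap.mulLeft k (a ⊗ₜ[k] b))
    (g := leftAct L (a ⊗ₜ[k] b) ∘ₗ (leftAct L).flip x) (fun c d => ?_) t
  refine linearMap_congr₂ (f := leftAct L ((a ⊗ₜ[k] b) * (c ⊗ₜ[k] d)))
    (g := leftAct L (a ⊗ₜ[k] b) ∘ₗ leftAct L (c ⊗ₜ[k] d)) (fun m y => ?_) x
  simp [hM.mul_left, mul_assoc]

theorem leftAct_one (x : M ⊗[k] X) : leftAct L 1 x = x :=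
  linearMap_congr₂ (f := leftAct L 1) (g := LinearMap.id) (fun m y => by
    simp [Algebra.TensorProduct.one_def, hM.one_left]) x

theorem leftAct_rightAct (s t : H ⊗[k] X) (x : M ⊗[k] X) :
    leftAct L s (rightAct R x t) = rightAct R (leftAct L s x) t := by
  refine linearMap_congr₂ (f := (leftAct L).flip (rightAct R x t))
    (g := (rightAct R).flip t ∘ₗ (leftAct L).flip x) (fun a b => ?_) s
  refine linearMap_congr₂ (f := leftAct L (a ⊗ₜ[k] b) ∘ₗ rightAct R x)
    (g := rightAct R (leftAct L (a ⊗ₜ[k] b) x)) (fun c d => ?_) t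
  refine linearMap_congr₂ (f := leftAct L (a ⊗ₜ[k] b) ∘ₗ (rightAct R).flip (c ⊗ₜ[k] d))
    (g := (rightAct R).flip (c ⊗ₜ[k] d) ∘ₗ leftAct L (a ⊗ₜ[k] b)) (fun m y => ?_) x
  simp [hM.left_right, mul_assoc]

end

/-- `m ⊗ y ⊗ z ↦ m · β S(y) α z`. -/
def tail (R : M →ₗ[k] H →ₗ[k] M) : M ⊗[k] H² →ₗ[k] M :=
  lin₃ fun m y z => R m (βₕ * (S y * αₕ * z))

@[simp] theorem tail_tmul (m : M) (y z : H) :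
    tail R (m ⊗ₜ[k] (y ⊗ₜ[k] z)) = R m (βₕ * (S y * αₕ * z)) := rfl

variable (k H M) in
/-- `m ⊗ c ↦ m ⊗ c ⊗ 1`. -/
def tensorOneRight : M ⊗[k] H →ₗ[k] M ⊗[k] H² :=
  TensorProduct.map LinearMap.id (Algebra.TensorProduct.includeLeft : H →ₐ[k] H²).toLinearMap

@[simp] theorem tensorOneRight_tmul (m : M) (c : H) :
    tensorOneRight k H M (m ⊗ₜ[k] c) = m ⊗ₜ[k] (c ⊗ₜ[k] 1) := rfl

local notation "E" => coinvariantProjection L R ρ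

theorem projection_eq (m : M) :
    E m = tail R (leftAct L Φ (tensorOneRight k H M (ρ m))) := by
  have h : tail R = TensorProduct.lift R ∘ₗ TensorProduct.map LinearMap.id
      (LinearMap.mulLeft k βₕ ∘ₗ sAlpha S αₕ) :=
    LinearMap.ext fun t => linearMap_congr₃ (f := tail R) (g := TensorProduct.lift R ∘ₗ
      TensorProduct.map LinearMap.id (LinearMap.mulLeft k βₕ ∘ₗ sAlpha S αₕ))
      (fun a b c => rfl) t
  rw [h]; rfl

include hM

/-- The right action contributes h₁ before β and h₂ inside S, so ∑ h₁βS(h₂) = ε(h)β applies. Hence E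
sees right multiplication only through ε. -/
theorem tail_rightAct (x : M ⊗[k] H²) (h : H) :
    tail R (rightAct R x (face₃ k H (Δ h))) = ε h • tail R x := by
  refine linearMap_congr₃ (f := tail R ∘ₗ (rightAct R).flip (face₃ k H (Δ h)))
    (g := ε h • tail R) (fun m y z => ?_) x
  refine (comul_beta (tail R ∘ₗ rightAct R (m ⊗ₜ[k] (y ⊗ₜ[k] z)) ∘ₗ (face₃ k H).toLinearMap)
    (fun b => R m (b * (S y * αₕ * z)))
    (by constructor <;> intros <;> simp [add_mul]) (fun u v => ?_) h).trans ?_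
  · simp [← hM.mul_right, antipode_anti, mul_assoc]
  · simp [one_two, hM.one_right]

theorem projection_right (m : M) (h : H) : E (R m h) = ε h • E m := by
  rw [projection_eq, projection_eq, hM.coact_right, ← hM.tail_rightAct, ← hM.leftAct_rightAct]
  congr 2
  refine linearMap_congr₂ (f := tensorOneRight k H M ∘ₗ rightAct R (ρ m))
    (g := rightAct R (tensorOneRight k H M (ρ m)) ∘ₗ (face₃ k H).toLinearMap)
    (fun a b => ?_) (Δ h)
  refine linearMap_congr₂ (f := tensorOneRight k H M ∘ₗ (rightAct R).flip (a ⊗ₜ[k] b))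
    (g := (rightAct R).flip (face₃ k H (a ⊗ₜ[k] b)) ∘ₗ tensorOneRight k H M) (fun n c => ?_) (ρ m)
  simp

theorem projection_left_projection (h : H) (m : M) : E (L h (E m)) = E (L h m) := by
  -- The outer projection sees the right action in E(m) only through ε, so `tail` may be replaced by
  -- this counital version; the scalars ε(α) and ε(β) cancel each other.
  let κ : M ⊗[k] H² →ₗ[k] M := (TensorProduct.rid k M).toLinearMap ∘ₗ
    TensorProduct.map LinearMap.id (LinearMap.mul' k k ∘ₗ
      TensorProduct.map (counit (k := k) (H := H)).toLinearMap counit.toLinearMap)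
  have hκ : ∀ m y z, κ (m ⊗ₜ[k] (y ⊗ₜ[k] z)) = (ε y * ε z) • m := fun _ _ _ => rfl
  have h₁ : ∀ x, E (L h (tail R x)) = E (L h (κ x)) := fun x => by
    refine linearMap_congr₃ (f := E ∘ₗ L h ∘ₗ tail R) (g := E ∘ₗ L h ∘ₗ κ) (fun n y z => ?_) x
    have h₂ := counit_alpha_mul_beta (k := k) (H := H)
    simp only [LinearMap.comp_apply, tail_tmul, ← hM.left_right, hM.projection_right, hκ,
      map_smul, map_mul, counit_antipode]
    congr 1
    calc _ = (ε αₕ * ε βₕ) * (ε y * ε z) := by ring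
      _ = _ := by rw [h₂, one_mul]
  have h₂ : ∀ s, κ (leftAct L Φ (tensorOneRight k H M s)) = counitRight k H s := fun s => by
    refine linearMap_congr₂ (f := κ ∘ₗ leftAct L Φ ∘ₗ tensorOneRight k H M)
      (fun n c => ?_) s
    have h₃ := linearMap_congr₃ (f := κ ∘ₗ (leftAct L).flip (n ⊗ₜ[k] (c ⊗ₜ[k] (1 : H))))
      (g := ε c • L.flip n ∘ₗ contractRight₂ counit.toLinearMap ∘ₗ (counit₃ k H).toLinearMap)
      (fun a b d => by
        simp only [hκ, LinearMap.comp_apply, LinearMap.flip_apply, leftAct_tmul,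
          Algebra.TensorProduct.tmul_mul_tmul, mul_one, map_mul, LinearMap.smul_apply,
          AlgHom.toLinearMap_apply, counit₃_tmul, contractRight₂_tmul, map_smul, smul_smul]
        congr 1; ring) Φ
    refine h₃.trans ?_
    simp [counit₃_Phi, one_two, hM.one_left]
  rw [projection_eq m, h₁, h₂, hM.counit_coact]

/-- Coassociativity of the coaction rewrites ∑ E(m₀)·m₁ as an expression in which S(m₁₁)αm₁₂
collapses to ε(m₁)α, and ∑ X¹βS(X²)αX³ = 1 remains. So M is generated by coinvariants over H. -/
theorem right_projection_coact (m : M) :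
    (lin₂ (k := k) fun m c => R (E m) c) (ρ m) = m := by
  have h₁ : ∀ s, (lin₂ (k := k) fun m c => R (E m) c) s = tail R (leftAct L Φ
      (TensorProduct.assoc k M H H (TensorProduct.map ρ LinearMap.id s))) := fun s => by
    refine linearMap_congr₂ (g := tail R ∘ₗ leftAct L Φ ∘ₗ
      (TensorProduct.assoc k M H H).toLinearMap ∘ₗ TensorProduct.map ρ LinearMap.id)
      (fun n c => ?_) s
    simp only [lin₂_tmul, projection_eq, LinearMap.comp_apply, TensorProduct.map_tmul,
      LinearMap.id_apply]
    refine linearMap_congr₂ (f := R.flip c ∘ₗ tail R ∘ₗ leftAct L Φ ∘ₗ tensorOneRight k H M)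
      (g := tail R ∘ₗ leftAct L Φ ∘ₗ (TensorProduct.assoc k M H H).toLinearMap ∘ₗ
        (TensorProduct.mk k (M ⊗[k] H) H).flip c) (fun l d => ?_) (ρ n)
    refine linearMap_congr₃ (f := R.flip c ∘ₗ tail R ∘ₗ (leftAct L).flip (l ⊗ₜ[k] (d ⊗ₜ[k] (1 : H))))
      (g := tail R ∘ₗ (leftAct L).flip (l ⊗ₜ[k] (d ⊗ₜ[k] c))) (fun u v w => ?_) Φ
    simp [← hM.mul_right, mul_assoc]
  have h₂ : ∀ s, tail R (rightAct R (TensorProduct.map LinearMap.id (Δ).toLinearMap s) Φ) =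
      counitRight k H s := fun s => by
    refine linearMap_congr₂ (f := tail R ∘ₗ (rightAct R).flip Φ ∘ₗ
      TensorProduct.map LinearMap.id (Δ).toLinearMap) (fun n c => ?_) s
    have h₃ := linearMap_congr₃ (f := tail R ∘ₗ rightAct R (n ⊗ₜ[k] Δ c))
      (g := ε c • R n ∘ₗ betaSAlpha S αₕ βₕ) (fun u v w => by
        refine (comul_alpha (tail R ∘ₗ (rightAct R).flip (u ⊗ₜ[k] (v ⊗ₜ[k] w)) ∘ₗ
          TensorProduct.mk k M H² n) (fun a => R n (u * βₕ * (S v * a * w)))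
          (by constructor <;> intros <;> simp [add_mul, mul_add]) (fun x y => ?_) c).trans ?_
        · simp [← hM.mul_right, antipode_anti, mul_assoc]
        · simp [one_two, ← hM.mul_right, mul_assoc]) Φ
    refine h₃.trans ?_
    simp [betaSAlpha_Phi, hM.one_right]
  rw [h₁, hM.coassoc_coact, h₂, hM.counit_coact]

theorem map_projection_rightAct (x : M ⊗[k] H) (b : H) :
    TensorProduct.map E LinearMap.id (rightAct R x (Δ b)) =
      rightAct R (TensorProduct.map E LinearMap.id x) (1 ⊗ₜ[k] b) := by
  refine linearMap_congr₂ (f := TensorProduct.map E LinearMap.id ∘ₗ (rightAct R).flip (Δ b))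
    (g := (rightAct R).flip (1 ⊗ₜ[k] b) ∘ₗ TensorProduct.map E LinearMap.id) (fun m c => ?_) x
  have h₁ := linearMap_congr₂ (f := TensorProduct.map E LinearMap.id ∘ₗ rightAct R (m ⊗ₜ[k] c))
    (g := TensorProduct.mk k M H (E m) ∘ₗ LinearMap.mulLeft k c ∘ₗ
      contractLeft₂ counit.toLinearMap) (fun u v => by
        simp [hM.projection_right, TensorProduct.smul_tmul']) (Δ b)
  refine h₁.trans ?_
  simp [contractLeft_comul, hM.one_right]

theorem map_projection_coact_right (m : M) (b : H) :
    TensorProduct.map E LinearMap.id (ρ (R m b)) =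
      rightAct R (TensorProduct.map E LinearMap.id (ρ m)) (1 ⊗ₜ[k] b) := by
  rw [hM.coact_right, hM.map_projection_rightAct]

theorem assoc_coact (m : M) : TensorProduct.assoc k M H H
    (TensorProduct.map ρ LinearMap.id (ρ m)) = rightAct R (leftAct L Φ⁻
      (TensorProduct.map LinearMap.id (Δ).toLinearMap (ρ m))) Φ := by
  rw [← hM.leftAct_rightAct, ← hM.coassoc_coact, ← hM.leftAct_mul, PhiInv_mul_Phi, hM.leftAct_one]

/-- A linear map on `M ⊗ H ⊗ H` that factors through `E` on the first factor does not see the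
right action of `Φ`. -/
theorem apply_rightAct_Phi {N : Type*} [AddCommGroup N] [Module k N] (Z : M ⊗[k] H² →ₗ[k] N)
    (hZ : ∀ m h x, Z (R m h ⊗ₜ[k] x) = ε h • Z (m ⊗ₜ[k] x)) (x : M ⊗[k] H²) :
    Z (rightAct R x Φ) = Z x := by
  refine linearMap_congr₂ (f := Z ∘ₗ (rightAct R).flip Φ) (fun m y => ?_) x
  have h₁ := linearMap_congr₃ (f := Z ∘ₗ rightAct R (m ⊗ₜ[k] y))
    (g := Z ∘ₗ TensorProduct.mk k M H² m ∘ₗ LinearMap.mulLeft k y ∘ₗ (counit₁ k H).toLinearMap)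
    (fun u v w => by simp [hZ]) Φ
  refine h₁.trans ?_
  simp [counit₁_Phi]

/-- This makes the coinvariants free generators. The double coaction hidden in ρ(E(m)) is rewritten
by coassociativity; its outer Φ is invisible under E, its inner coproduct is absorbed by β, and the
rest is ∑ Δ(X¹) p_R (1 ⊗ S(X²)αX³) = 1 acting on m ⊗ 1. -/
theorem map_projection_coact_projection (m : M) :
    TensorProduct.map E LinearMap.id (ρ (E m)) = E m ⊗ₜ[k] 1 := by
  let w := TensorProduct.assoc k M H H (TensorProduct.map ρ LinearMap.id (ρ m))
  let Z : H → H → H → M ⊗[k] H² →ₗ[k] M ⊗[k] H := fun a b d => lin₃ fun n c c' =>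
    rightAct R (TensorProduct.map E LinearMap.id (leftAct L (Δ a) (n ⊗ₜ[k] c)))
      (1 ⊗ₜ[k] (βₕ * (S (b * c') * αₕ * d)))
  have h₁ : ∀ a b d, TensorProduct.map E LinearMap.id (ρ (tail R (leftAct L (a ⊗ₜ[k] (b ⊗ₜ[k] d))
      (tensorOneRight k H M (ρ m))))) = Z a b d w := fun a b d => by
    refine linearMap_congr₂ (f := TensorProduct.map E LinearMap.id ∘ₗ ρ ∘ₗ tail R ∘ₗ
      leftAct L (a ⊗ₜ[k] (b ⊗ₜ[k] d)) ∘ₗ tensorOneRight k H M) (g := Z a b d ∘ₗ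
      (TensorProduct.assoc k M H H).toLinearMap ∘ₗ TensorProduct.map ρ LinearMap.id)
      (fun n c => ?_) (ρ m)
    simp only [LinearMap.comp_apply, tensorOneRight_tmul, leftAct_tmul, tail_tmul,
      Algebra.TensorProduct.tmul_mul_tmul, hM.map_projection_coact_right, hM.coact_left,
      TensorProduct.map_tmul, LinearMap.id_apply, mul_one]
    refine linearMap_congr₂ (f := (rightAct R).flip _ ∘ₗ TensorProduct.map E LinearMap.id ∘ₗ
      leftAct L (Δ a)) (g := Z a b d ∘ₗ (TensorProduct.assoc k M H H).toLinearMap ∘ₗ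
        (TensorProduct.mk k (M ⊗[k] H) H).flip c) (fun l e => ?_) (ρ n)
    simp [Z]
  have h₂ : ∀ a b d x, Z a b d (rightAct R x Φ) = Z a b d x := fun a b d x => by
    refine hM.apply_rightAct_Phi _ (fun n h y => ?_) x
    refine linearMap_congr₂ (f := Z a b d ∘ₗ TensorProduct.mk k M H² (R n h))
      (g := ε h • Z a b d ∘ₗ TensorProduct.mk k M H² n) (fun c c' => ?_) y
    simp only [LinearMap.comp_apply, TensorProduct.mk_apply, Z, lin₃_tmul, LinearMap.smul_apply]
    refine linearMap_congr₂ (f := (rightAct R).flip _ ∘ₗ TensorProduct.map E LinearMap.id ∘ₗ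
      (leftAct L).flip (R n h ⊗ₜ[k] c)) (g := ε h • (rightAct R).flip
        (1 ⊗ₜ[k] (βₕ * (S (b * c') * αₕ * d))) ∘ₗ
        TensorProduct.map E LinearMap.id ∘ₗ (leftAct L).flip (n ⊗ₜ[k] c)) (fun u v => ?_) (Δ a)
    simp [← hM.left_right, hM.projection_right, TensorProduct.smul_tmul']
  have h₃ : ∀ a b d s, Z a b d (leftAct L Φ⁻ (TensorProduct.map LinearMap.id (Δ).toLinearMap s)) =
      TensorProduct.map E LinearMap.id (leftAct L (Δ a * pR k H * (1 ⊗ₜ[k] (S b * αₕ * d)))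
        (counitRight k H s ⊗ₜ[k] 1)) := fun a b d s => by
    refine linearMap_congr₂ (f := Z a b d ∘ₗ leftAct L Φ⁻ ∘ₗ
      TensorProduct.map LinearMap.id (Δ).toLinearMap) (g := TensorProduct.map E LinearMap.id ∘ₗ
      leftAct L (Δ a * pR k H * (1 ⊗ₜ[k] (S b * αₕ * d))) ∘ₗ (TensorProduct.mk k M H).flip 1 ∘ₗ
      counitRight k H) (fun n c => ?_) s
    rw [pR_eq]
    refine linearMap_congr₃ (f := Z a b d ∘ₗ (leftAct L).flip (n ⊗ₜ[k] Δ c))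
      (g := TensorProduct.map E LinearMap.id ∘ₗ (leftAct L).flip ((ε c • n) ⊗ₜ[k] (1 : H)) ∘ₗ
        LinearMap.mulRight k (1 ⊗ₜ[k] (S b * αₕ * d)) ∘ₗ LinearMap.mulLeft k (Δ a) ∘ₗ pMap k H)
      (fun u v w => ?_) Φ⁻
    refine linearMap_congr₂ (f := Z a b d ∘ₗ leftAct L (u ⊗ₜ[k] (v ⊗ₜ[k] w)) ∘ₗ TensorProduct.mk k M H² n) 
      (g := lin₂ (k := k) fun x y => TensorProduct.map E LinearMap.id (leftAct L (Δ a)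
        (L u n ⊗ₜ[k] (v * (x * βₕ * S y) * S w * S b * αₕ * d)))) (fun x y => ?_) (Δ c) |>.trans ?_
    · simp only [LinearMap.comp_apply, TensorProduct.mk_apply, Z, leftAct_tmul, lin₃_tmul,
        Algebra.TensorProduct.tmul_mul_tmul, lin₂_tmul]
      refine linearMap_congr₂ (f := (rightAct R).flip _ ∘ₗ TensorProduct.map E LinearMap.id ∘ₗ
        (leftAct L).flip (L u n ⊗ₜ[k] (v * x)))
        (g := TensorProduct.map E LinearMap.id ∘ₗ (leftAct L).flip (L u n ⊗ₜ[k] _))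
        (fun p q => ?_) (Δ a)
      simp [hM.one_right, antipode_anti, mul_assoc]
    · refine (comul_beta _ (fun z => TensorProduct.map E LinearMap.id (leftAct L (Δ a)
        (L u n ⊗ₜ[k] (v * z * S w * S b * αₕ * d))))
        (by constructor <;> intros <;> simp [add_mul, mul_add, TensorProduct.tmul_add])
        (fun x y => rfl) c).trans ?_
      simp only [one_two, lin₂_tmul, LinearMap.comp_apply, pMap_tmul, LinearMap.mulLeft_apply,
        LinearMap.mulRight_apply, LinearMap.flip_apply, hM.leftAct_mul]
      simp [antipode_unit, hM.one_left, ← TensorProduct.smul_tmul', mul_assoc]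
  have h₄ := linearMap_congr₃ (f := TensorProduct.map E LinearMap.id ∘ₗ ρ ∘ₗ tail R ∘ₗ
      (leftAct L).flip (tensorOneRight k H M (ρ m)))
    (g := TensorProduct.map E LinearMap.id ∘ₗ (leftAct L).flip (m ⊗ₜ[k] (1 : H)) ∘ₗ
      lin₃ (k := k) fun a b c => Δ a * pR k H * (1 ⊗ₜ[k] (S b * αₕ * c))) (fun a b d => by
      refine (h₁ a b d).trans ?_
      simp only [w]
      rw [hM.assoc_coact, h₂, h₃, hM.counit_coact]
      rfl) Φ
  rw [projection_eq m]
  refine h₄.trans ?_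
  simp only [LinearMap.comp_apply, comul_pR_Phi, LinearMap.flip_apply, hM.leftAct_one]
  rw [← projection_eq]; rfl

/-- `h · n = E(h₁ · n) · h₂` for a coinvariant `n`. -/
theorem left_eq_of_coinvariant {n : M} (hn : E n = n) (h : H) :
    L h n = (lin₂ (k := k) fun a b => R (E (L a n)) b) (Δ h) := by
  conv_lhs => rw [← hM.right_projection_coact (L h n), hM.coact_left]
  refine linearMap_congr₂ (f := (lin₂ (k := k) fun m c => R (E m) c) ∘ₗ (leftAct L).flip (ρ n))
    (fun a b => ?_) (Δ h)
  -- By `projection_left_projection` an extra E can be placed on the coaction of n, which then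
  -- becomes n ⊗ 1.
  have h₁ := linearMap_congr₂ (f := (lin₂ (k := k) fun m c => R (E m) c) ∘ₗ leftAct L (a ⊗ₜ[k] b))
    (g := (lin₂ (k := k) fun m c => R (E (L a m)) (b * c)) ∘ₗ TensorProduct.map E LinearMap.id)
    (fun m c => by simp [hM.projection_left_projection]) (ρ n)
  refine h₁.trans ?_
  conv_lhs => rw [← hn, LinearMap.comp_apply, hM.map_projection_coact_projection, hn]
  simp

/-- `ρ(n) = E(x¹ · n) · x² ⊗ x³` for a coinvariant `n`. -/
theorem coact_eq_of_coinvariant {n : M} (hn : E n = n) :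
    ρ n = (lin₃ (k := k) fun a b c => R (E (L a n)) b ⊗ₜ[k] c) Φ⁻ := by
  let N : M ⊗[k] H² →ₗ[k] M ⊗[k] H := lin₃ fun m c c' => R (E m) c ⊗ₜ[k] c'
  have h₁ : ∀ s, s = N (TensorProduct.assoc k M H H (TensorProduct.map ρ LinearMap.id s)) :=
    fun s => by
      refine linearMap_congr₂ (f := LinearMap.id) (g := N ∘ₗ
        (TensorProduct.assoc k M H H).toLinearMap ∘ₗ TensorProduct.map ρ LinearMap.id)
        (fun m c => ?_) s
      conv_lhs => rw [← hM.right_projection_coact m]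
      refine linearMap_congr₂ (f := (TensorProduct.mk k M H).flip c ∘ₗ
        lin₂ (k := k) fun m c => R (E m) c) (g := N ∘ₗ
        (TensorProduct.assoc k M H H).toLinearMap ∘ₗ (TensorProduct.mk k (M ⊗[k] H) H).flip c)
        (fun u v => ?_) (ρ m)
      simp [N]
  -- The right-hand Φ in the double coaction drops out, so only Φ⁻¹ on the left survives in the
  -- final formula.
  have h₂ : ∀ x, N (rightAct R x Φ) = N x := hM.apply_rightAct_Phi _ (fun m h y => by
    refine linearMap_congr₂ (f := N ∘ₗ TensorProduct.mk k M H² (R m h))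
      (g := ε h • N ∘ₗ TensorProduct.mk k M H² m) (fun c c' => ?_) y
    simp [N, hM.projection_right, TensorProduct.smul_tmul'])
  conv_lhs => rw [h₁ (ρ n), hM.assoc_coact, h₂]
  refine linearMap_congr₃ (f := N ∘ₗ (leftAct L).flip
    (TensorProduct.map LinearMap.id (Δ).toLinearMap (ρ n))) (fun a b c => ?_) Φ⁻
  have h₃ := linearMap_congr₂ (f := N ∘ₗ leftAct L (a ⊗ₜ[k] (b ⊗ₜ[k] c)) ∘ₗ
    TensorProduct.map LinearMap.id (Δ).toLinearMap)
    (g := (lin₂ (k := k) fun m d => (rightAct R (E (L a m) ⊗ₜ[k] (1 : H)))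
      ((b ⊗ₜ[k] c) * Δ d)) ∘ₗ TensorProduct.map E LinearMap.id) (fun m d => by
      simp only [LinearMap.comp_apply, TensorProduct.map_tmul, LinearMap.id_apply, lin₂_tmul,
        hM.projection_left_projection]
      refine linearMap_congr₂ (f := N ∘ₗ leftAct L (a ⊗ₜ[k] (b ⊗ₜ[k] c)) ∘ₗ TensorProduct.mk k M H² m)
        (g := rightAct R (E (L a m) ⊗ₜ[k] (1 : H)) ∘ₗ LinearMap.mulLeft k (b ⊗ₜ[k] c))
        (fun u v => ?_) (Δ d)
      simp [N]) (ρ n)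
  refine h₃.trans ?_
  conv_lhs => rw [← hn, LinearMap.comp_apply, hM.map_projection_coact_projection, hn]
  simp

end IsHopfBimodule

end HopfBimodule

/-! ### The dual space as a right quasi-Hopf bimodule -/

section Dual

variable [FiniteDimensional k H]

section Evaluation

variable {X : Type*} [Ring X] [Algebra k X]

/-- In finite dimension H* ⊗ X is Hom(H, X). Identities of coactions become identities of functions
of a ∈ H, without reference to a basis. -/
theorem dual_tensor_ext {s t : Module.Dual k H ⊗[k] X}
    (h : ∀ a, dualTensorHom k H X s a = dualTensorHom k H X t a) : s = t :=
  (dualTensorHomEquiv k H X).injective (LinearMap.ext fun a => by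
    exact h a)

theorem dualTensorHom_leftAct (t : H ⊗[k] X) (s : Module.Dual k H ⊗[k] X) (a : H) :
    dualTensorHom k H X (leftAct (dualLeft k H) t s) a =
      (lin₂ (k := k) fun u x => x * dualTensorHom k H X s (S⁻ u * a)) t := by
  refine linearMap_congr₂ (f := LinearMap.applyₗ a ∘ₗ dualTensorHom k H X ∘ₗ
    (leftAct (dualLeft k H)).flip s) (fun u x => ?_) t
  refine linearMap_congr₂ (f := LinearMap.applyₗ a ∘ₗ dualTensorHom k H X ∘ₗ
    leftAct (dualLeft k H) (u ⊗ₜ[k] x)) (g := LinearMap.mulLeft k x ∘ₗ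
    LinearMap.applyₗ (S⁻ u * a) ∘ₗ dualTensorHom k H X) (fun φ y => ?_) s
  simp [dualLeft]

theorem dualTensorHom_rightAct (t : H ⊗[k] X) (s : Module.Dual k H ⊗[k] X) (a : H) :
    dualTensorHom k H X (rightAct (dualRight k H) s t) a =
      (lin₂ (k := k) fun u x => dualTensorHom k H X s (a * S u) * x) t := by
  refine linearMap_congr₂ (f := LinearMap.applyₗ a ∘ₗ dualTensorHom k H X ∘ₗ
    rightAct (dualRight k H) s) (fun u x => ?_) t
  refine linearMap_congr₂ (f := LinearMap.applyₗ a ∘ₗ dualTensorHom k H X ∘ₗ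
    (rightAct (dualRight k H)).flip (u ⊗ₜ[k] x)) (g := LinearMap.mulRight k x ∘ₗ
    LinearMap.applyₗ (a * S u) ∘ₗ dualTensorHom k H X) (fun φ y => ?_) s
  simp [dualRight]

end Evaluation

/-- `∑ φ(a V² h₂ U²) V¹ h₁ U¹` computes the coaction on `H*`. -/
theorem dualTensorHom_dualCoaction (φ : Module.Dual k H) (a : H) :
    dualTensorHom k H H (dualCoaction k H φ) a = contractRight₂ φ (V k H * Δ a * U k H) := by
  change dualTensorHom k H H (∑ i, dualMul ((Module.finBasis k H).coord i) φ ⊗ₜ[k]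
    Module.finBasis k H i) a = _
  rw [map_sum, LinearMap.sum_apply]
  simp only [dualTensorHom_apply, dualMul, LinearMap.comp_apply, LinearMap.mulRight_apply,
    LinearMap.mulLeft_apply, AlgHom.toLinearMap_apply]
  have h := linearMap_congr₂ (f := ∑ i, (LinearMap.toSpanSingleton k H (Module.finBasis k H i)) ∘ₗ
    LinearMap.mul' k k ∘ₗ TensorProduct.map ((Module.finBasis k H).coord i) φ)
    (g := contractRight₂ φ) (fun x y => by
    simp only [LinearMap.sum_apply, LinearMap.comp_apply, TensorProduct.map_tmul,
      LinearMap.mul'_apply, LinearMap.toSpanSingleton_apply, contractRight₂_tmul,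
      Module.Basis.coord_apply, mul_comm _ (φ y), mul_smul, ← Finset.smul_sum]
    rw [Module.Basis.sum_repr]) (V k H * Δ a * U k H)
  rw [← h, LinearMap.sum_apply]; rfl

variable (k H) in
/-- `a ⊗ b ⊗ c ↦ φ(c) a ⊗ b`. -/
def contractThird (φ : Module.Dual k H) : H³ →ₗ[k] H² :=
  TensorProduct.map LinearMap.id (contractRight₂ φ)

@[simp] theorem contractThird_tmul (φ : Module.Dual k H) (a b c : H) :
    contractThird k H φ (a ⊗ₜ[k] (b ⊗ₜ[k] c)) = a ⊗ₜ[k] (φ c • b) := rfl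

theorem contractThird_face₁ (φ : Module.Dual k H) (t : H²) :
    contractThird k H φ (face₁ k H t) = Δ (contractRight₂ φ t) := by
  refine linearMap_congr₂ (f := contractThird k H φ ∘ₗ (face₁ k H).toLinearMap)
    (g := (Δ).toLinearMap ∘ₗ contractRight₂ φ) (fun a b => ?_) t
  simp only [LinearMap.comp_apply, AlgHom.toLinearMap_apply, face₁_tmul, contractRight₂_tmul,
    map_smul]
  refine linearMap_congr₂ (f := contractThird k H φ ∘ₗ
    LinearMap.mulRight k ((1 : H) ⊗ₜ[k] ((1 : H) ⊗ₜ[k] b)) ∘ₗ (face₃ k H).toLinearMap)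
    (g := φ b • LinearMap.id) (fun x y => ?_) (Δ a)
  simp

theorem contractThird_face₃_mul (φ : Module.Dual k H) (x : H²) (t : H³) :
    contractThird k H φ (face₃ k H x * t) = x * contractThird k H φ t := by
  refine linearMap_congr₂ (f := contractThird k H φ ∘ₗ LinearMap.mulRight k t ∘ₗ
    (face₃ k H).toLinearMap) (g := LinearMap.mulRight k (contractThird k H φ t))
    (fun a b => ?_) x
  refine linearMap_congr₃ (f := contractThird k H φ ∘ₗ LinearMap.mulLeft k _)
    (g := LinearMap.mulLeft k _ ∘ₗ contractThird k H φ) (fun u v w => ?_) t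
  simp

theorem contractThird_mul_face₃ (φ : Module.Dual k H) (x : H²) (t : H³) :
    contractThird k H φ (t * face₃ k H x) = contractThird k H φ t * x := by
  refine linearMap_congr₂ (f := contractThird k H φ ∘ₗ LinearMap.mulLeft k t ∘ₗ
    (face₃ k H).toLinearMap) (g := LinearMap.mulLeft k (contractThird k H φ t))
    (fun a b => ?_) x
  refine linearMap_congr₃ (f := contractThird k H φ ∘ₗ LinearMap.mulRight k _)
    (g := LinearMap.mulRight k _ ∘ₗ contractThird k H φ) (fun u v w => ?_) t
  simp

/-- Iterating the coaction nests two pairs V, U: the outer pair sits around Δ(b), the inner one in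
legs 2 and 3. -/
theorem dualTensorHom_assoc (φ : Module.Dual k H) (b : H) :
    dualTensorHom k H H² (TensorProduct.assoc k (Module.Dual k H) H H
      (TensorProduct.map (dualCoaction k H) LinearMap.id (dualCoaction k H φ))) b =
    contractThird k H φ (face₀ k H (V k H) * face₂ k H (V k H * Δ b * U k H) *
      face₀ k H (U k H)) := by
  have h₁ : ∀ s, dualTensorHom k H H² (TensorProduct.assoc k (Module.Dual k H) H H
      (TensorProduct.map (dualCoaction k H) LinearMap.id s)) b =
      TensorProduct.map LinearMap.id (dualTensorHom k H H s) (V k H * Δ b * U k H) := fun s => by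
    have h₀ : ∀ (s : Module.Dual k H ⊗[k] H) (c : H), dualTensorHom k H H²
        (TensorProduct.assoc k (Module.Dual k H) H H (s ⊗ₜ[k] c)) b =
        dualTensorHom k H H s b ⊗ₜ[k] c := fun s c => by
      refine linearMap_congr₂ (f := LinearMap.applyₗ b ∘ₗ dualTensorHom k H H² ∘ₗ
        (TensorProduct.assoc k (Module.Dual k H) H H).toLinearMap ∘ₗ
        (TensorProduct.mk k _ H).flip c) (g := (TensorProduct.mk k H H).flip c ∘ₗ
        LinearMap.applyₗ b ∘ₗ dualTensorHom k H H) (fun ψ d => ?_) s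
      simp [TensorProduct.smul_tmul']
    let T : Module.Dual k H ⊗[k] H →ₗ[k] H² :=
      LinearMap.applyₗ (V k H * Δ b * U k H) ∘ₗ LinearMap.lTensorHom H ∘ₗ dualTensorHom k H H
    refine linearMap_congr₂ (f := LinearMap.applyₗ b ∘ₗ dualTensorHom k H H² ∘ₗ
      (TensorProduct.assoc k (Module.Dual k H) H H).toLinearMap ∘ₗ
      TensorProduct.map (dualCoaction k H) LinearMap.id) (g := T) (fun ψ c => ?_) s
    change dualTensorHom k H H² (TensorProduct.assoc k (Module.Dual k H) H H
      (dualCoaction k H ψ ⊗ₜ[k] c)) b = TensorProduct.map LinearMap.id (dualTensorHom k H H (ψ ⊗ₜ[k] c)) _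
    rw [h₀, dualTensorHom_dualCoaction]
    refine linearMap_congr₂ (f := (TensorProduct.mk k H H).flip c ∘ₗ contractRight₂ ψ)
      (g := TensorProduct.map LinearMap.id (dualTensorHom k H H (ψ ⊗ₜ[k] c))) (fun x y => ?_) _
    simp [TensorProduct.smul_tmul']
  rw [h₁]
  refine linearMap_congr₂ (g := contractThird k H φ ∘ₗ LinearMap.mulRight k (face₀ k H (U k H)) ∘ₗ
    LinearMap.mulLeft k (face₀ k H (V k H)) ∘ₗ (face₂ k H).toLinearMap) (fun x y => ?_) _
  simp [dualTensorHom_dualCoaction, face₂_tmul, face₀_apply, contractThird]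

theorem dualTensorHom_map_comul (s : Module.Dual k H ⊗[k] H) (a : H) :
    dualTensorHom k H H² (TensorProduct.map LinearMap.id (Δ).toLinearMap s) a =
      Δ (dualTensorHom k H H s a) := by
  refine linearMap_congr₂ (f := LinearMap.applyₗ a ∘ₗ dualTensorHom k H H² ∘ₗ
    TensorProduct.map LinearMap.id (Δ).toLinearMap) (g := (Δ).toLinearMap ∘ₗ
    LinearMap.applyₗ a ∘ₗ dualTensorHom k H H) (fun φ c => ?_) s
  simp

/-- `H*` is a right quasi-Hopf `H`-bimodule. -/
theorem isHopfBimodule_dual :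
    IsHopfBimodule (dualLeft k H) (dualRight k H) (dualCoaction k H) where
  one_left φ := by ext; simp [dualLeft, antipodeInv_unit]
  mul_left a b φ := by ext; simp [dualLeft, antipodeInv_anti]
  one_right φ := by ext; simp [dualRight, antipode_unit]
  mul_right φ a b := by ext; simp [dualRight, antipode_anti, mul_assoc]
  left_right a φ b := by ext; simp [dualRight, dualLeft, mul_assoc]
  -- The left action inserts S⁻¹(h) in front of V in the second leg, where `antipodeInv_mul_V`
  -- redistributes it.
  coact_left h φ := by
    refine dual_tensor_ext fun a => ?_
    rw [dualTensorHom_leftAct, dualTensorHom_dualCoaction]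
    have h₁ : contractRight₂ (dualLeft k H h φ) (V k H * Δ a * U k H) =
        contractRight₂ φ ((1 ⊗ₜ[k] S⁻ h) * V k H * (Δ a * U k H)) := by
      rw [mul_assoc _ (V k H), ← mul_assoc (V k H)]
      refine linearMap_congr₂ (f := contractRight₂ (dualLeft k H h φ))
        (g := contractRight₂ φ ∘ₗ LinearMap.mulLeft k (1 ⊗ₜ[k] S⁻ h)) (fun x y => ?_) _
      simp [dualLeft]
    rw [h₁, antipodeInv_mul_V]
    refine linearMap_congr₂ (f := contractRight₂ φ ∘ₗ LinearMap.mulRight k (Δ a * U k H) ∘ₗ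
      lin₂ (k := k) fun a b => (b ⊗ₜ[k] 1) * V k H * Δ (S⁻ a)) (fun x y => ?_) (Δ h)
    simp only [LinearMap.comp_apply, lin₂_tmul, LinearMap.mulRight_apply,
      dualTensorHom_dualCoaction, map_mul]
    have h₂ : ∀ t, contractRight₂ φ ((y ⊗ₜ[k] (1 : H)) * t) = y * contractRight₂ φ t := fun t => by
      refine linearMap_congr₂ (f := contractRight₂ φ ∘ₗ LinearMap.mulLeft k (y ⊗ₜ[k] (1 : H)))
        (g := LinearMap.mulLeft k y ∘ₗ contractRight₂ φ) (fun u v => by simp) t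
    rw [← h₂]
    simp only [mul_assoc]
  coact_right φ h := by
    refine dual_tensor_ext fun a => ?_
    rw [dualTensorHom_rightAct, dualTensorHom_dualCoaction]
    have h₁ : contractRight₂ (dualRight k H φ h) (V k H * Δ a * U k H) =
        contractRight₂ φ (V k H * Δ a * (U k H * (1 ⊗ₜ[k] S h))) := by
      rw [← mul_assoc]
      refine linearMap_congr₂ (f := contractRight₂ (dualRight k H φ h))
        (g := contractRight₂ φ ∘ₗ LinearMap.mulRight k (1 ⊗ₜ[k] S h)) (fun x y => ?_) _
      simp [dualRight]
    rw [h₁, U_mul_antipode]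
    refine linearMap_congr₂ (f := contractRight₂ φ ∘ₗ LinearMap.mulLeft k (V k H * Δ a) ∘ₗ
      lin₂ (k := k) fun a b => Δ (S a) * U k H * (b ⊗ₜ[k] 1)) (fun x y => ?_) (Δ h)
    simp only [LinearMap.comp_apply, lin₂_tmul, LinearMap.mulLeft_apply,
      dualTensorHom_dualCoaction, map_mul]
    have h₂ : ∀ t, contractRight₂ φ (t * (y ⊗ₜ[k] (1 : H))) = contractRight₂ φ t * y := fun t => by
      refine linearMap_congr₂ (f := contractRight₂ φ ∘ₗ LinearMap.mulRight k (y ⊗ₜ[k] (1 : H)))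
        (g := LinearMap.mulRight k y ∘ₗ contractRight₂ φ) (fun u v => by simp) t
    rw [← h₂]
    simp only [mul_assoc]
  counit_coact φ := by
    refine LinearMap.ext fun a => ?_
    have h₁ := linearMap_congr₂ (f := LinearMap.applyₗ a ∘ₗ counitRight k H)
      (g := (counit (k := k) (H := H)).toLinearMap ∘ₗ LinearMap.applyₗ a ∘ₗ dualTensorHom k H H)
      (fun ψ c => by simp [mul_comm]) (dualCoaction k H φ)
    refine h₁.trans ?_
    simp only [LinearMap.comp_apply, LinearMap.applyₗ_apply_apply, dualTensorHom_dualCoaction]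
    have h₂ := linearMap_congr₂ (f := (counit (k := k) (H := H)).toLinearMap ∘ₗ contractRight₂ φ)
      (g := φ ∘ₗ contractLeft₂ counit.toLinearMap) (fun x y => by simp [mul_comm])
      (V k H * Δ a * U k H)
    refine h₂.trans ?_
    let e : H² →ₐ[k] H := (Algebra.TensorProduct.lid k H).toAlgHom.comp
      (Algebra.TensorProduct.map counit (AlgHom.id k H))
    have h₃ : e (V k H * Δ a * U k H) = a := by
      have hU : e (U k H) = 1 := counit_U
      have hV : e (V k H) = 1 := counit_V
      have ha : e (Δ a) = a := contractLeft_comul a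
      rw [map_mul, map_mul, hU, hV, ha, one_mul, mul_one]
    exact congrArg φ h₃
  -- After evaluation this is the product of the coassociativity relations for V and U, joined by
  -- quasi-coassociativity for Δ(a).
  coassoc_coact φ := by
    refine dual_tensor_ext fun a => ?_
    rw [dualTensorHom_leftAct, dualTensorHom_rightAct]
    have h₁ := linearMap_congr₃ (f := lin₂ (k := k) fun u x => x * dualTensorHom k H H²
        (TensorProduct.assoc k (Module.Dual k H) H H (TensorProduct.map (dualCoaction k H)
          LinearMap.id (dualCoaction k H φ))) (S⁻ u * a))
      (g := contractThird k H φ ∘ₗ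
        LinearMap.mulRight k (face₂ k H (Δ a) * (face₂ k H (U k H) * face₀ k H (U k H))) ∘ₗ
        sandwichV (k := k) (face₀ k H (V k H) * face₂ k H (V k H))) (fun u v w => by
        simp only [lin₂_tmul, dualTensorHom_assoc, ← contractThird_face₃_mul, sandwichV,
          LinearMap.comp_apply, LinearMap.mulRight_apply, lin₃_tmul, map_mul, face₃_tmul, mul_assoc])
      Φ
    have h₂ := linearMap_congr₃ (f := lin₂ (k := k) fun u x => dualTensorHom k H H²
        (TensorProduct.map LinearMap.id (Δ).toLinearMap (dualCoaction k H φ)) (a * S u) * x)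
      (g := contractThird k H φ ∘ₗ LinearMap.mulLeft k (face₁ k H (V k H * Δ a)) ∘ₗ
        sandwichU (k := k) (face₁ k H (U k H))) (fun u v w => by
        simp only [lin₂_tmul, dualTensorHom_map_comul, dualTensorHom_dualCoaction,
          ← contractThird_face₁, ← contractThird_mul_face₃, sandwichU,
          LinearMap.comp_apply, LinearMap.mulLeft_apply, lin₃_tmul, map_mul, face₃_tmul, mul_assoc])
      Φ
    rw [h₁, h₂]
    simp only [LinearMap.comp_apply, LinearMap.mulRight_apply, LinearMap.mulLeft_apply,
      face₀_V_mul_face₂_V, ← face₂_U_mul_face₀_U, map_mul]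
    congr 1
    calc _ = face₁ k H (V k H) * (Φ⁻ * face₂ k H (Δ a)) * face₂ k H (U k H) *
          face₀ k H (U k H) := by simp only [mul_assoc]
      _ = _ := by rw [← coassoc_inv]; simp only [mul_assoc]

end Dual

/-! ### The line of cointegrals and the modulus -/

section Cointegrals

variable [FiniteDimensional k H]

variable (k H) in
/-- The projection of `H*` onto the space of left cointegrals. -/
abbrev cointegralProjection : Module.Dual k H →ₗ[k] Module.Dual k H :=
  coinvariantProjection (dualLeft k H) (dualRight k H) (dualCoaction k H)

theorem nontrivial_of_counit (η : H →ₐ[k] k) : Nontrivial H :=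
  η.toRingHom.domain_nontrivial

theorem projection_projection (φ : Module.Dual k H) :
    cointegralProjection k H (cointegralProjection k H φ) = cointegralProjection k H φ := by
  have := isHopfBimodule_dual.projection_left_projection (1 : H) φ
  rwa [isHopfBimodule_dual.one_left, isHopfBimodule_dual.one_left] at this

/-- If `M` is the free right module over the image of the projection `P`, as witnessed by `ρ`, and
has the dimension of `H`, then the image of `P` is one-dimensional. -/
theorem exists_generator_of_free {M : Type*} [AddCommGroup M] [Module k M] [Nontrivial H]
    [FiniteDimensional k M] (hdim : Module.finrank k M = Module.finrank k H)
    (P : M →ₗ[k] M) (R : M →ₗ[k] H →ₗ[k] M) (ρ : M →ₗ[k] M ⊗[k] H)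
    (hP : ∀ m, P (P m) = P m)
    (h₁ : ∀ m, P m = m → ∀ h, TensorProduct.map P LinearMap.id (ρ (R m h)) = m ⊗ₜ[k] h)
    (h₂ : ∀ m, TensorProduct.lift (R ∘ₗ P) (ρ m) = m) :
    ∃ m₀, P m₀ = m₀ ∧ (∀ m, P m = m → ∃ c : k, m = c • m₀) ∧ Function.Bijective (R m₀) := by
  let N : Submodule k M := LinearMap.range P
  have hN : ∀ m : N, P m = m := by rintro ⟨_, m, rfl⟩; exact hP m
  let T : N ⊗[k] H →ₗ[k] M := TensorProduct.lift (R ∘ₗ N.subtype)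
  -- (P ⊗ id) ∘ ρ composed with T is the inclusion tensored with id, hence injective; `h₂` gives
  -- surjectivity.
  have hT : Function.Bijective T := by
    constructor
    · have h : (TensorProduct.map P LinearMap.id ∘ₗ ρ) ∘ₗ T =
          TensorProduct.map N.subtype LinearMap.id :=
        TensorProduct.ext' fun m h => h₁ m (hN m) h
      have hinj : Function.Injective (TensorProduct.map N.subtype (LinearMap.id : H →ₗ[k] H)) :=
        Module.Flat.rTensor_preserves_injective_linearMap _ (Submodule.subtype_injective _)
      rw [← h, LinearMap.coe_comp] at hinj
      exact Function.Injective.of_comp hinj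
    · intro m
      refine ⟨TensorProduct.map P.rangeRestrict LinearMap.id (ρ m), ?_⟩
      conv_rhs => rw [← h₂ m]
      exact linearMap_congr₂ (f := T ∘ₗ TensorProduct.map P.rangeRestrict LinearMap.id)
        (g := TensorProduct.lift (R ∘ₗ P)) (fun _ _ => rfl) _
  -- dim N · dim H = dim M = dim H, and dim H is positive.
  have hfin : Module.finrank k N = 1 := by
    have h := (LinearEquiv.ofBijective T hT).finrank_eq
    rw [Module.finrank_tensorProduct, hdim] at h
    exact Nat.eq_of_mul_eq_mul_right (Module.finrank_pos (R := k) (M := H)) (by rw [h, one_mul])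
  obtain ⟨v, hv, hspan⟩ := finrank_eq_one_iff'.1 hfin
  have hspan' : ∀ m, P m = m → ∃ c : k, m = c • (v : M) := fun m hm => by
    obtain ⟨c, hc⟩ := hspan ⟨m, m, hm⟩
    exact ⟨c, (congrArg Subtype.val hc).symm⟩
  have hsurj : Function.Surjective (R v) := fun m => by
    obtain ⟨t, rfl⟩ := hT.2 m
    induction t with
    | zero => exact ⟨0, by simp⟩
    | tmul l h =>
      obtain ⟨c, hc⟩ := hspan' l (hN l)
      refine ⟨c • h, ?_⟩
      change _ = R l h
      rw [hc]; simp
    | add s t hs ht =>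
      obtain ⟨x, hx⟩ := hs
      obtain ⟨y, hy⟩ := ht
      exact ⟨x + y, by rw [map_add, map_add, hx, hy]⟩
  exact ⟨v, hN v, hspan', (LinearMap.injective_iff_surjective_of_finrank_eq_finrank
    hdim.symm).2 hsurj, hsurj⟩

/-- The structure theorem for Hopf bimodules applied to H*, whose dimension is that of H. The
bijectivity says that l₀ is a nondegenerate functional. -/
theorem exists_cointegral_generator : ∃ l₀ : Module.Dual k H, cointegralProjection k H l₀ = l₀ ∧
    (∀ l, cointegralProjection k H l = l → ∃ c : k, l = c • l₀) ∧
    Function.Bijective (dualRight k H l₀) := by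
  have : Nontrivial H := nontrivial_of_counit (counit (k := k) (H := H))
  refine exists_generator_of_free Subspace.dual_finrank_eq (cointegralProjection k H)
    (dualRight k H) (dualCoaction k H)
    projection_projection (fun l hl h => ?_) fun φ => ?_
  · rw [isHopfBimodule_dual.map_projection_coact_right]
    conv_lhs => rw [← hl]
    rw [isHopfBimodule_dual.map_projection_coact_projection, hl]
    simp [isHopfBimodule_dual.one_right]
  · conv_rhs => rw [← isHopfBimodule_dual.right_projection_coact φ]
    exact linearMap_congr₂ (g := lin₂ (k := k) fun m c =>
      dualRight k H (cointegralProjection k H m) c)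
      (fun _ _ => rfl) _

theorem eq_zero_of_dualRight_bijective {l₀ : Module.Dual k H}
    (hl₀ : Function.Bijective (dualRight k H l₀)) {x : H} (h : ∀ a, l₀ (a * x) = 0) : x = 0 := by
  rw [← antipode_antipodeInv (k := k) x]
  have : S⁻ x = 0 := hl₀.1 (LinearMap.ext fun a => by simpa [dualRight] using h a)
  rw [this, map_zero]

/-- Solve l₀·y = ε and put r = S(y). Nondegeneracy turns the multiplicativity of ε into the integral
property of r. -/
theorem exists_left_integral {l₀ : Module.Dual k H}
    (hl₀ : Function.Bijective (dualRight k H l₀)) :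
    ∃ r : H, IsLeftIntegral k r ∧ ∀ a, l₀ (a * r) = ε a := by
  obtain ⟨y, hy⟩ := hl₀.2 (counit (k := k) (H := H)).toLinearMap
  have h : ∀ a, l₀ (a * S y) = ε a := fun a => DFunLike.congr_fun hy a
  refine ⟨S y, fun x => ?_, h⟩
  rw [← sub_eq_zero]
  refine eq_zero_of_dualRight_bijective hl₀ fun a => ?_
  rw [mul_sub, map_sub, ← mul_assoc, h, mul_smul_comm, map_smul, h, map_mul, smul_eq_mul, mul_comm,
    sub_self]

/-- Two characters `χ`, `μ` with `χ * (μ ∘ S) = ε` are equal. -/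
theorem character_eq {χ ν : H →ₐ[k] k}
    (h : ∀ x, (LinearMap.mul' k k ∘ₗ
      TensorProduct.map χ.toLinearMap (ν.toLinearMap ∘ₗ S)) (Δ x) = ε x) : χ = ν := by
  let νS : H →ₐ[k] k := AlgHom.ofLinearMap (ν.toLinearMap ∘ₗ S) (by simp [antipode_unit])
    (fun a b => by simp [antipode_anti, mul_comm])
  let ψ : H² →ₐ[k] k := (Algebra.TensorProduct.lmul' k).comp (Algebra.TensorProduct.map νS ν)
  let Ψ : H³ →ₐ[k] k := (Algebra.TensorProduct.lmul' k).comp (Algebra.TensorProduct.map χ ψ)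
  have hΨ : ∀ a b c, Ψ (a ⊗ₜ[k] (b ⊗ₜ[k] c)) = χ a * (ν (S b) * ν c) := fun _ _ _ => rfl
  have hα : ν αₕ ≠ 0 := fun h₀ => by
    have h₁ := congrArg ν (betaSAlpha_Phi (k := k) (H := H))
    have h₂ := linearMap_congr₃ (f := ν.toLinearMap ∘ₗ betaSAlpha S αₕ βₕ) (g := 0)
      (fun a b c => by simp [h₀]) Φ
    have h₃ := h₂.symm.trans h₁
    rw [map_one] at h₃
    exact zero_ne_one h₃
  -- Applying ν to ∑ S(x₁)αx₂ = ε(x)α and cancelling ν(α), nonzero by the normalisation, shows that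
  -- ν ∘ S is a left convolution inverse of ν.
  have hψ : ∀ x, ψ (Δ x) = ε x := fun x => by
    have h₁ := congrArg ν (antipode_left (k := k) x)
    have h₂ := linearMap_congr₂ (f := ν.toLinearMap ∘ₗ sAlpha S αₕ)
      (g := ν αₕ • ψ.toLinearMap) (fun a b => by
        change ν (S a * αₕ * b) = ν αₕ * (ν (S a) * ν b)
        rw [map_mul, map_mul]; ring) (Δ x)
    have h₃ : ν αₕ * ψ (Δ x) = ν αₕ * ε x := by
      refine h₂.symm.trans (h₁.trans ?_)
      rw [map_smul, smul_eq_mul, mul_comm]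
    exact mul_left_cancel₀ hα h₃
  refine AlgHom.ext fun x => ?_
  have h₁ : Ψ (face₂ k H (Δ x)) = χ x := by
    have := linearMap_congr₂ (f := Ψ.toLinearMap ∘ₗ (face₂ k H).toLinearMap)
      (g := χ.toLinearMap ∘ₗ contractRight₂ counit.toLinearMap) (fun a b => by
        change χ a * ψ (Δ b) = χ (ε b • a)
        rw [hψ, map_smul, smul_eq_mul, mul_comm]) (Δ x)
    refine this.trans ?_
    simp [contractRight_comul]
  have h₂ : Ψ (face₁ k H (Δ x)) = ν x := by
    have := linearMap_congr₂ (f := Ψ.toLinearMap ∘ₗ (face₁ k H).toLinearMap)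
      (g := ν.toLinearMap ∘ₗ contractLeft₂ counit.toLinearMap) (fun a b => by
        simp only [LinearMap.comp_apply, AlgHom.toLinearMap_apply, face₁_tmul,
          contractLeft₂_tmul, map_smul, ← h a, map_mul]
        have h₃ := linearMap_congr₂ (f := Ψ.toLinearMap ∘ₗ (face₃ k H).toLinearMap)
          (g := LinearMap.mul' k k ∘ₗ
            TensorProduct.map χ.toLinearMap (ν.toLinearMap ∘ₗ S)) (fun u v => by simp [hΨ]) (Δ a)
        have h₄ : Ψ (face₃ k H (Δ a)) = (LinearMap.mul' k k ∘ₗ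
            TensorProduct.map χ.toLinearMap (ν.toLinearMap ∘ₗ S)) (Δ a) := h₃
        rw [h₄, hΨ]; simp [antipode_unit]) (Δ x)
    refine this.trans ?_
    simp [contractLeft_comul]
  -- Convolution of characters is associative up to the value of Φ, which is an invertible scalar
  -- and cancels.
  have h₃ : Ψ Φ * Ψ Φ⁻ = 1 := map_Phi_mul Ψ
  have h₄ := congrArg (fun t => Ψ t * Ψ Φ⁻) (coassoc (k := k) x)
  simp only [map_mul, h₁, h₂, mul_assoc, h₃, mul_one] at h₄
  rw [h₄, mul_comm (ν x), ← mul_assoc, h₃, one_mul]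

/-- The distinguished grouplike element governs the left action on cointegrals. -/
theorem projection_dualLeft {μ : Module.Dual k H} (hμ : IsDistinguishedGrouplike μ)
    {l₀ : Module.Dual k H} (h₀ : cointegralProjection k H l₀ = l₀)
    (hspan : ∀ l, cointegralProjection k H l = l → ∃ c : k, l = c • l₀)
    (hbij : Function.Bijective (dualRight k H l₀)) :
    ∃ ν : H →ₐ[k] k, ν.toLinearMap = μ ∧
      ∀ h, cointegralProjection k H (dualLeft k H h l₀) = ν h • l₀ := by
  obtain ⟨r, hr, hlr⟩ := exists_left_integral hbij
  have hr₁ : l₀ r = 1 := by simpa using hlr 1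
  have hrμ := hμ r hr
  -- Multiplicativity of μ follows from its definition at the single integral r, normalised by l₀(r)
  -- = 1.
  let ν : H →ₐ[k] k := AlgHom.ofLinearMap μ
    (by
      have := congrArg l₀ (hrμ 1)
      rwa [mul_one, map_smul, hr₁, smul_eq_mul, mul_one, eq_comm] at this)
    (fun a b => by
      have := congrArg l₀ (hrμ (a * b))
      rw [← mul_assoc, hrμ, smul_mul_assoc, hrμ] at this
      simp only [map_smul, hr₁, smul_eq_mul, mul_one] at this
      exact this.symm)
  have hχ : ∀ h, cointegralProjection k H (dualLeft k H h l₀) =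
      cointegralProjection k H (dualLeft k H h l₀) r • l₀ := fun h => by
    obtain ⟨c, hc⟩ := hspan _ (projection_projection (dualLeft k H h l₀))
    rw [hc]; simp [hr₁]
  let χ : H →ₐ[k] k := AlgHom.ofLinearMap
    (LinearMap.applyₗ r ∘ₗ cointegralProjection k H ∘ₗ (dualLeft k H).flip l₀)
    (by
      change cointegralProjection k H (dualLeft k H 1 l₀) r = 1
      rw [isHopfBimodule_dual.one_left, h₀, hr₁])
    (fun a b => by
      change cointegralProjection k H (dualLeft k H (a * b) l₀) r =
        cointegralProjection k H (dualLeft k H a l₀) r * cointegralProjection k H (dualLeft k H b l₀) r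
      rw [isHopfBimodule_dual.mul_left, ← isHopfBimodule_dual.projection_left_projection, hχ b,
        map_smul, map_smul, LinearMap.smul_apply, smul_eq_mul, LinearMap.smul_apply, hr₁, smul_eq_mul, mul_one, mul_comm])
  -- Evaluate x·l₀ = ∑ χ(x₁) l₀·x₂ at r. The left side is ε(S⁻¹(x)) = ε(x), the right side ∑ χ(x₁)
  -- l₀(rS(x₂)) = ∑ χ(x₁) μ(S(x₂)).
  have hχν : χ = ν := by
    refine character_eq fun x => ?_
    have h₁ := DFunLike.congr_fun (isHopfBimodule_dual.left_eq_of_coinvariant h₀ x) r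
    have h₂ : dualLeft k H x l₀ r = ε x := by
      change l₀ (S⁻ x * r) = ε x
      rw [hlr, counit_antipodeInv]
    rw [← h₂, h₁]
    refine linearMap_congr₂ (g := LinearMap.applyₗ r ∘ₗ
      lin₂ (k := k) fun a b => dualRight k H (cointegralProjection k H (dualLeft k H a l₀)) b)
      (fun a b => ?_) (Δ x)
    change χ a * μ (S b) = dualRight k H (cointegralProjection k H (dualLeft k H a l₀)) b r
    rw [hχ a]
    change χ a * μ (S b) = χ a * l₀ (r * S b)
    rw [hrμ, map_smul, hr₁, smul_eq_mul, mul_one]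
  refine ⟨ν, rfl, fun h => ?_⟩
  rw [← hχν]
  exact hχ h

end Cointegrals

/-! ### Cointegrals and the identity in terms of U -/

section CointegralIdentity

variable [FiniteDimensional k H]

/-- `Δ(q¹) p_R (1 ⊗ S(q²)) = 1` for `q_R = q¹ ⊗ q²`. -/
theorem comul_qR_pR : (lin₂ (k := k) fun a b => Δ a * pR k H * (1 ⊗ₜ[k] S b)) (qR k H) = 1 := by
  rw [← comul_pR_Phi, qR]
  refine linearMap_congr₃ (f := (lin₂ (k := k) fun a b => Δ a * pR k H * (1 ⊗ₜ[k] S b)) ∘ₗ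
    TensorProduct.map LinearMap.id
      (LinearMap.mul' k H ∘ₗ TensorProduct.map (S⁻ ∘ₗ LinearMap.mulLeft k (α k)) LinearMap.id ∘ₗ
        (TensorProduct.comm k H H).toLinearMap)) (fun a b c => ?_) Φ
  simp [antipode_anti, mul_assoc]

/-- `S⁻¹(f²) ⊗ S⁻¹(f¹) = (q² ⊗ 1) V Δ(S⁻¹(q¹))`. -/
theorem antipodeInvFlip_twistF : AIF (twistF k H) =
    (lin₂ (k := k) fun a b => (b ⊗ₜ[k] 1) * V k H * Δ (S⁻ a)) (qR k H) := by
  have h₁ : AIF (twistF k H) = AIF (twistF k H *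
      (lin₂ (k := k) fun a b => Δ a * pR k H * (1 ⊗ₜ[k] S b)) (qR k H)) := by
    rw [comul_qR_pR, mul_one]
  rw [h₁]
  refine linearMap_congr₂ (f := AIF ∘ₗ LinearMap.mulLeft k (twistF k H) ∘ₗ
    lin₂ (k := k) fun a b => Δ a * pR k H * (1 ⊗ₜ[k] S b)) (fun a b => ?_) (qR k H)
  simp only [LinearMap.comp_apply, LinearMap.mulLeft_apply, lin₂_tmul]
  rw [mul_assoc (b ⊗ₜ[k] 1), V_mul_comul_antipodeInv, ← mul_assoc, ← mul_assoc, antipodeInvFlip_mul]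
  simp [antipodeInv_unit]

theorem qx_eq : qx k H = face₁ k H (qR k H) * Φ⁻ := rfl

variable {ν : H →ₐ[k] k} {l : Module.Dual k H}

/-- In h·l = ∑ E(h₁·l)·h₂ the projected factors are scalars ν(h₁) times l, so the left action on a
cointegral is a right action twisted by ν. -/
theorem dualLeft_eq_of_cointegral (hl : cointegralProjection k H l = l)
    (hν : ∀ h, cointegralProjection k H (dualLeft k H h l) = ν h • l)
    (h : H) : dualLeft k H h l =
      (dualRight k H l) (contractLeft₂ ν.toLinearMap (Δ h)) := by
  rw [isHopfBimodule_dual.left_eq_of_coinvariant hl h]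
  refine linearMap_congr₂ (g := dualRight k H l ∘ₗ contractLeft₂ ν.toLinearMap) (fun a b => ?_) _
  simp only [lin₂_tmul, hν, map_smul, LinearMap.smul_apply, LinearMap.comp_apply,
    contractLeft₂_tmul, AlgHom.toLinearMap_apply]

theorem contractRight_of_cointegral (hl : cointegralProjection k H l = l)
    (hν : ∀ h, cointegralProjection k H (dualLeft k H h l) = ν h • l)
    (a : H) : contractRight₂ l (V k H * Δ a * U k H) =
      contractLeft₃ ν.toLinearMap (l ∘ₗ LinearMap.mulLeft k a ∘ₗ S) Φ⁻ := by
  rw [← dualTensorHom_dualCoaction, isHopfBimodule_dual.coact_eq_of_coinvariant hl]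
  refine linearMap_congr₃ (f := LinearMap.applyₗ a ∘ₗ dualTensorHom k H H ∘ₗ
    lin₃ (k := k) fun a b c =>
      dualRight k H (cointegralProjection k H (dualLeft k H a l)) b ⊗ₜ[k] c) (fun x y z => ?_) Φ⁻
  simp only [LinearMap.comp_apply, lin₃_tmul, hν, map_smul, LinearMap.smul_apply]
  simp [dualRight, mul_smul]

/-- Cointegrals satisfy the defining identity in terms of `U`. -/
theorem uIdentity_of_cointegral (hl : cointegralProjection k H l = l)
    (hν : ∀ h, cointegralProjection k H (dualLeft k H h l) = ν h • l)
    (h : H) : uIdentityLeft l h = uIdentityRight ν.toLinearMap l h := by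
  rw [uIdentityLeft, uIdentityRight, qx_eq, antipodeInvFlip_twistF]
  refine linearMap_congr₂ (f := contractRight₂ l ∘ₗ LinearMap.mulRight k (U k H) ∘ₗ
    LinearMap.mulRight k (Δ h) ∘ₗ lin₂ (k := k) fun a b => (b ⊗ₜ[k] 1) * V k H * Δ (S⁻ a))
    (g := contractLeft₃ ν.toLinearMap (l ∘ₗ LinearMap.mulLeft k h ∘ₗ S) ∘ₗ
      LinearMap.mulRight k Φ⁻ ∘ₗ (face₁ k H).toLinearMap) (fun a b => ?_) (qR k H)
  have h₂ : ∀ t, contractRight₂ l ((b ⊗ₜ[k] (1 : H)) * t) = b * contractRight₂ l t := fun t => by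
    refine linearMap_congr₂ (f := contractRight₂ l ∘ₗ LinearMap.mulLeft k (b ⊗ₜ[k] (1 : H)))
      (g := LinearMap.mulLeft k b ∘ₗ contractRight₂ l) (fun u v => by simp) t
  -- This exhibits the coaction on l evaluated at S⁻¹(q¹)h, with a and b in the roles of q¹ and q².
  have h₃ : (b ⊗ₜ[k] (1 : H)) * V k H * Δ (S⁻ a) * Δ h * U k H =
      (b ⊗ₜ[k] (1 : H)) * (V k H * Δ (S⁻ a * h) * U k H) := by
    simp only [map_mul, mul_assoc]
  simp only [LinearMap.comp_apply, lin₂_tmul, LinearMap.mulRight_apply, AlgHom.toLinearMap_apply]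
  rw [h₃, h₂, contractRight_of_cointegral hl hν]
  refine linearMap_congr₃ (f := LinearMap.mulLeft k b ∘ₗ
      contractLeft₃ ν.toLinearMap (l ∘ₗ LinearMap.mulLeft k (S⁻ a * h) ∘ₗ S))
    (g := contractLeft₃ ν.toLinearMap (l ∘ₗ LinearMap.mulLeft k h ∘ₗ S) ∘ₗ
      LinearMap.mulLeft k (face₁ k H (a ⊗ₜ[k] b))) (fun x y z => ?_) Φ⁻
  -- The factor S⁻¹(a) is a left action on l, traded for a right action; this produces ν(q¹₁) and
  -- S(q¹₂).
  have h₄ : l (S⁻ a * h * S y) = (dualRight k H l)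
      (contractLeft₂ ν.toLinearMap (Δ a)) (h * S y) := by
    rw [← dualLeft_eq_of_cointegral hl hν, mul_assoc]; rfl
  simp only [LinearMap.comp_apply, LinearMap.mulLeft_apply, contractLeft₃_tmul, h₄, face₁_tmul]
  refine linearMap_congr₂ (f := LinearMap.mulLeft k b ∘ₗ LinearMap.lsmul k H (ν.toLinearMap x) ∘ₗ
      LinearMap.toSpanSingleton k H z ∘ₗ LinearMap.applyₗ (h * S y) ∘ₗ dualRight k H l ∘ₗ
      contractLeft₂ ν.toLinearMap)
    (g := contractLeft₃ ν.toLinearMap (l ∘ₗ LinearMap.mulLeft k h ∘ₗ S) ∘ₗ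
      LinearMap.mulRight k (x ⊗ₜ[k] (y ⊗ₜ[k] z)) ∘ₗ LinearMap.mulRight k (1 ⊗ₜ[k] (1 ⊗ₜ[k] b)) ∘ₗ
        (face₃ k H).toLinearMap) (fun u v => ?_) (Δ a)
  simp [dualRight, antipode_anti, mul_assoc, mul_smul]
  rw [smul_comm (l _) (ν x)]

/-- `μ(q¹₁ x¹) q¹₂ x² ⊗ q² x³`. -/
def modulusElement (μ : Module.Dual k H) : H² :=
  TensorProduct.lid k H² (TensorProduct.map μ LinearMap.id (qx k H))

theorem uIdentityRight_eq (μ l : Module.Dual k H) (h : H) : uIdentityRight μ l h =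
    contractLeft₂ (l ∘ₗ LinearMap.mulLeft k h ∘ₗ S) (modulusElement μ) :=
  linearMap_congr₃ (f := contractLeft₃ μ (l ∘ₗ LinearMap.mulLeft k h ∘ₗ S))
    (g := contractLeft₂ (l ∘ₗ LinearMap.mulLeft k h ∘ₗ S) ∘ₗ
      (TensorProduct.lid k H²).toLinearMap ∘ₗ TensorProduct.map μ LinearMap.id)
    (fun a b c => by simp) (qx k H)

/-- Contracting the last two legs of (Δ ⊗ id)(q_R)Φ⁻¹ by b ⊗ c ↦ bβS(c) gives Δ(q¹) p_R (1 ⊗ S(q²))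
= 1, whatever the character. -/
theorem betaS_modulusElement (ν : H →ₐ[k] k) :
    betaS S βₕ (modulusElement ν.toLinearMap) = 1 := by
  have h₁ : betaS S βₕ (modulusElement ν.toLinearMap) =
      contractLeft₂ ν.toLinearMap (pMap k H (qx k H)) :=
    linearMap_congr₃ (f := betaS S βₕ ∘ₗ
      (TensorProduct.lid k H²).toLinearMap ∘ₗ TensorProduct.map ν.toLinearMap LinearMap.id)
      (g := contractLeft₂ ν.toLinearMap ∘ₗ pMap k H) (fun a b c => by simp) (qx k H)
  have h₂ : pMap k H (qx k H) = 1 := by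
    rw [← comul_qR_pR, qx_eq]
    exact linearMap_congr₂ (f := pMap k H ∘ₗ LinearMap.mulRight k Φ⁻ ∘ₗ (face₁ k H).toLinearMap)
      (fun a b => by simp [pMap_face₁_mul, pR_eq]) (qR k H)
  rw [h₁, h₂, one_two]
  simp

theorem dualTensorHom_map_dualRight (l : Module.Dual k H) (t : H²) (a : H) :
    dualTensorHom k H H (TensorProduct.map (dualRight k H l) LinearMap.id t) a =
      contractLeft₂ (l ∘ₗ LinearMap.mulLeft k a ∘ₗ S) t :=
  linearMap_congr₂ (f := LinearMap.applyₗ a ∘ₗ dualTensorHom k H H ∘ₗ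
    TensorProduct.map (dualRight k H l) LinearMap.id) (fun u v => by simp [dualRight]) t

theorem contractLeft_injective {l₀ : Module.Dual k H}
    (hl₀ : Function.Bijective (dualRight k H l₀)) {s t : H²}
    (h : ∀ a, contractLeft₂ (l₀ ∘ₗ LinearMap.mulLeft k a ∘ₗ S) s =
      contractLeft₂ (l₀ ∘ₗ LinearMap.mulLeft k a ∘ₗ S) t) : s = t := by
  have hinj : Function.Injective (TensorProduct.map (dualRight k H l₀)
      (LinearMap.id : H →ₗ[k] H)) :=
    Module.Flat.rTensor_preserves_injective_linearMap _ hl₀.1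
  refine hinj (dual_tensor_ext fun a => ?_)
  rw [dualTensorHom_map_dualRight, dualTensorHom_map_dualRight, h]

theorem eq_smul_one_of_uIdentity {l₀ : Module.Dual k H}
    (hl₀ : Function.Bijective (dualRight k H l₀))
    (h₀ : ∀ h, uIdentityLeft l₀ h = uIdentityRight ν.toLinearMap l₀ h) (y : H)
    (h : ∀ h, uIdentityLeft (dualRight k H l₀ y) h =
      uIdentityRight ν.toLinearMap (dualRight k H l₀ y) h) : y = ε y • 1 := by
  -- For l₀·y the left side of the identity contains U(1 ⊗ S(y)); moving S(y) through U reduces it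
  -- to the identity for l₀. The nondegeneracy of l₀ then strips the functional off.
  have key : modulusElement ν.toLinearMap * Δ y = (y ⊗ₜ[k] 1) * modulusElement ν.toLinearMap := by
    refine contractLeft_injective hl₀ fun a => ?_
    have h₁ : contractLeft₂ (l₀ ∘ₗ LinearMap.mulLeft k a ∘ₗ S)
        ((y ⊗ₜ[k] 1) * modulusElement ν.toLinearMap) =
        uIdentityRight ν.toLinearMap (dualRight k H l₀ y) a := by
      rw [uIdentityRight_eq]
      refine linearMap_congr₂ (f := contractLeft₂ (l₀ ∘ₗ LinearMap.mulLeft k a ∘ₗ S) ∘ₗ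
        LinearMap.mulLeft k (y ⊗ₜ[k] (1 : H))) (fun u v => ?_) _
      simp [dualRight, antipode_anti, mul_assoc]
    have h₂ : uIdentityLeft (dualRight k H l₀ y) a =
        contractRight₂ l₀ (AIF (twistF k H) * Δ a * (U k H * (1 ⊗ₜ[k] S y))) := by
      rw [← mul_assoc]
      refine linearMap_congr₂ (f := contractRight₂ (dualRight k H l₀ y))
        (g := contractRight₂ l₀ ∘ₗ LinearMap.mulRight k (1 ⊗ₜ[k] S y)) (fun u v => ?_) _
      simp [dualRight]
    rw [h₁, ← h, h₂, U_mul_antipode]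
    refine linearMap_congr₂ (f := contractLeft₂ (l₀ ∘ₗ LinearMap.mulLeft k a ∘ₗ S) ∘ₗ
        LinearMap.mulLeft k (modulusElement ν.toLinearMap))
      (g := contractRight₂ l₀ ∘ₗ LinearMap.mulLeft k (AIF (twistF k H) * Δ a) ∘ₗ
        lin₂ (k := k) fun a b => Δ (S a) * U k H * (b ⊗ₜ[k] 1)) (fun u v => ?_) (Δ y)
    have h₃ : ∀ t, contractRight₂ l₀ (t * (v ⊗ₜ[k] (1 : H))) = contractRight₂ l₀ t * v := fun t =>
      linearMap_congr₂ (f := contractRight₂ l₀ ∘ₗ LinearMap.mulRight k (v ⊗ₜ[k] (1 : H)))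
        (g := LinearMap.mulRight k v ∘ₗ contractRight₂ l₀) (fun u v => by simp) t
    have h₄ : contractRight₂ l₀ (AIF (twistF k H) * Δ a * (Δ (S u) * U k H * (v ⊗ₜ[k] 1))) =
        uIdentityLeft l₀ (a * S u) * v := by
      rw [uIdentityLeft, ← h₃]
      simp only [map_mul, mul_assoc]
    simp only [LinearMap.comp_apply, LinearMap.mulLeft_apply, lin₂_tmul]
    rw [h₄, h₀, uIdentityRight_eq]
    refine linearMap_congr₂ (f := contractLeft₂ (l₀ ∘ₗ LinearMap.mulLeft k a ∘ₗ S) ∘ₗ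
        LinearMap.mulRight k (u ⊗ₜ[k] v))
      (g := LinearMap.mulRight k v ∘ₗ contractLeft₂ (l₀ ∘ₗ LinearMap.mulLeft k (a * S u) ∘ₗ S))
      (fun b c => ?_) _
    simp [antipode_anti]
  -- Under a ⊗ b ↦ aβS(b) the right factor Δ(y) contributes ε(y), the left factor contributes y, and
  -- the modulus element contributes 1.
  have h₁ := congrArg (betaS S βₕ) key
  have h₂ : ∀ t, betaS S βₕ (t * Δ y) = ε y • betaS S βₕ t := fun t => by
    refine linearMap_congr₂ (f := betaS S βₕ ∘ₗ LinearMap.mulRight k (Δ y))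
      (g := ε y • betaS S βₕ) (fun a b => ?_) t
    have h₃ : ∀ s, betaS S βₕ ((a ⊗ₜ[k] b) * s) = a * betaS S βₕ s * S b := fun s =>
      linearMap_congr₂ (f := betaS S βₕ ∘ₗ LinearMap.mulLeft k (a ⊗ₜ[k] b))
        (g := LinearMap.mulRight k (S b) ∘ₗ LinearMap.mulLeft k a ∘ₗ betaS S βₕ)
        (fun u v => by simp [antipode_anti, mul_assoc]) s
    simp [h₃, antipode_right]
  have h₃ : ∀ t, betaS S βₕ ((y ⊗ₜ[k] 1) * t) = y * betaS S βₕ t := fun t =>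
    linearMap_congr₂ (f := betaS S βₕ ∘ₗ LinearMap.mulLeft k (y ⊗ₜ[k] (1 : H)))
      (g := LinearMap.mulLeft k y ∘ₗ betaS S βₕ) (fun u v => by simp [mul_assoc]) t
  rw [h₂, h₃, betaS_modulusElement, mul_one] at h₁
  exact h₁.symm

/-- An element of `H*` is a left cointegral if and only if it satisfies the identity
in terms of `U`. -/
theorem isLeftCointegral_iff_uIdentity {μ : Module.Dual k H} (hμ : IsDistinguishedGrouplike μ)
    (l : Module.Dual k H) :
    IsLeftCointegral l ↔ ∀ h, uIdentityLeft l h = uIdentityRight μ l h := by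
  obtain ⟨l₀, h₀, hspan, hbij⟩ := exists_cointegral_generator (k := k) (H := H)
  obtain ⟨ν, rfl, hν⟩ := projection_dualLeft hμ h₀ hspan hbij
  constructor
  · intro hl
    obtain ⟨c, rfl⟩ := hspan l hl
    refine uIdentity_of_cointegral hl fun h => ?_
    rw [map_smul, map_smul, hν, smul_comm]
  · intro h
    obtain ⟨y, rfl⟩ := hbij.2 l
    have hy := eq_smul_one_of_uIdentity hbij (uIdentity_of_cointegral h₀ hν) y h
    change cointegralProjection k H _ = _
    rw [hy, map_smul, isHopfBimodule_dual.one_right, map_smul, h₀]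

end CointegralIdentity

/-! ### The identity in terms of the twist -/

section TwistedIdentity

variable [FiniteDimensional k H]

variable (k H) in
/-- `a ⊗ b ⊗ c ↦ b S⁻¹(a β) ⊗ c`. -/
def pLMap : H³ →ₗ[k] H² := lin₃ fun a b c => (b * S⁻ (a * βₕ)) ⊗ₜ[k] c

variable (k H) in
/-- `p_L = X² S⁻¹(X¹ β) ⊗ X³`. -/
def pL : H² := pLMap k H Φ

@[simp] theorem pLMap_tmul (a b c : H) :
    pLMap k H (a ⊗ₜ[k] (b ⊗ₜ[k] c)) = (b * S⁻ (a * βₕ)) ⊗ₜ[k] c := rfl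

/-- Here the first two legs occur in reversed order as bS⁻¹(aβ); applying S⁻¹ to ∑ u β S(v) is what
makes the absorption work. -/
theorem pLMap_invRight : InvRight (face₃ k H) (pLMap k H) :=
  invRight_three _ _ (fun a b c y => (b * S⁻ y * S⁻ a) ⊗ₜ[k] c)
    (by intros; simp [antipodeInv_anti, mul_assoc])

theorem antipodeFlip_pL : AF (pL k H) = antipodePL k H :=
  linearMap_congr₃ (f := AF ∘ₗ pLMap k H)
    (g := lin₃ (k := k) fun a b c => S c ⊗ₜ[k] (a * βₕ * S b)) (fun a b c => by simp [antipode_anti]) Φ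

variable (k) in
/-- `a ⊗ b ↦ Δ(b) t (S⁻¹(a) ⊗ 1)`. -/
def innerSandwich (t : H²) : H² →ₗ[k] H² := lin₂ fun a b => Δ b * t * (S⁻ a ⊗ₜ[k] 1)

variable (k) in
/-- `a ⊗ b ↦ (1 ⊗ S⁻¹(b)) t Δ(a)`. -/
def outerSandwich (t : H²) : H² →ₗ[k] H² := lin₂ fun a b => (1 ⊗ₜ[k] S⁻ b) * t * Δ a

@[simp] theorem innerSandwich_tmul (t : H²) (a b : H) :
    innerSandwich k t (a ⊗ₜ[k] b) = Δ b * t * (S⁻ a ⊗ₜ[k] 1) := rfl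

@[simp] theorem outerSandwich_tmul (t : H²) (a b : H) :
    outerSandwich k t (a ⊗ₜ[k] b) = (1 ⊗ₜ[k] S⁻ b) * t * Δ a := rfl

theorem innerSandwich_mul (t x y : H²) :
    innerSandwich k t (x * y) = innerSandwich k (innerSandwich k t y) x := by
  refine linearMap_congr₂ (f := innerSandwich k t ∘ₗ LinearMap.mulRight k y)
    (g := innerSandwich k (innerSandwich k t y)) (fun a b => ?_) x
  refine linearMap_congr₂ (f := innerSandwich k t ∘ₗ LinearMap.mulLeft k (a ⊗ₜ[k] b))
    (g := LinearMap.mulRight k (S⁻ a ⊗ₜ[k] 1) ∘ₗ LinearMap.mulLeft k (Δ b) ∘ₗ innerSandwich k t)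
    (fun c d => ?_) y
  simp [antipodeInv_anti, mul_assoc]

theorem outerSandwich_mul (t x y : H²) :
    outerSandwich k t (x * y) = outerSandwich k (outerSandwich k t x) y := by
  refine linearMap_congr₂ (f := outerSandwich k t ∘ₗ LinearMap.mulLeft k x)
    (g := outerSandwich k (outerSandwich k t x)) (fun a b => ?_) y
  refine linearMap_congr₂ (f := outerSandwich k t ∘ₗ LinearMap.mulRight k (a ⊗ₜ[k] b))
    (g := LinearMap.mulRight k (Δ a) ∘ₗ LinearMap.mulLeft k (1 ⊗ₜ[k] S⁻ b) ∘ₗ outerSandwich k t)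
    (fun c d => ?_) x
  simp [antipodeInv_anti, ← mul_assoc]

theorem innerSandwich_mul_tmul (t x : H²) (b : H) :
    innerSandwich k (t * (1 ⊗ₜ[k] b)) x = innerSandwich k t x * (1 ⊗ₜ[k] b) := by
  refine linearMap_congr₂ (f := innerSandwich k (t * (1 ⊗ₜ[k] b)))
    (g := LinearMap.mulRight k (1 ⊗ₜ[k] b) ∘ₗ innerSandwich k t) (fun c d => ?_) x
  simp [mul_assoc]

theorem outerSandwich_tmul_mul (t x : H²) (a : H) :
    outerSandwich k ((a ⊗ₜ[k] 1) * t) x = (a ⊗ₜ[k] 1) * outerSandwich k t x := by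
  refine linearMap_congr₂ (f := outerSandwich k ((a ⊗ₜ[k] 1) * t))
    (g := LinearMap.mulLeft k (a ⊗ₜ[k] 1) ∘ₗ outerSandwich k t) (fun c d => ?_) x
  simp [← mul_assoc]

theorem pLMap_face₂_mul (s : H²) (t : H³) :
    pLMap k H (face₂ k H s * t) = innerSandwich k (pLMap k H t) s := by
  refine linearMap_congr₂ (f := pLMap k H ∘ₗ LinearMap.mulRight k t ∘ₗ (face₂ k H).toLinearMap)
    (g := innerSandwich k (pLMap k H t)) (fun a b => ?_) s
  simp only [LinearMap.comp_apply, LinearMap.mulRight_apply, AlgHom.toLinearMap_apply, face₂_tmul,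
    innerSandwich_tmul]
  refine linearMap_congr₂ (f := pLMap k H ∘ₗ LinearMap.mulRight k t ∘ₗ TensorProduct.mk k H H² a)
    (g := LinearMap.mulRight k (S⁻ a ⊗ₜ[k] 1) ∘ₗ LinearMap.mulRight k (pLMap k H t))
    (fun x y => ?_) (Δ b)
  refine linearMap_congr₃ (f := pLMap k H ∘ₗ LinearMap.mulLeft k _)
    (g := LinearMap.mulRight k (S⁻ a ⊗ₜ[k] 1) ∘ₗ LinearMap.mulLeft k (x ⊗ₜ[k] y) ∘ₗ pLMap k H)
    (fun u v w => ?_) t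
  simp [antipodeInv_anti, mul_assoc]

/-- `Δ(b₂) p_L (S⁻¹(b₁) ⊗ 1) = p_L (1 ⊗ b)`. -/
theorem innerSandwich_pL_comul (b : H) :
    innerSandwich k (pL k H) (Δ b) = pL k H * (1 ⊗ₜ[k] b) := by
  rw [pL, ← pLMap_face₂_mul, coassoc, pLMap_invRight.mul_face₁]
  refine linearMap_congr₃ (f := pLMap k H ∘ₗ LinearMap.mulRight k (1 ⊗ₜ[k] (1 ⊗ₜ[k] b)))
    (g := LinearMap.mulRight k (1 ⊗ₜ[k] b) ∘ₗ pLMap k H) (fun x y z => ?_) Φ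
  simp

/-- `Δ(q²) p_L (S⁻¹(q¹) ⊗ 1) = 1` for `q_L = q¹ ⊗ q²`. -/
theorem innerSandwich_pL_qL : innerSandwich k (pL k H) (qL k H) = 1 := by
  let F : H⁴ →ₗ[k] H² := lin₄ fun a b c d => (c * S⁻ (αₕ * b * βₕ) * a) ⊗ₜ[k] d
  have hL : InvLeft (leg₁₂ k H) F :=
    invLeft_four _ _ (fun a b c d y => (c * S⁻ (y * b * βₕ) * a) ⊗ₜ[k] d)
      (by intros; simp [F, antipodeInv_anti, mul_assoc])
  have hR : InvRight (leg₂₃ k H) F :=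
    invRight_four _ _ (fun a b c d y => (c * S⁻ (αₕ * b * y) * a) ⊗ₜ[k] d)
      (by intros; simp [F, antipodeInv_anti, mul_assoc])
  -- A further form of the pentagon: its outer factors are absorbed by the α and β inside S⁻¹,
  -- leaving Φ⁻¹ ⊗ 1.
  have hP : cell₃ k H Φ⁻ * cell₀ k H Φ = cell₁ k H Φ * cell₄ k H Φ⁻ * cell₂ k H Φ⁻ := by
    have h := pentagon (k := k) (H := H)
    calc _ = cell₃ k H Φ⁻ * (cell₀ k H Φ * (cell₂ k H Φ * (cell₄ k H Φ * cell₄ k H Φ⁻) *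
          cell₂ k H Φ⁻)) := by
          rw [map_Phi_mul, mul_one, map_Phi_mul, mul_one]
      _ = cell₃ k H Φ⁻ * (cell₀ k H Φ * cell₂ k H Φ * cell₄ k H Φ) * cell₄ k H Φ⁻ *
          cell₂ k H Φ⁻ := by simp only [mul_assoc]
      _ = _ := by rw [h, ← mul_assoc, map_PhiInv_mul, one_mul]
  have key : ∀ t : H³, innerSandwich k (pLMap k H t) (qL k H) =
      F (cell₃ k H Φ⁻ * cell₀ k H t) := fun t => by
    rw [qL]
    refine linearMap_congr₃ (f := innerSandwich k (pLMap k H t) ∘ₗ qLMap k H)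
      (g := F ∘ₗ LinearMap.mulRight k (cell₀ k H t) ∘ₗ (cell₃ k H).toLinearMap)
      (fun a b c => ?_) Φ⁻
    simp only [LinearMap.comp_apply, LinearMap.mulRight_apply, AlgHom.toLinearMap_apply,
      cell₃_tmul, qLMap_tmul, innerSandwich_tmul]
    refine linearMap_congr₂ (f := LinearMap.mulRight k (S⁻ (S a * αₕ * b) ⊗ₜ[k] 1) ∘ₗ
        LinearMap.mulRight k (pLMap k H t))
      (g := F ∘ₗ LinearMap.mulRight k (cell₀ k H t) ∘ₗ
        LinearMap.mulRight k (a ⊗ₜ[k] (b ⊗ₜ[k] (1 ⊗ₜ[k] 1))) ∘ₗ (leg₃₄ k H).toLinearMap)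
      (fun x y => ?_) (Δ c)
    refine linearMap_congr₃ (f := LinearMap.mulRight k (S⁻ (S a * αₕ * b) ⊗ₜ[k] 1) ∘ₗ
        LinearMap.mulLeft k (x ⊗ₜ[k] y) ∘ₗ pLMap k H)
      (g := F ∘ₗ LinearMap.mulLeft k (leg₃₄ k H (x ⊗ₜ[k] y) * a ⊗ₜ[k] (b ⊗ₜ[k] (1 ⊗ₜ[k] 1))) ∘ₗ
        (cell₀ k H).toLinearMap) (fun u v w => ?_) t
    simp [F, antipodeInv_anti, mul_assoc]
  rw [pL, key, hP, (hR.mul_cell₂ _).2, (hL.cell₁_mul _).1]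
  have h₁ := linearMap_congr₃ (f := F ∘ₗ (cell₄ k H).toLinearMap)
    (g := (TensorProduct.mk k H H).flip 1 ∘ₗ S⁻ ∘ₗ sAlphaBetaS S αₕ βₕ)
    (fun a b c => by simp [F, antipodeInv_anti, mul_assoc]) Φ⁻
  refine h₁.trans ?_
  simp [sAlphaBetaS_PhiInv, antipodeInv_unit, one_two]

/-- `Δ(γ²) p_L (S⁻¹(γ¹) ⊗ 1) = U (1 ⊗ α)`. -/
theorem innerSandwich_pL_gam :
    innerSandwich k (pL k H) (gam k H) = U k H * (1 ⊗ₜ[k] αₕ) := by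
  rw [U_mul_alpha, gam_eq_right]
  refine linearMap_congr₃ (f := innerSandwich k (pL k H) ∘ₗ
    lin₃ (k := k) fun a b c => (S b ⊗ₜ[k] (S a * αₕ)) * qL k H * Δ c) (fun a b c => ?_) Φ
  simp only [LinearMap.comp_apply, lin₃_tmul]
  rw [innerSandwich_mul, innerSandwich_pL_comul, innerSandwich_mul, innerSandwich_mul_tmul,
    innerSandwich_pL_qL]
  simp [mul_assoc]

/-- `Δ(g²) U (S⁻¹(g¹) ⊗ 1) = p_L`. -/
theorem innerSandwich_U_twistFInv : innerSandwich k (U k H) (twistFInv k H) = pL k H := by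
  have hU : ∀ h, U k H * (1 ⊗ₜ[k] S h) = innerSandwich k (U k H) (AF (Δ h)) := fun h => by
    rw [U_mul_antipode]
    exact linearMap_congr₂ (g := innerSandwich k (U k H) ∘ₗ AF) (fun a b => by simp) (Δ h)
  -- In the second leg both sides react alike to S(x), via the intertwining of f⁻¹, and agree after
  -- α because f⁻¹γ = Δ(α).
  refine eq_of_mul_antipode_mul_alpha
    (Algebra.TensorProduct.includeRight : H →ₐ[k] H²) fun x => ?_
  simp only [Algebra.TensorProduct.includeRight_apply]
  have h₁ : innerSandwich k (U k H) (twistFInv k H) * (1 ⊗ₜ[k] αₕ) = pL k H * (1 ⊗ₜ[k] αₕ) := by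
    rw [← innerSandwich_mul_tmul, ← innerSandwich_pL_gam, ← innerSandwich_mul, twistFInv_mul_gam,
      innerSandwich_pL_comul]
  rw [← innerSandwich_mul_tmul, hU, ← innerSandwich_mul, twistFInv_mul_antipodeFlip,
    innerSandwich_mul, ← innerSandwich_pL_comul, ← innerSandwich_mul_tmul, h₁,
    innerSandwich_mul_tmul]

/-- The relation of Q from `antipodeFlip_mul_antipodeQR`, carried back to q_R by the flip with S⁻¹.
-/
theorem outerSandwich_qR_comul (h : H) :
    outerSandwich k (qR k H) (Δ h) = (h ⊗ₜ[k] 1) * qR k H := by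
  have h₁ := congrArg AIF (antipodeFlip_mul_antipodeQR (k := k) h)
  have h₂ : AIF (antipodeQR k H * (1 ⊗ₜ[k] S h)) = (h ⊗ₜ[k] 1) * qR k H := by
    rw [antipodeInvFlip_mul, ← antipodeFlip_qR, antipodeInvFlip_antipodeFlip]
    simp [antipodeInv_unit]
  rw [← h₂, ← h₁]
  refine linearMap_congr₂ (f := outerSandwich k (qR k H)) (g := AIF ∘ₗ
    lin₂ (k := k) fun a b => AF (Δ a) * antipodeQR k H * (b ⊗ₜ[k] 1)) (fun a b => ?_) (Δ h)
  simp only [LinearMap.comp_apply, lin₂_tmul, outerSandwich_tmul]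
  rw [antipodeInvFlip_mul, antipodeInvFlip_mul, ← antipodeFlip_qR, antipodeInvFlip_antipodeFlip,
    antipodeInvFlip_antipodeFlip]
  simp [antipodeInv_unit, mul_assoc]

theorem outerSandwich_qR_pR : outerSandwich k (qR k H) (pR k H) = 1 := by
  have h₁ := congrArg AIF (antipodeFlip_antipodeQR_pR (k := k) (H := H))
  rw [antipodeInvFlip_one] at h₁
  rw [← h₁]
  refine linearMap_congr₂ (f := outerSandwich k (qR k H)) (g := AIF ∘ₗ
    lin₂ (k := k) fun a b => AF (Δ a) * antipodeQR k H * (b ⊗ₜ[k] 1)) (fun a b => ?_) (pR k H)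
  simp only [LinearMap.comp_apply, lin₂_tmul, outerSandwich_tmul]
  rw [antipodeInvFlip_mul, antipodeInvFlip_mul, ← antipodeFlip_qR, antipodeInvFlip_antipodeFlip,
    antipodeInvFlip_antipodeFlip]
  simp [antipodeInv_unit, mul_assoc]

/-- The formula of `del_eq_right` solved for the flipped p_L by inserting ΦΦ⁻¹ = 1. -/
theorem beta_mul_antipodePL : (βₕ ⊗ₜ[k] 1) * antipodePL k H =
    (lin₃ (k := k) fun a b c => (a ⊗ₜ[k] b) * del k H * AF (Δ c)) Φ := by
  let M : H³ →ₗ[k] H² := lin₃ fun a b c => ((a * βₕ) ⊗ₜ[k] b) * antipodePL k H * AF (Δ c)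
  have h : M (Φ * Φ⁻) = (βₕ ⊗ₜ[k] 1) * antipodePL k H := by
    rw [Phi_mul_PhiInv]
    simp [M, one_three, antipodeFlip_one]
  rw [← h, del_eq_right]
  refine linearMap_congr₃ (f := M ∘ₗ LinearMap.mulRight k Φ⁻) (fun a b c => ?_) Φ
  refine linearMap_congr₃ (f := M ∘ₗ LinearMap.mulLeft k (a ⊗ₜ[k] (b ⊗ₜ[k] c)))
    (g := LinearMap.mulRight k (AF (Δ c)) ∘ₗ LinearMap.mulLeft k (a ⊗ₜ[k] b) ∘ₗ M)
    (fun u v w => ?_) Φ⁻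
  simp [M, antipodeFlip_mul, ← mul_assoc]

/-- `(1 ⊗ S⁻¹(δ²)) q_R Δ(δ¹) = (β ⊗ 1) (S ⊗ S)(p_L)ᵒᵖ f`. -/
theorem outerSandwich_qR_del :
    outerSandwich k (qR k H) (del k H) = (βₕ ⊗ₜ[k] 1) * (antipodePL k H * twistF k H) := by
  have h₀ : outerSandwich k (qR k H) (del k H) =
      outerSandwich k (qR k H) (delMapLeft k H Φ) := by rw [← del_eq_left]
  rw [← mul_assoc, beta_mul_antipodePL, h₀]
  refine linearMap_congr₃ (f := outerSandwich k (qR k H) ∘ₗ delMapLeft k H)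
    (g := LinearMap.mulRight k (twistF k H) ∘ₗ
      lin₃ (k := k) fun a b c => (a ⊗ₜ[k] b) * del k H * AF (Δ c)) (fun a b c => ?_) Φ
  have h₁ : (a ⊗ₜ[k] b) * del k H * AF (Δ c) * twistF k H = (a ⊗ₜ[k] b) * Δ (βₕ * S c) := by
    rw [mul_assoc, ← twistF_mul_comul_antipode, mul_assoc, ← mul_assoc (del k H), del_mul_twistF,
      map_mul]
  simp only [LinearMap.comp_apply, lin₃_tmul, LinearMap.mulRight_apply, h₁]
  change outerSandwich k (qR k H) (Δ a * pR k H * ((βₕ * S c) ⊗ₜ[k] S b)) = _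
  rw [outerSandwich_mul, outerSandwich_mul, outerSandwich_qR_comul, outerSandwich_tmul_mul,
    outerSandwich_qR_pR]
  simp

/-- `(1 ⊗ S⁻¹(f²)) (S ⊗ S)(p_L)ᵒᵖ f Δ(f¹) = q_R`. -/
theorem outerSandwich_antipodePL_twistF :
    outerSandwich k (antipodePL k H * twistF k H) (twistF k H) = qR k H := by
  have hP : ∀ h, (h ⊗ₜ[k] 1) * (antipodePL k H * twistF k H) =
      outerSandwich k (antipodePL k H * twistF k H) (AF (Δ (S⁻ h))) := fun h => by
    have h₁ : (h ⊗ₜ[k] 1) * antipodePL k H = AF (pL k H * (1 ⊗ₜ[k] S⁻ h)) := by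
      rw [antipodeFlip_mul, antipodeFlip_pL]
      simp [antipode_unit]
    rw [← mul_assoc, h₁, ← innerSandwich_pL_comul]
    refine linearMap_congr₂ (f := LinearMap.mulRight k (twistF k H) ∘ₗ AF ∘ₗ
      innerSandwich k (pL k H)) (g := outerSandwich k (antipodePL k H * twistF k H) ∘ₗ AF)
      (fun a b => ?_) (Δ (S⁻ h))
    simp only [LinearMap.comp_apply, LinearMap.mulRight_apply, innerSandwich_tmul,
      antipodeFlip_mul, antipodeFlip_pL, antipodeFlip_tmul, outerSandwich_tmul,
      antipodeInv_antipode, antipode_antipodeInv, antipode_unit]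
    rw [mul_assoc, mul_assoc, ← twistF_mul_comul_antipode]
    simp only [mul_assoc]
  -- In the first leg both sides obey the same rule for left multiplication by x, and they agree
  -- after β because δf = Δ(β).
  refine eq_of_beta_mul (Algebra.TensorProduct.includeLeft : H →ₐ[k] H²) fun x => ?_
  simp only [Algebra.TensorProduct.includeLeft_apply]
  have h₁ : (βₕ ⊗ₜ[k] 1) * outerSandwich k (antipodePL k H * twistF k H) (twistF k H) =
      (βₕ ⊗ₜ[k] 1) * qR k H := by
    rw [← outerSandwich_tmul_mul, ← outerSandwich_qR_del, ← outerSandwich_mul, del_mul_twistF,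
      outerSandwich_qR_comul]
  have h₂ : (x ⊗ₜ[k] 1) * outerSandwich k (antipodePL k H * twistF k H) (twistF k H) =
      outerSandwich k (outerSandwich k (antipodePL k H * twistF k H) (twistF k H)) (Δ x) := by
    rw [← outerSandwich_tmul_mul, hP, ← outerSandwich_mul, antipodeFlip_comul_antipodeInv,
      outerSandwich_mul]
  rw [h₂, ← outerSandwich_qR_comul, ← outerSandwich_tmul_mul, h₁, outerSandwich_tmul_mul]

/-- The bridge between (b) and (c): the right factor of (b) is U surrounded by the legs of `fg`.
Both sides reduce to ∑ Δ(S⁻¹(f¹)) p_L (S⁻²(f²) ⊗ 1), the left one by expressing q_R through p_L and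
f, the right one by contracting U with f⁻¹. -/
theorem antipodeInvFlip_qR_mul_twistFInv : AIF (qR k H * twistFInv k H) =
    (lin₂ (k := k) fun w z => Δ w * U k H * (z ⊗ₜ[k] 1)) (fg k H) := by
  have h₁ : (lin₂ (k := k) fun w z => Δ w * U k H * (z ⊗ₜ[k] 1)) (fg k H) =
      (lin₂ (k := k) fun a b => Δ (S⁻ a) * innerSandwich k (U k H) (twistFInv k H) *
        (S⁻ (S⁻ b) ⊗ₜ[k] 1)) (twistF k H) := by
    rw [fg]
    refine linearMap_congr₂ (f := (lin₂ (k := k) fun w z => Δ w * U k H * (z ⊗ₜ[k] 1)) ∘ₗ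
      TensorProduct.map LinearMap.id S⁻ ∘ₗ
      LinearMap.mulRight k (TensorProduct.comm k H H (twistFInv k H)) ∘ₗ
      TensorProduct.map S⁻ S⁻) (fun a b => ?_) (twistF k H)
    refine linearMap_congr₂ (f := (lin₂ (k := k) fun w z => Δ w * U k H * (z ⊗ₜ[k] 1)) ∘ₗ
      TensorProduct.map LinearMap.id S⁻ ∘ₗ LinearMap.mulLeft k (S⁻ a ⊗ₜ[k] S⁻ b) ∘ₗ
      (TensorProduct.comm k H H).toLinearMap)
      (g := LinearMap.mulRight k (S⁻ (S⁻ b) ⊗ₜ[k] 1) ∘ₗ LinearMap.mulLeft k (Δ (S⁻ a)) ∘ₗ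
        innerSandwich k (U k H)) (fun c d => ?_) (twistFInv k H)
    simp [antipodeInv_anti, mul_assoc]
  rw [h₁, innerSandwich_U_twistFInv]
  conv_lhs => rw [← outerSandwich_antipodePL_twistF]
  refine linearMap_congr₂ (f := AIF ∘ₗ LinearMap.mulRight k (twistFInv k H) ∘ₗ
    outerSandwich k (antipodePL k H * twistF k H)) (fun a b => ?_) (twistF k H)
  have h₂ : antipodePL k H * twistF k H * Δ a * twistFInv k H = AF (Δ (S⁻ a) * pL k H) := by
    rw [mul_assoc (antipodePL k H), ← antipodeFlip_comul_antipodeInv, mul_assoc, mul_assoc,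
      twistF_mul_twistFInv, mul_one, antipodeFlip_mul, antipodeFlip_pL]
  simp only [LinearMap.comp_apply, LinearMap.mulRight_apply, outerSandwich_tmul, lin₂_tmul]
  rw [mul_assoc (1 ⊗ₜ[k] S⁻ b), mul_assoc (1 ⊗ₜ[k] S⁻ b), h₂, antipodeInvFlip_mul,
    antipodeInvFlip_antipodeFlip]
  simp [antipodeInv_unit]

theorem outerMul_assoc (x y z : H²) : outerMul (k := k) (outerMul (k := k) x y) z =
    outerMul (k := k) x (outerMul (k := k) y z) := by
  refine linearMap_congr₂ (f := (outerMul (k := k)).flip z ∘ₗ (outerMul (k := k)).flip y)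
    (g := (outerMul (k := k)).flip (outerMul (k := k) y z)) (fun a b => ?_) x
  refine linearMap_congr₂ (f := (outerMul (k := k)).flip z ∘ₗ outerMul (k := k) (a ⊗ₜ[k] b))
    (g := outerMul (k := k) (a ⊗ₜ[k] b) ∘ₗ (outerMul (k := k)).flip z) (fun c d => ?_) y
  refine linearMap_congr₂ (f := outerMul (k := k) (outerMul (k := k) (a ⊗ₜ[k] b) (c ⊗ₜ[k] d)))
    (g := outerMul (k := k) (a ⊗ₜ[k] b) ∘ₗ outerMul (k := k) (c ⊗ₜ[k] d)) (fun u v => ?_) z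
  simp [mul_assoc]

theorem one_outerMul (x : H²) : outerMul (k := k) 1 x = x :=
  linearMap_congr₂ (f := outerMul (k := k) (1 ⊗ₜ[k] 1)) (g := LinearMap.id) (fun a b => by simp) x

/-- `S⁻¹(f¹) g² ⊗ S⁻¹(S⁻¹(f²) g¹)` has a left inverse in `H ⊗ Hᵒᵖ`. -/
theorem exists_outerMul_fg : ∃ t : H², outerMul (k := k) t (fg k H) = 1 := by
  -- `outerMul` is the product of H ⊗ Hᵒᵖ. For it P reverses products and Q preserves them, and `fg`
  -- is P(f) times Q(f⁻¹), so Q(f) times P(f⁻¹) is a left inverse.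
  let P : H² →ₗ[k] H² := TensorProduct.map S⁻ (S⁻ ∘ₗ S⁻)
  let Q : H² →ₗ[k] H² := TensorProduct.map LinearMap.id S⁻ ∘ₗ (TensorProduct.comm k H H).toLinearMap
  have hP : ∀ x y, outerMul (k := k) (P x) (P y) = P (y * x) := fun x y => by
    refine linearMap_congr₂ (f := (outerMul (k := k)).flip (P y) ∘ₗ P)
      (g := P ∘ₗ LinearMap.mulLeft k y) (fun a b => ?_) x
    refine linearMap_congr₂ (f := outerMul (k := k) (P (a ⊗ₜ[k] b)) ∘ₗ P)
      (g := P ∘ₗ LinearMap.mulRight k (a ⊗ₜ[k] b)) (fun c d => ?_) y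
    simp [P, antipodeInv_anti]
  have hQ : ∀ x y, outerMul (k := k) (Q x) (Q y) = Q (x * y) := fun x y => by
    refine linearMap_congr₂ (f := (outerMul (k := k)).flip (Q y) ∘ₗ Q)
      (g := Q ∘ₗ LinearMap.mulRight k y) (fun a b => ?_) x
    refine linearMap_congr₂ (f := outerMul (k := k) (Q (a ⊗ₜ[k] b)) ∘ₗ Q)
      (g := Q ∘ₗ LinearMap.mulLeft k (a ⊗ₜ[k] b)) (fun c d => ?_) y
    simp [Q, antipodeInv_anti]
  have hfg : fg k H = outerMul (k := k) (P (twistF k H)) (Q (twistFInv k H)) := by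
    rw [fg]
    refine linearMap_congr₂ (f := TensorProduct.map LinearMap.id S⁻ ∘ₗ
      LinearMap.mulRight k (TensorProduct.comm k H H (twistFInv k H)) ∘ₗ TensorProduct.map S⁻ S⁻)
      (g := (outerMul (k := k)).flip (Q (twistFInv k H)) ∘ₗ P) (fun a b => ?_) (twistF k H)
    refine linearMap_congr₂ (f := TensorProduct.map LinearMap.id S⁻ ∘ₗ
      LinearMap.mulLeft k (S⁻ a ⊗ₜ[k] S⁻ b) ∘ₗ (TensorProduct.comm k H H).toLinearMap)
      (g := outerMul (k := k) (P (a ⊗ₜ[k] b)) ∘ₗ Q) (fun c d => ?_) (twistFInv k H)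
    simp [P, Q, antipodeInv_anti]
  refine ⟨outerMul (k := k) (Q (twistF k H)) (P (twistFInv k H)), ?_⟩
  rw [hfg, outerMul_assoc, ← outerMul_assoc (P _), hP, twistF_mul_twistFInv]
  have h₁ : P 1 = 1 := by simp [P, one_two, antipodeInv_unit]
  rw [h₁, one_outerMul, hQ, twistF_mul_twistFInv]
  simp [Q, one_two, antipodeInv_unit]

/-- `w ⊗ z ↦ F(h w) z`. -/
def rightTranslate (F : H →ₗ[k] H) (h : H) : H² →ₗ[k] H := lin₂ fun w z => F (h * w) * z

theorem rightTranslate_one (F : H →ₗ[k] H) (h : H) : rightTranslate F h 1 = F h := by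
  simp [rightTranslate, one_two]

theorem rightTranslate_outerMul (F : H →ₗ[k] H) (a x y : H) (t : H²) :
    rightTranslate F a (outerMul (k := k) (x ⊗ₜ[k] y) t) = rightTranslate F (a * x) t * y := by
  refine linearMap_congr₂ (f := rightTranslate F a ∘ₗ outerMul (k := k) (x ⊗ₜ[k] y))
    (g := LinearMap.mulRight k y ∘ₗ rightTranslate F (a * x)) (fun u v => ?_) t
  simp [rightTranslate, mul_assoc]

/-- Δ(h)Δ(w) = Δ(hw), and z comes out of the contraction on the right. The side of (c) enters as a
linear map F so that it can be translated by a tensor. -/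
theorem twistIdentityLeft_eq (l : Module.Dual k H) (F : H →ₗ[k] H)
    (hF : ∀ h, F h = uIdentityLeft l h) (h : H) :
    twistIdentityLeft l h = rightTranslate F h (fg k H) := by
  rw [twistIdentityLeft, antipodeInvFlip_qR_mul_twistFInv]
  refine linearMap_congr₂ (f := contractRight₂ l ∘ₗ
    LinearMap.mulLeft k (AIF (twistF k H) * Δ h) ∘ₗ
    lin₂ (k := k) fun w z => Δ w * U k H * (z ⊗ₜ[k] 1)) (g := rightTranslate F h) (fun w z => ?_) _
  have h₃ : ∀ t, contractRight₂ l (t * (z ⊗ₜ[k] (1 : H))) = contractRight₂ l t * z := fun t =>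
    linearMap_congr₂ (f := contractRight₂ l ∘ₗ LinearMap.mulRight k (z ⊗ₜ[k] (1 : H)))
      (g := LinearMap.mulRight k z ∘ₗ contractRight₂ l) (fun u v => by simp) t
  simp only [LinearMap.comp_apply, lin₂_tmul, LinearMap.mulLeft_apply, rightTranslate, hF,
    uIdentityLeft]
  rw [← h₃]
  simp only [map_mul, mul_assoc]

theorem twistIdentityRight_eq (μ l : Module.Dual k H) (F : H →ₗ[k] H)
    (hF : ∀ h, F h = uIdentityRight μ l h) (h : H) :
    twistIdentityRight μ l h = rightTranslate F h (fg k H) := by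
  refine linearMap_congr₂ (f := contractLeft₂ (l ∘ₗ LinearMap.mulLeft k h) ∘ₗ
    (outerMul (k := k)).flip (TensorProduct.map S LinearMap.id (modulusElement μ)))
    (g := rightTranslate F h) (fun w z => ?_) (fg k H)
  simp only [rightTranslate, lin₂_tmul, hF, uIdentityRight_eq]
  refine linearMap_congr₂ (f := contractLeft₂ (l ∘ₗ LinearMap.mulLeft k h) ∘ₗ
    outerMul (k := k) (w ⊗ₜ[k] z) ∘ₗ TensorProduct.map S LinearMap.id)
    (g := LinearMap.mulRight k z ∘ₗ contractLeft₂ (l ∘ₗ LinearMap.mulLeft k (h * w) ∘ₗ S))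
    (fun u v => ?_) (modulusElement μ)
  simp

theorem twistIdentity_iff_uIdentity (μ l : Module.Dual k H) :
    (∀ h, twistIdentityLeft l h = twistIdentityRight μ l h) ↔
      ∀ h, uIdentityLeft l h = uIdentityRight μ l h := by
  let F : H →ₗ[k] H := contractRight₂ l ∘ₗ LinearMap.mulRight k (U k H) ∘ₗ
    LinearMap.mulLeft k (AIF (twistF k H)) ∘ₗ (Δ).toLinearMap
  let G : H →ₗ[k] H := dualTensorHom k H H
    (TensorProduct.map (dualRight k H l) LinearMap.id (modulusElement μ))
  have hF : ∀ h, F h = uIdentityLeft l h := fun _ => rfl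
  have hG : ∀ h, G h = uIdentityRight μ l h := fun h => by
    rw [uIdentityRight_eq, ← dualTensorHom_map_dualRight]
  have hF' := twistIdentityLeft_eq l F hF
  have hG' := twistIdentityRight_eq μ l G hG
  simp only [hF', hG', ← hF, ← hG]
  constructor
  · intro h a
    -- The equality is known for translation by `fg` at every argument; translating once more by the
    -- left inverse t recovers F = G at a.
    obtain ⟨t, ht⟩ := exists_outerMul_fg (k := k) (H := H)
    rw [← rightTranslate_one F, ← rightTranslate_one G, ← ht]
    refine linearMap_congr₂ (f := rightTranslate F a ∘ₗ (outerMul (k := k)).flip (fg k H))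
      (g := rightTranslate G a ∘ₗ (outerMul (k := k)).flip (fg k H)) (fun x y => ?_) t
    simp only [LinearMap.comp_apply, LinearMap.flip_apply, rightTranslate_outerMul, h]
  · intro h a
    rw [LinearMap.ext h]

end TwistedIdentity

end QuasiHopfAlgebra

end

theorem proposition3p4 {k H : Type*} [Field k] [Ring H] [Algebra k H] [QuasiHopfAlgebra k H]
    [FiniteDimensional k H]
    (μ : Module.Dual k H) (hμ : QuasiHopfAlgebra.IsDistinguishedGrouplike μ)
    (l : Module.Dual k H) :
    Function.Bijective (QuasiHopfAlgebra.antipode : H →ₗ[k] H) ∧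
    List.TFAE [
      QuasiHopfAlgebra.IsLeftCointegral l,
      ∀ h : H, QuasiHopfAlgebra.twistIdentityLeft l h = QuasiHopfAlgebra.twistIdentityRight μ l h,
      ∀ h : H, QuasiHopfAlgebra.uIdentityLeft l h = QuasiHopfAlgebra.uIdentityRight μ l h] := by
  refine ⟨QuasiHopfAlgebra.antipode_bijective, ?_⟩
  tfae_have 1 ↔ 3 := QuasiHopfAlgebra.isLeftCointegral_iff_uIdentity hμ l
  tfae_have 2 ↔ 3 := QuasiHopfAlgebra.twistIdentity_iff_uIdentity μ l
  tfae_finish
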